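/- Let $\mu$ be the normalised Haar measure on $\mathrm{SU}(2)$, let ${\bm Z}_1,{\bm Z}_2,{\bm Z}_3$ be the left-invariant vector fields on $\mathrm{SU}(2)$ generated by $-\tfrac{i}{2}\sigma_k$ ($\sigma_k$ the Pauli matrices), so that $[{\bm Z}_i,{\bm Z}_j]=\epsilon_{ijk}{\bm Z}_k$, and put ${\bm X}_\pm=-({\bm Z}_2\pm i{\bm Z}_1)$, ${\bm Z}^\alpha={\bm Z}_1^{\alpha_1}{\bm Z}_2^{\alpha_2}{\bm Z}_3^{\alpha_3}$. For $\rho_\star>0$ and $0<\varepsilon<1$ let \[\underline{\mathcal N}_\varepsilon=\Big\{(\tau,\rho,g)\in\mathbb R\times\mathbb R\times\mathrm{SU}(2): -1\le\tau\le-1+\varepsilon,\ 0\le\rho\le\tfrac{2\rho_\star}{1-\tau}\Big\},\] \[\mathscr I^-_{\rho_\star}=\{\tau=-1,\ 0\le\rho\le\rho_\star\},\qquad \underline{\mathcal B}_\varepsilon=\Big\{-1\le\tau\le-1+\varepsilon,\ \rho=\tfrac{2\rho_\star}{1-\tau}\Big\},\] let $\mathrm{dv}=\mathrm d\tau\,\mathrm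 d\rho\,\mathrm d\mu$, and let $\mathrm d\underline{\mathcal B}$ be the measure induced on $\underline{\mathcal B}_\varepsilon$ by contracting $\mathrm{dv}$ with $\tfrac1{\sqrt2}\big((1+\tau)\partial_\tau-\rho\partial_\rho\big)$. For $m\in\mathbb N$ put \[\|f\|^2_{H^m(\underline{\mathcal N}_\varepsilon)}=\sum_{p'+q'+|\alpha|\le m}\int_{\underline{\mathcal N}_\varepsilon}|\partial_\rho^{p'}\partial_\tau^{q'}{\bm Z}^\alpha f|^2\,\mathrm{dv}.\] Let $m,p,q\in\mathbb N$ with $m+p<q$. Then there is a constant $C>0$ depending only on $m,p,q$ (in particular independent of $\varepsilon$) such that the following holds for all $\rho_\star>0$, $0<\varepsilon<1$ and $\Omega_\star>0$. Let $\psi,\psi_0,\psi_1,\psi_2$ be complex-valued functions of class $C^{m+p+q+1}$ in a neighbourhood of every point of $\underline{\mathcal N}_\varepsilon\cap\{\rho>0\}$ which satisfy on $\underline{\mathcal N}_\varepsilon\cap\{\rho>0\}$ the transport equations (the first-order form of the conformal wave equation near spatial infinity of Minkowski space) \begin{align*} (1+\tau)\partial_\tau\psi_2-\rho\partial_\rho\psi_2-\tfrac12{\bm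 X}_-\psi-{\bm X}_-\psi_1&=0,\\ (1-\tau)\partial_\tau\psi_1+\rho\partial_\rho\psi_1+\tfrac12\big((1-\tau)\partial_\tau\psi+\rho\partial_\rho\psi\big)-{\bm X}_+\psi_2-\tfrac12\psi-\psi_1&=0,\\ (1+\tau)\partial_\tau\psi_1-\rho\partial_\rho\psi_1-\tfrac12\big((1+\tau)\partial_\tau\psi-\rho\partial_\rho\psi\big)-{\bm X}_-\psi_0-\tfrac12\psi+\psi_1&=0,\\ (1-\tau)\partial_\tau\psi_0+\rho\partial_\rho\psi_0+\tfrac12{\bm X}_+\psi-{\bm X}_+\psi_1&=0, \end{align*} and suppose that for each $f\in\{\psi,\psi_0,\psi_1,\psi_2\}$ the characteristic data satisfy \[\sum_{p'+q'+|\alpha|\le m}\Big(\int_{\mathscr I^-_{\rho_\star}}|\partial_\rho^{p'}\partial_\tau^{q'}{\bm Z}^\alpha\partial_\tau^q\partial_\rho^pf|^2\,\mathrm d\rho\,\mathrm d\mu+\int_{\underline{\mathcal B}_\varepsilon}|\partial_\rho^{p'}\partial_\tau^{q'}{\bm Z}^\alpha\partial_\tau^q\partial_\rho^pf|^2\,\mathrm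 d\underline{\mathcal B}\Big)\le\Omega_\star.\] Then \[\sum_{k\in\{0,1\}}\|\partial_\rho^p\partial_\tau^q\psi_k\|^2_{H^m(\underline{\mathcal N}_\varepsilon)}+\|\partial_\rho^p\partial_\tau^q\psi\|^2_{H^m(\underline{\mathcal N}_\varepsilon)}\le C\,\Omega_\star.\] -/

import Mathlib

open MeasureTheory Topology
open scoped ENNReal

noncomputable section

namespace FriedrichCylinder

/-! ### The group `SU(2)`, its normalised Haar measure and its left-invariant frame -/

/-- The group `SU(2)`, with the topology inherited from the complex `2 × 2` matrices. -/
abbrev SU2 : Type := ↥(Matrix.specialUnitaryGroup (Fin 2) ℂ)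

instance : MeasurableSpace SU2 := borel SU2

instance : BorelSpace SU2 := ⟨rfl⟩

instance : IsTopologicalGroup SU2 where
  continuous_inv := by
    refine Continuous.subtype_mk (f := fun g : SU2 => star (g : Matrix (Fin 2) (Fin 2) ℂ)) ?_ _
    exact continuous_subtype_val.star

theorem isCompact_specialUnitary :
    IsCompact (Matrix.specialUnitaryGroup (Fin 2) ℂ : Set (Matrix (Fin 2) (Fin 2) ℂ)) := by
  have hK : IsCompact {A : Matrix (Fin 2) (Fin 2) ℂ |
      ∀ i, A i ∈ {v : Fin 2 → ℂ | ∀ j, v j ∈ Metric.closedBall (0 : ℂ) 1}} :=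
    isCompact_pi_infinite fun _ => isCompact_pi_infinite fun _ => isCompact_closedBall _ _
  refine hK.of_isClosed_subset ?_ ?_
  · have : (Matrix.specialUnitaryGroup (Fin 2) ℂ : Set (Matrix (Fin 2) (Fin 2) ℂ))
        = {A | A * star A = 1} ∩ {A | A.det = 1} := by
      ext A
      simp only [SetLike.mem_coe, Matrix.mem_specialUnitaryGroup_iff, Matrix.mem_unitaryGroup_iff,
        Set.mem_inter_iff, Set.mem_ofPred_eq]
    rw [this]
    exact (isClosed_eq (continuous_id.mul continuous_id.star) continuous_const).inter
      (isClosed_eq (continuous_id.matrix_det) continuous_const)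
  · intro A hA i j
    have h := entry_norm_bound_of_unitary (Matrix.specialUnitaryGroup_le_unitaryGroup hA) i j
    simpa using h

instance : CompactSpace SU2 := isCompact_iff_compactSpace.mp isCompact_specialUnitary

/-- The Haar measure `μ` on `SU(2)`, normalised to total mass `1`. -/
def haarSU2 : Measure SU2 := Measure.haarMeasure ⊤

/-- The Pauli matrices `σ₁, σ₂, σ₃` (indexed by `0, 1, 2`). -/
def pauli : Fin 3 → Matrix (Fin 2) (Fin 2) ℂ :=
  ![!![0, 1; 1, 0], !![0, -Complex.I; Complex.I, 0], !![1, 0; 0, -1]]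

/-- The matrix `cos (s/2) 1 - i sin (s/2) σₖ = exp (s uₖ)`, where `uₖ = -(i/2) σₖ ∈ su(2)`. -/
def rotMatrix (k : Fin 3) (s : ℝ) : Matrix (Fin 2) (Fin 2) ℂ :=
  (Real.cos (s / 2) : ℂ) • (1 : Matrix (Fin 2) (Fin 2) ℂ)
    - (Complex.I * (Real.sin (s / 2) : ℂ)) • pauli k

theorem rotMatrix_mem (k : Fin 3) (s : ℝ) :
    rotMatrix k s ∈ Matrix.specialUnitaryGroup (Fin 2) ℂ := by
  have h : (Real.cos (s / 2) : ℂ) ^ 2 + (Real.sin (s / 2) : ℂ) ^ 2 = 1 := by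
    exact_mod_cast Real.cos_sq_add_sin_sq (s / 2)
  have hI : Complex.I ^ 2 = -1 := Complex.I_sq
  rw [Matrix.mem_specialUnitaryGroup_iff, Matrix.mem_unitaryGroup_iff]
  unfold rotMatrix
  generalize Real.cos (s / 2) = c at *
  generalize Real.sin (s / 2) = d at *
  constructor
  · ext i j
    fin_cases k <;> fin_cases i <;> fin_cases j <;>
      simp [pauli, Matrix.mul_apply, Fin.sum_univ_two, Matrix.star_apply] <;> grind
  · fin_cases k <;> simp [pauli, Matrix.det_fin_two] <;> grind

/-- The one-parameter subgroup `s ↦ exp (s uₖ)` of `SU(2)`, with `uₖ = -(i/2) σₖ`. -/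
def rot (k : Fin 3) (s : ℝ) : SU2 := ⟨rotMatrix k s, rotMatrix_mem k s⟩

/-! ### Spacetime points and differential operators -/

/-- Points `(τ, ρ, g)` of `ℝ × ℝ × SU(2)`. -/
abbrev Pt : Type := ℝ × ℝ × SU2

/-- The measure `dv = dτ dρ dμ`. -/
def dv : Measure Pt := (volume : Measure ℝ).prod ((volume : Measure ℝ).prod haarSU2)

/-- The partial derivative `∂_τ`. -/
def dTau (f : Pt → ℂ) : Pt → ℂ := fun x => deriv (fun t : ℝ => f (t, x.2.1, x.2.2)) x.1

/-- The partial derivative `∂_ρ`. -/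
def dRho (f : Pt → ℂ) : Pt → ℂ := fun x => deriv (fun r : ℝ => f (x.1, r, x.2.2)) x.2.1

/-- The left-invariant vector field `Zₖ` generated by `uₖ`; `[Z₁, Z₂] = Z₃` and cyclically. -/
def Z (k : Fin 3) (f : Pt → ℂ) : Pt → ℂ :=
  fun x => deriv (fun s : ℝ => f (x.1, x.2.1, x.2.2 * rot k s)) 0

/-- `X₊ = -(Z₂ + i Z₁)`. -/
def XPlus (f : Pt → ℂ) : Pt → ℂ := fun x => -(Z 1 f x + Complex.I * Z 0 f x)

/-- `X₋ = -(Z₂ - i Z₁)`. -/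
def XMinus (f : Pt → ℂ) : Pt → ℂ := fun x => -(Z 1 f x - Complex.I * Z 0 f x)

/-- `Z^α = Z₁^α₁ Z₂^α₂ Z₃^α₃`. -/
def ZPow (α : ℕ × ℕ × ℕ) (f : Pt → ℂ) : Pt → ℂ :=
  (Z 0)^[α.1] ((Z 1)^[α.2.1] ((Z 2)^[α.2.2] f))

/-- `D^{p,q,α} = ∂_ρ^p ∂_τ^q Z^α`. -/
def D (p q : ℕ) (α : ℕ × ℕ × ℕ) (f : Pt → ℂ) : Pt → ℂ := dRho^[p] (dTau^[q] (ZPow α f))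

/-- The set of all `(p', q', α) ∈ ℕ × ℕ × ℕ³` with `p' + q' + |α| ≤ m`. -/
def multiIndices (m : ℕ) : Finset (ℕ × ℕ × (ℕ × ℕ × ℕ)) :=
  (Finset.range (m + 1) ×ˢ Finset.range (m + 1) ×ˢ
    (Finset.range (m + 1) ×ˢ Finset.range (m + 1) ×ˢ Finset.range (m + 1))).filter
      fun i => i.1 + i.2.1 + (i.2.2.1 + i.2.2.2.1 + i.2.2.2.2) ≤ m

/-- `ℝ × ℝ × SU(2)` as a subset of the vector space `ℝ × ℝ × M₂(ℂ)`. -/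
def ambient (x : Pt) : ℝ × ℝ × (Fin 2 → Fin 2 → ℂ) := (x.1, x.2.1, fun i j => x.2.2.1 i j)

/-- `f` is of class `C^n` in a neighbourhood of the point `x` of the manifold `ℝ × ℝ × SU(2)`:
near `x` it is the restriction of a `C^n` function on `ℝ × ℝ × M₂(ℂ)`. -/
def IsCkAt (n : ℕ) (f : Pt → ℂ) (x : Pt) : Prop :=
  ∃ F : ℝ × ℝ × (Fin 2 → Fin 2 → ℂ) → ℂ,
    ContDiffAt ℝ n F (ambient x) ∧ ∀ᶠ y in 𝓝 x, f y = F (ambient y)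

/-! ### The lower domain, the equations and the norms -/

/-- The slab bounded by past null infinity `τ = -1`, the incoming null hypersurface
`ρ = 2ρ⋆/(1-τ)`, the hypersurface `τ = -1+ε`, and the cylinder `ρ = 0`. -/
def lowerDomain (ρs ε : ℝ) : Set Pt :=
  {x | -1 ≤ x.1 ∧ x.1 ≤ -1 + ε ∧ 0 ≤ x.2.1 ∧ x.2.1 ≤ 2 * ρs / (1 - x.1)}

/-- The transport equations `A₀ = B₀ = A₁ = B₁ = 0` at the point `x`. -/
def TransportEqAt (ψ ψ₀ ψ₁ ψ₂ : Pt → ℂ) (x : Pt) : Prop :=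
  let τ : ℂ := (x.1 : ℂ)
  let ρ : ℂ := (x.2.1 : ℂ)
  ((1 + τ) * dTau ψ₂ x - ρ * dRho ψ₂ x - 1 / 2 * XMinus ψ x - XMinus ψ₁ x = 0) ∧
  ((1 - τ) * dTau ψ₁ x + ρ * dRho ψ₁ x + 1 / 2 * ((1 - τ) * dTau ψ x + ρ * dRho ψ x)
    - XPlus ψ₂ x - 1 / 2 * ψ x - ψ₁ x = 0) ∧
  ((1 + τ) * dTau ψ₁ x - ρ * dRho ψ₁ x - 1 / 2 * ((1 + τ) * dTau ψ x - ρ * dRho ψ x)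
    - XMinus ψ₀ x - 1 / 2 * ψ x + ψ₁ x = 0) ∧
  ((1 - τ) * dTau ψ₀ x + ρ * dRho ψ₀ x + 1 / 2 * XPlus ψ x - XPlus ψ₁ x = 0)

/-- The squared norm `‖f‖²_{H^m(S)} = ∑_{p'+q'+|α| ≤ m} ∫_S |∂_ρ^{p'} ∂_τ^{q'} Z^α f|² dv`,
with value `∞` when an integral diverges. -/
def sobolevSq (m : ℕ) (S : Set Pt) (f : Pt → ℂ) : ℝ≥0∞ :=
  ∑ i ∈ multiIndices m, ∫⁻ x in S, ‖D i.1 i.2.1 i.2.2 f x‖ₑ ^ 2 ∂dv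

/-- `∑_{p'+q'+|α| ≤ m} ∫ |∂_ρ^{p'} ∂_τ^{q'} Z^α f|² dρ dμ` over the portion `0 ≤ ρ ≤ ρ⋆` of past
null infinity `τ = -1`. -/
def scriDataSq (m : ℕ) (ρs : ℝ) (f : Pt → ℂ) : ℝ≥0∞ :=
  ∑ i ∈ multiIndices m, ∫⁻ y in Set.Icc 0 ρs ×ˢ (Set.univ : Set SU2),
    ‖D i.1 i.2.1 i.2.2 f (-1, y.1, y.2)‖ₑ ^ 2 ∂((volume : Measure ℝ).prod haarSU2)

/-- The density with respect to `dτ dμ` of the measure which `dv` induces on the null hypersurface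
`ρ = 2ρ⋆/(1-τ)`, that is, of the contraction of `dτ ∧ dρ ∧ dμ` with the transverse null vector
`e₁₁' = ((1+τ) ∂_τ - ρ ∂_ρ)/√2`: it is `((1+τ) dρ/dτ + ρ)/√2`, where `dρ/dτ = 2ρ⋆/(1-τ)²`. -/
def nullDensity (ρs τ : ℝ) : ℝ :=
  ((1 + τ) * (2 * ρs / (1 - τ) ^ 2) + 2 * ρs / (1 - τ)) / Real.sqrt 2

/-- `∑_{p'+q'+|α| ≤ m} ∫ |∂_ρ^{p'} ∂_τ^{q'} Z^α f|²` over the portion `-1 ≤ τ ≤ -1+ε` of the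
incoming null hypersurface `ρ = 2ρ⋆/(1-τ)`, with respect to the measure induced by `dv`. -/
def nullDataSq (m : ℕ) (ρs ε : ℝ) (f : Pt → ℂ) : ℝ≥0∞ :=
  ∑ i ∈ multiIndices m, ∫⁻ y in Set.Icc (-1) (-1 + ε) ×ˢ (Set.univ : Set SU2),
    ‖D i.1 i.2.1 i.2.2 f (y.1, 2 * ρs / (1 - y.1), y.2)‖ₑ ^ 2
      * ENNReal.ofReal (nullDensity ρs y.1) ∂((volume : Measure ℝ).prod haarSU2)

end FriedrichCylinder

end

open FriedrichCylinder

open MeasureTheory Topology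
open scoped ENNReal

noncomputable section

namespace FriedrichCylinder

/-! ### Differentiation along the frame `∂_τ, ∂_ρ, Z₁, Z₂, Z₃` -/

/-! With a = ψ₁ + ψ/2 and b = ψ₁ - ψ/2, the four equations split into two uncoupled pairs (u, w) of
the same shape, namely (ψ₂, a) and (b, ψ₀): ((1+τ)∂_τ - ρ∂_ρ) u = X₋w - κu, ((1-τ)∂_τ + ρ∂_ρ) w =
X₊u + κ'w, with (κ, κ') = (0, 1) and (1, 0) respectively.

Apply ∂_ρ^P ∂_τ^N Z^α with P = p'+p and N = q'+q. The null derivatives are homogeneous under the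
coordinate derivatives, so commuting with them only adds the multiples -(N-P)u and +(N-P)w
(`D_nullDer`). Since P ≤ m+p < q ≤ N, the first is a genuine damping of u with rate at least 1. This
is the whole role of m+p < q: the coefficient 1+τ degenerates at past null infinity, so no
exponential weight in τ could control u there. The coefficient 1-τ does not degenerate, so the
growing term in w is a matter for Gronwall. Commuting with X₊ and X₋ produces angular derivatives of
order at most |α| (`exists_D_XPlus`, `exists_D_XMinus`), of u in the w equation and of w in the u
equation. Every error is therefore a product of a u with a w, and it is absorbed by the damping of u
and the weight on w (`sum_coupling_le`).

The energy identity is written in the coordinate s = ρ(1-τ)/2, in which the domain is a rectangle,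
the second null derivative is (1-τ)∂_τ, and the incoming null hypersurface is s = ρ⋆. The multiplier
2 exp(-λ(τ+1))/(1-τ) gives a current whose coefficient derivatives cancel except for the exponential
(`div_current`). Its flux sees only w at τ = -1 and only u at s = ρ⋆; the fluxes through the top and
through the inner side s = δ > 0 have a favourable sign (`flux_balance`). Integrating gives
`energy_box`, undoing the change of variables gives `energy_wedge`, and letting δ tend to 0 gives
`energy_lowerDomain`, with no condition needed at ρ = 0. Because 0 ≤ τ+1 ≤ 1, the weight lies
between exp(-λ) and 1, so the constant does not see ε. `pair_estimate` puts commutation and energy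
together, and ψ₁ and ψ are recovered from a and b. -/

/-- The ambient vector space `ℝ × ℝ × M₂(ℂ)`. -/
abbrev Amb : Type := ℝ × ℝ × (Fin 2 → Fin 2 → ℂ)

/-- The five directions of the frame. -/
inductive Dir
  | tau
  | rho
  | ang (k : Fin 3)

/-- The integral curve through `x` in a given direction. -/
def Dir.curve : Dir → Pt → ℝ → Pt
  | .tau, x, t => (t, x.2.1, x.2.2)
  | .rho, x, t => (x.1, t, x.2.2)
  | .ang k, x, t => (x.1, x.2.1, x.2.2 * rot k t)

/-- The parameter at which `Dir.curve` passes through `x`. -/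
def Dir.base : Dir → Pt → ℝ
  | .tau, x => x.1
  | .rho, x => x.2.1
  | .ang _, _ => 0

/-- The derivative in a given direction of the frame. -/
def Dir.op (d : Dir) (f : Pt → ℂ) : Pt → ℂ :=
  fun x => deriv (fun t => f (d.curve x t)) (d.base x)

theorem op_tau : Dir.op .tau = dTau := rfl
theorem op_rho : Dir.op .rho = dRho := rfl
theorem op_ang (k : Fin 3) : Dir.op (.ang k) = Z k := rfl

theorem rot_zero (k : Fin 3) : rot k 0 = 1 := by
  apply Subtype.ext
  simp [rot, rotMatrix]

theorem Dir.curve_base (d : Dir) (x : Pt) : d.curve x (d.base x) = x := by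
  cases d <;> simp [Dir.curve, Dir.base, rot_zero]

theorem continuous_rot (k : Fin 3) : Continuous (rot k) := by
  refine Continuous.subtype_mk (f := rotMatrix k) ?_ _
  unfold rotMatrix
  fun_prop

theorem Dir.continuous_curve (d : Dir) (x : Pt) : Continuous (d.curve x) := by
  cases d with
  | tau => exact continuous_id.prodMk continuous_const
  | rho => exact continuous_const.prodMk (continuous_id.prodMk continuous_const)
  | ang k =>
    exact continuous_const.prodMk
      (continuous_const.prodMk (continuous_const.mul (continuous_rot k)))

/-- The element `-(i/2) σₖ` of `su(2)`. -/
def gen (k : Fin 3) : Matrix (Fin 2) (Fin 2) ℂ := (-(Complex.I / 2)) • pauli k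

/-- Right multiplication by a matrix. -/
def rmul (u : Matrix (Fin 2) (Fin 2) ℂ) : (Fin 2 → Fin 2 → ℂ) →L[ℝ] (Fin 2 → Fin 2 → ℂ) :=
  LinearMap.toContinuousLinearMap
    { toFun := fun M i j => ∑ l, M i l * u l j
      map_add' := fun M N => by
        ext i j; simp [add_mul, Finset.sum_add_distrib]
      map_smul' := fun r M => by
        ext i j; simp [mul_assoc] }

theorem rmul_apply (u : Matrix (Fin 2) (Fin 2) ℂ) (M : Fin 2 → Fin 2 → ℂ) :
    rmul u M = fun i j => ∑ l, M i l * u l j := rfl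

/-- The linear part of the extension of a frame field to the ambient space. -/
def Dir.lin : Dir → Amb →L[ℝ] Amb
  | .tau => 0
  | .rho => 0
  | .ang k => ((0 : Amb →L[ℝ] ℝ).prod ((0 : Amb →L[ℝ] ℝ).prod
      ((rmul (gen k)).comp ((ContinuousLinearMap.snd ℝ ℝ _).comp
        (ContinuousLinearMap.snd ℝ ℝ _)))))

/-- The constant part of the extension of a frame field to the ambient space. -/
def Dir.cst : Dir → Amb
  | .tau => (1, 0, 0)
  | .rho => (0, 1, 0)
  | .ang _ => 0

theorem continuous_ambient : Continuous ambient := by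
  have h : Continuous fun x : Pt => (x.2.2 : Matrix (Fin 2) (Fin 2) ℂ) := by fun_prop
  exact continuous_fst.prodMk ((continuous_fst.comp continuous_snd).prodMk h)

theorem hasDerivAt_rotMatrix (k : Fin 3) (i j : Fin 2) :
    HasDerivAt (fun t => rotMatrix k t i j) (gen k i j) 0 := by
  have h2 : HasDerivAt (fun t : ℝ => t / 2) (1 / 2) 0 := (hasDerivAt_id _).div_const 2
  have hc := (h2.cos).ofReal_comp
  have hs := (h2.sin).ofReal_comp
  have := (hc.mul_const ((1 : Matrix (Fin 2) (Fin 2) ℂ) i j)).sub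
    ((hs.const_mul Complex.I).mul_const (pauli k i j))
  have e : gen k i j = ((-Real.sin (0 / 2) * (1 / 2) : ℝ) : ℂ) *
      (1 : Matrix (Fin 2) (Fin 2) ℂ) i j -
      Complex.I * ((Real.cos (0 / 2) * (1 / 2) : ℝ) : ℂ) * pauli k i j := by
    simp only [gen, Matrix.smul_apply, smul_eq_mul, zero_div, Real.sin_zero, Real.cos_zero]
    push_cast
    ring
  rw [e]
  exact this

theorem Dir.hasDerivAt_ambient (d : Dir) (x : Pt) :
    HasDerivAt (fun t => ambient (d.curve x t)) (d.cst + d.lin (ambient x)) (d.base x) := by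
  cases d with
  | tau =>
    have := (hasDerivAt_id x.1).prodMk
      (hasDerivAt_const x.1 ((x.2.1, fun i j => x.2.2.1 i j) : ℝ × (Fin 2 → Fin 2 → ℂ)))
    have e : Dir.tau.cst + Dir.tau.lin (ambient x) = (1, 0) := by simp [Dir.cst, Dir.lin]
    rw [e]
    exact this
  | rho =>
    have := (hasDerivAt_const x.2.1 x.1).prodMk ((hasDerivAt_id x.2.1).prodMk
      (hasDerivAt_const x.2.1 ((fun i j => x.2.2.1 i j) : (Fin 2 → Fin 2 → ℂ))))
    have e : Dir.rho.cst + Dir.rho.lin (ambient x) = (0, 1, 0) := by simp [Dir.cst, Dir.lin]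
    rw [e]
    exact this
  | ang k =>
    have h3 : HasDerivAt (fun t => fun i j => (x.2.2 * rot k t).1 i j)
        (rmul (gen k) (fun i j => x.2.2.1 i j)) 0 := by
      rw [hasDerivAt_pi]; intro i
      rw [hasDerivAt_pi]; intro j
      simp only [rmul_apply, Submonoid.coe_mul, Matrix.mul_apply]
      exact HasDerivAt.fun_sum fun l _ => (hasDerivAt_rotMatrix k l j).const_mul _
    have := (hasDerivAt_const (0 : ℝ) x.1).prodMk ((hasDerivAt_const (0 : ℝ) x.2.1).prodMk h3)
    have e : (Dir.ang k).cst + (Dir.ang k).lin (ambient x) =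
        (0, 0, rmul (gen k) (fun i j => x.2.2.1 i j)) := by
      simp [Dir.cst, Dir.lin, ambient]
    rw [e]
    exact this

/-! ### Germs of functions of class `C^n` -/

theorem IsCkAt.congr {n : ℕ} {f g : Pt → ℂ} {x : Pt} (hf : IsCkAt n f x) (h : g =ᶠ[𝓝 x] f) :
    IsCkAt n g x := by
  obtain ⟨F, hF, hfF⟩ := hf
  exact ⟨F, hF, h.trans hfF⟩

theorem IsCkAt.of_le {n m : ℕ} {f : Pt → ℂ} {x : Pt} (hf : IsCkAt n f x) (h : m ≤ n) :
    IsCkAt m f x := by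
  obtain ⟨F, hF, hfF⟩ := hf
  exact ⟨F, hF.of_le (by exact_mod_cast h), hfF⟩

theorem IsCkAt.eventually {n : ℕ} {f : Pt → ℂ} {x : Pt} (hf : IsCkAt n f x) :
    ∀ᶠ y in 𝓝 x, IsCkAt n f y := by
  obtain ⟨F, hF, hfF⟩ := hf
  have h1 := continuous_ambient.continuousAt.eventually (hF.eventually (by simp))
  filter_upwards [h1, hfF.eventually_nhds] with y h1 h2
  exact ⟨F, h1, h2⟩

theorem IsCkAt.continuousAt {n : ℕ} {f : Pt → ℂ} {x : Pt} (hf : IsCkAt n f x) :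
    ContinuousAt f x := by
  obtain ⟨F, hF, hfF⟩ := hf
  exact (ContinuousAt.comp (f := ambient) (x := x) hF.continuousAt
    continuous_ambient.continuousAt).congr
    (Filter.EventuallyEq.symm hfF)

/-- Each frame field is the restriction of an affine vector field on the ambient space, so
differentiation along the frame becomes a Fréchet derivative of the extension and calculus on `SU2`
needs no charts. -/
theorem hasDerivAt_comp_curve {F : Amb → ℂ} {f : Pt → ℂ} {x : Pt}
    (hF : DifferentiableAt ℝ F (ambient x)) (h : ∀ᶠ y in 𝓝 x, f y = F (ambient y)) (d : Dir) :
    HasDerivAt (fun t => f (d.curve x t)) (fderiv ℝ F (ambient x) (d.cst + d.lin (ambient x)))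
      (d.base x) := by
  have hx : ambient x = ambient (d.curve x (d.base x)) := by rw [d.curve_base]
  have h1 := HasFDerivAt.comp_hasDerivAt_of_eq (d.base x) hF.hasFDerivAt
    (d.hasDerivAt_ambient x) hx
  refine h1.congr_of_eventuallyEq ?_
  have := (d.continuous_curve x).continuousAt (x := d.base x)
  rw [ContinuousAt, d.curve_base] at this
  exact this.eventually h

theorem IsCkAt.differentiableAt {f : Pt → ℂ} {x : Pt} (hf : IsCkAt 1 f x) (d : Dir) :
    DifferentiableAt ℝ (fun t => f (d.curve x t)) (d.base x) := by
  obtain ⟨F, hF, hfF⟩ := hf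
  exact (hasDerivAt_comp_curve (hF.differentiableAt (by simp)) hfF d).differentiableAt

theorem op_eventuallyEq_fderiv {F : Amb → ℂ} {f : Pt → ℂ} {x : Pt}
    (hF : ContDiffAt ℝ 1 F (ambient x)) (h : ∀ᶠ y in 𝓝 x, f y = F (ambient y)) (d : Dir) :
    ∀ᶠ y in 𝓝 x, d.op f y = fderiv ℝ F (ambient y) (d.cst + d.lin (ambient y)) := by
  have h1 := continuous_ambient.continuousAt.eventually (hF.eventually (by simp))
  filter_upwards [h1, h.eventually_nhds] with y h1 h2
  exact (hasDerivAt_comp_curve (h1.differentiableAt (by simp)) h2 d).deriv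

theorem contDiffAt_fderiv_dir {n : ℕ} {F : Amb → ℂ} {e : Amb}
    (hF : ContDiffAt ℝ (n + 1 : ℕ) F e) (d : Dir) :
    ContDiffAt ℝ n (fun e => fderiv ℝ F e (d.cst + d.lin e)) e := by
  have h1 : ContDiffAt ℝ n (fderiv ℝ F) e := hF.fderiv_right (by simp)
  exact h1.clm_apply (contDiffAt_const.add d.lin.contDiff.contDiffAt)

/-- The derivative of the extension along the affine field is itself an extension, and only one
order of differentiability is lost. -/
theorem IsCkAt.op {n : ℕ} {f : Pt → ℂ} {x : Pt} (hf : IsCkAt (n + 1) f x) (d : Dir) :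
    IsCkAt n (d.op f) x := by
  obtain ⟨F, hF, hfF⟩ := hf
  exact ⟨_, contDiffAt_fderiv_dir hF d,
    op_eventuallyEq_fderiv (hF.of_le (by simp)) hfF d⟩

theorem op_congr {f g : Pt → ℂ} {x : Pt} (h : f =ᶠ[𝓝 x] g) (d : Dir) :
    d.op f =ᶠ[𝓝 x] d.op g := by
  filter_upwards [h.eventually_nhds] with y hy
  have := (d.continuous_curve y).continuousAt (x := d.base y)
  rw [ContinuousAt, d.curve_base] at this
  exact Filter.EventuallyEq.deriv_eq (this.eventually hy)

theorem IsCkAt.op_iterate {n r : ℕ} {f : Pt → ℂ} {x : Pt} (hf : IsCkAt (n + r) f x) (d : Dir) :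
    IsCkAt n (d.op^[r] f) x := by
  induction r generalizing n with
  | zero => exact hf
  | succ r ih =>
    rw [Function.iterate_succ_apply']
    exact (ih (n := n + 1) (hf.of_le (by omega))).op d

theorem op_iterate_congr {f g : Pt → ℂ} {x : Pt} (h : f =ᶠ[𝓝 x] g) (d : Dir) (r : ℕ) :
    d.op^[r] f =ᶠ[𝓝 x] d.op^[r] g := by
  induction r with
  | zero => exact h
  | succ r ih =>
    rw [Function.iterate_succ_apply', Function.iterate_succ_apply']
    exact op_congr ih d

/-! ### Algebraic operations on germs -/

theorem IsCkAt.add {n : ℕ} {f g : Pt → ℂ} {x : Pt} (hf : IsCkAt n f x) (hg : IsCkAt n g x) :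
    IsCkAt n (fun y => f y + g y) x := by
  obtain ⟨F, hF, hfF⟩ := hf
  obtain ⟨G, hG, hgG⟩ := hg
  refine ⟨fun e => F e + G e, hF.add hG, ?_⟩
  filter_upwards [hfF, hgG] with y h1 h2
  rw [h1, h2]

theorem IsCkAt.mul {n : ℕ} {f g : Pt → ℂ} {x : Pt} (hf : IsCkAt n f x) (hg : IsCkAt n g x) :
    IsCkAt n (fun y => f y * g y) x := by
  obtain ⟨F, hF, hfF⟩ := hf
  obtain ⟨G, hG, hgG⟩ := hg
  refine ⟨fun e => F e * G e, hF.mul hG, ?_⟩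
  filter_upwards [hfF, hgG] with y h1 h2
  rw [h1, h2]

theorem IsCkAt.conj {n : ℕ} {f : Pt → ℂ} {x : Pt} (hf : IsCkAt n f x) :
    IsCkAt n (fun y => (starRingEnd ℂ) (f y)) x := by
  obtain ⟨F, hF, hfF⟩ := hf
  refine ⟨fun e => (starRingEnd ℂ) (F e), ?_, ?_⟩
  · exact Complex.conjCLE.contDiff.contDiffAt.comp _ hF
  · filter_upwards [hfF] with y h1
    rw [h1]

/-- A smooth function of `(τ, ρ)` is smooth on `ℝ × ℝ × SU(2)`. -/
theorem IsCkAt.of_coord {n : ℕ} {φ : ℝ × ℝ → ℂ} {x : Pt}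
    (hφ : ContDiffAt ℝ n φ (x.1, x.2.1)) : IsCkAt n (fun y => φ (y.1, y.2.1)) x := by
  refine ⟨fun e => φ (e.1, e.2.1), ?_, Filter.Eventually.of_forall fun y => rfl⟩
  exact ContDiffAt.comp (ambient x) (g := φ) (f := fun e : Amb => (e.1, e.2.1)) hφ
    (contDiff_fst.prodMk (contDiff_fst.comp contDiff_snd)).contDiffAt

theorem IsCkAt.const {n : ℕ} (c : ℂ) (x : Pt) : IsCkAt n (fun _ => c) x :=
  IsCkAt.of_coord (φ := fun _ => c) contDiffAt_const

theorem IsCkAt.const_mul {n : ℕ} {f : Pt → ℂ} {x : Pt} (hf : IsCkAt n f x) (c : ℂ) :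
    IsCkAt n (fun y => c * f y) x := (IsCkAt.const c x).mul hf

theorem IsCkAt.sub {n : ℕ} {f g : Pt → ℂ} {x : Pt} (hf : IsCkAt n f x) (hg : IsCkAt n g x) :
    IsCkAt n (fun y => f y - g y) x :=
  (hf.add (hg.const_mul (-1))).congr (Filter.Eventually.of_forall fun y => by ring)

theorem op_add {f g : Pt → ℂ} {x : Pt} (hf : IsCkAt 1 f x) (hg : IsCkAt 1 g x) (d : Dir) :
    d.op (fun y => f y + g y) =ᶠ[𝓝 x] fun y => d.op f y + d.op g y := by
  filter_upwards [hf.eventually, hg.eventually] with y hf hg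
  exact deriv_fun_add (hf.differentiableAt d) (hg.differentiableAt d)

theorem op_mul {f g : Pt → ℂ} {x : Pt} (hf : IsCkAt 1 f x) (hg : IsCkAt 1 g x) (d : Dir) :
    d.op (fun y => f y * g y) =ᶠ[𝓝 x] fun y => d.op f y * g y + f y * d.op g y := by
  filter_upwards [hf.eventually, hg.eventually] with y hf hg
  have := deriv_fun_mul (hf.differentiableAt d) (hg.differentiableAt d)
  simp only [d.curve_base] at this
  exact this

theorem op_conj {f : Pt → ℂ} {x : Pt} (hf : IsCkAt 1 f x) (d : Dir) :
    d.op (fun y => (starRingEnd ℂ) (f y)) =ᶠ[𝓝 x] fun y => (starRingEnd ℂ) (d.op f y) := by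
  filter_upwards [hf.eventually] with y hf
  have := (hf.differentiableAt d).hasDerivAt
  exact (Complex.conjCLE.hasFDerivAt.comp_hasDerivAt _ this).deriv

theorem op_const (c : ℂ) (d : Dir) : d.op (fun _ => c) = fun _ => 0 := by
  ext y; simp [Dir.op]

theorem op_const_mul {f : Pt → ℂ} {x : Pt} (hf : IsCkAt 1 f x) (c : ℂ) (d : Dir) :
    d.op (fun y => c * f y) =ᶠ[𝓝 x] fun y => c * d.op f y := by
  filter_upwards [op_mul (IsCkAt.const c x) hf d] with y h
  rw [h, op_const]; ring

theorem op_sub {f g : Pt → ℂ} {x : Pt} (hf : IsCkAt 1 f x) (hg : IsCkAt 1 g x) (d : Dir) :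
    d.op (fun y => f y - g y) =ᶠ[𝓝 x] fun y => d.op f y - d.op g y := by
  filter_upwards [hf.eventually, hg.eventually] with y hf hg
  exact deriv_fun_sub (hf.differentiableAt d) (hg.differentiableAt d)

theorem op_sum {ι : Type*} {s : Finset ι} {f : ι → Pt → ℂ} {x : Pt}
    (hf : ∀ i ∈ s, IsCkAt 1 (f i) x) (d : Dir) :
    d.op (fun y => ∑ i ∈ s, f i y) =ᶠ[𝓝 x] fun y => ∑ i ∈ s, d.op (f i) y := by
  have : ∀ᶠ y in 𝓝 x, ∀ i ∈ s, IsCkAt 1 (f i) y :=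
    (Filter.eventually_all_finset s).2 fun i hi => (hf i hi).eventually
  filter_upwards [this] with y hy
  exact deriv_fun_sum fun i hi => (hy i hi).differentiableAt d

theorem op_lincomb {ι : Type*} {s : Finset ι} {f : ι → Pt → ℂ} {x : Pt} (c : ι → ℂ)
    (hf : ∀ i ∈ s, IsCkAt 1 (f i) x) (d : Dir) :
    d.op (fun y => ∑ i ∈ s, c i * f i y) =ᶠ[𝓝 x] fun y => ∑ i ∈ s, c i * d.op (f i) y := by
  have h2 : ∀ᶠ y in 𝓝 x, ∀ i ∈ s, d.op (fun y => c i * f i y) y = c i * d.op (f i) y :=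
    (Filter.eventually_all_finset s).2 fun i hi => op_const_mul (hf i hi) (c i) d
  filter_upwards [op_sum (fun i hi => (hf i hi).const_mul (c i)) d, h2] with y h h2
  rw [h]
  exact Finset.sum_congr rfl h2

theorem op_iterate_lincomb {ι : Type*} {s : Finset ι} {f : ι → Pt → ℂ} {x : Pt} (c : ι → ℂ)
    (r : ℕ) (hf : ∀ i ∈ s, IsCkAt r (f i) x) (d : Dir) :
    d.op^[r] (fun y => ∑ i ∈ s, c i * f i y) =ᶠ[𝓝 x]
      fun y => ∑ i ∈ s, c i * d.op^[r] (f i) y := by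
  induction r with
  | zero => exact Filter.EventuallyEq.rfl
  | succ r ih =>
    simp only [Function.iterate_succ_apply']
    refine (op_congr (ih fun i hi => (hf i hi).of_le (by omega)) d).trans ?_
    exact op_lincomb c (fun i hi => ((hf i hi).of_le (by omega)).op_iterate d) d

/-! ### Commutators of the frame fields -/

/-- The commutator of two frame fields in terms of the ambient extension. -/
theorem op_comm_ambient {F : Amb → ℂ} {f : Pt → ℂ} {x : Pt}
    (hF : ContDiffAt ℝ 2 F (ambient x)) (h : ∀ᶠ y in 𝓝 x, f y = F (ambient y)) (d d' : Dir) :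
    ∀ᶠ y in 𝓝 x, d.op (d'.op f) y = d'.op (d.op f) y + fderiv ℝ F (ambient y)
      (d'.lin (d.cst + d.lin (ambient y)) - d.lin (d'.cst + d'.lin (ambient y))) := by
  have hF1 : ContDiffAt ℝ 1 F (ambient x) := hF.of_le (by norm_num)
  have hF2 : ContDiffAt ℝ (1 + 1 : ℕ) F (ambient x) := by exact_mod_cast hF
  -- A double derivative is the Hessian on the two fields plus the gradient on the derivative of one
  -- field along the other. The Hessian is symmetric, so only the gradient parts survive in the
  -- commutator.
  have key : ∀ d d' : Dir, ∀ᶠ y in 𝓝 x, d.op (d'.op f) y =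
      fderiv ℝ (fderiv ℝ F) (ambient y) (d.cst + d.lin (ambient y))
        (d'.cst + d'.lin (ambient y)) +
      fderiv ℝ F (ambient y) (d'.lin (d.cst + d.lin (ambient y))) := by
    intro d d'
    have hG := contDiffAt_fderiv_dir hF2 d'
    have hev := continuous_ambient.continuousAt.eventually (hF.eventually (by norm_num))
    filter_upwards [op_eventuallyEq_fderiv (by exact_mod_cast hG)
      (op_eventuallyEq_fderiv hF1 h d') d, hev] with y hy hev
    rw [hy]
    have h1 : DifferentiableAt ℝ (fderiv ℝ F) (ambient y) :=
      (hev.fderiv_right (m := 1) (by norm_num)).differentiableAt (by simp)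
    have h2 := h1.hasFDerivAt.clm_apply
      (((d'.lin).hasFDerivAt (x := ambient y)).const_add d'.cst)
    rw [h2.fderiv]
    simp only [add_apply, ContinuousLinearMap.comp_apply,
      ContinuousLinearMap.flip_apply]
    ring
  have hev := continuous_ambient.continuousAt.eventually (hF.eventually (by norm_num))
  filter_upwards [key d d', key d' d, hev] with y h1 h2 hev
  have hsymm : IsSymmSndFDerivAt ℝ F (ambient y) :=
    hev.isSymmSndFDerivAt (by simp)
  rw [h1, h2, hsymm.eq, map_sub]
  ring

/-- The structure constants of `su(2)`. -/
def structConst : Fin 3 → Fin 3 → Fin 3 → ℝ :=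
  ![![![0, 0, 0], ![0, 0, 1], ![0, -1, 0]],
    ![![0, 0, -1], ![0, 0, 0], ![1, 0, 0]],
    ![![0, 1, 0], ![-1, 0, 0], ![0, 0, 0]]]

theorem gen_comm (k l : Fin 3) :
    gen k * gen l - gen l * gen k = ∑ j, structConst k l j • gen j := by
  have hI : Complex.I ^ 2 = -1 := Complex.I_sq
  ext a b
  fin_cases k <;> fin_cases l <;> fin_cases a <;> fin_cases b <;>
    simp [gen, pauli, structConst, Fin.sum_univ_succ] <;> grind

/-- Right multiplication reverses the order of composition: applying `k` first and then `l`
multiplies by `gen k * gen l`. Hence the commutator of the generators appears with indices in the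
order `k`, `l`. -/
theorem lin_comm_ang (k l : Fin 3) (e : Amb) :
    (Dir.ang l).lin ((Dir.ang k).lin e) - (Dir.ang k).lin ((Dir.ang l).lin e) =
      ∑ j, structConst k l j • (Dir.ang j).lin e := by
  have h : rmul (gen l) (rmul (gen k) e.2.2) - rmul (gen k) (rmul (gen l) e.2.2) =
      ∑ j, structConst k l j • rmul (gen j) e.2.2 := by
    have key := congrArg (fun u => Matrix.of e.2.2 * u) (gen_comm k l)
    simp only [mul_sub, ← mul_assoc, Finset.mul_sum, Matrix.mul_smul] at key
    funext a b
    have := congrFun (congrFun key a) b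
    simpa only [Matrix.sub_apply, Matrix.mul_apply, Matrix.sum_apply, Matrix.smul_apply,
      Matrix.of_apply, rmul_apply, Pi.sub_apply, Finset.sum_apply, Pi.smul_apply] using this
  refine Prod.ext ?_ (Prod.ext ?_ ?_)
  · simp [Dir.lin, Prod.fst_sum]
  · simp [Dir.lin, Prod.fst_sum, Prod.snd_sum]
  · simpa [Dir.lin, Prod.snd_sum] using h

theorem op_ang_comm {f : Pt → ℂ} {x : Pt} (hf : IsCkAt 2 f x) (k l : Fin 3) :
    (Dir.ang k).op ((Dir.ang l).op f) =ᶠ[𝓝 x] fun y => (Dir.ang l).op ((Dir.ang k).op f) y +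
      ∑ j, (structConst k l j : ℂ) * (Dir.ang j).op f y := by
  obtain ⟨F, hF, hfF⟩ := hf
  have h1 : ∀ᶠ y in 𝓝 x, ∀ j ∈ (Finset.univ : Finset (Fin 3)), (Dir.ang j).op f y =
      fderiv ℝ F (ambient y) ((Dir.ang j).cst + (Dir.ang j).lin (ambient y)) :=
    (Filter.eventually_all_finset _).2 fun j _ =>
      op_eventuallyEq_fderiv (hF.of_le (by norm_num)) hfF _
  filter_upwards [op_comm_ambient hF hfF (.ang k) (.ang l), h1] with y h h1
  have hc : ∀ j, (Dir.ang j).cst = 0 := fun _ => rfl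
  simp only [hc, zero_add] at h h1
  rw [h, lin_comm_ang, map_sum]
  congr 1
  refine Finset.sum_congr rfl fun j hj => ?_
  rw [h1 j hj, map_smul, Complex.real_smul]

/-- Whether a direction is one of the two coordinate directions. -/
def Dir.IsCoord : Dir → Prop
  | .ang _ => False
  | _ => True

/-- A coordinate field is constant on the ambient space, and the linear part of any other frame
field annihilates it, so the bracket vanishes. -/
theorem op_comm_coord {f : Pt → ℂ} {x : Pt} (hf : IsCkAt 2 f x) {d d' : Dir} (hd : d.IsCoord) :
    d.op (d'.op f) =ᶠ[𝓝 x] d'.op (d.op f) := by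
  obtain ⟨F, hF, hfF⟩ := hf
  filter_upwards [op_comm_ambient hF hfF d d'] with y h
  rw [h]
  have : d'.lin (d.cst + d.lin (ambient y)) - d.lin (d'.cst + d'.lin (ambient y)) = 0 := by
    cases d <;> cases d' <;> simp_all [Dir.IsCoord, Dir.lin, Dir.cst]
  rw [this]; simp

/-! ### Ordered angular derivatives -/

/-- The order of a multi-index. -/
def deg (α : ℕ × ℕ × ℕ) : ℕ := α.1 + α.2.1 + α.2.2

/-- The multi-indices of order at most `n`. -/
def angIdx (n : ℕ) : Finset (ℕ × ℕ × ℕ) :=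
  (Finset.range (n + 1) ×ˢ Finset.range (n + 1) ×ˢ Finset.range (n + 1)).filter fun α => deg α ≤ n

theorem mem_angIdx {n : ℕ} {α : ℕ × ℕ × ℕ} : α ∈ angIdx n ↔ deg α ≤ n := by
  obtain ⟨a, b, c⟩ := α
  unfold angIdx
  rw [Finset.mem_filter]
  simp only [Finset.mem_product, Finset.mem_range, deg]
  omega

theorem ZPow_eq (α : ℕ × ℕ × ℕ) (f : Pt → ℂ) : ZPow α f =
    (Dir.ang 0).op^[α.1] ((Dir.ang 1).op^[α.2.1] ((Dir.ang 2).op^[α.2.2] f)) := rfl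

theorem IsCkAt.ZPow {n : ℕ} {α : ℕ × ℕ × ℕ} {f : Pt → ℂ} {x : Pt}
    (hf : IsCkAt (n + deg α) f x) : IsCkAt n (ZPow α f) x := by
  rw [ZPow_eq]
  refine IsCkAt.op_iterate (IsCkAt.op_iterate (IsCkAt.op_iterate (hf.of_le ?_) _) _) _
  unfold deg; omega

theorem ZPow_congr {f g : Pt → ℂ} {x : Pt} (h : f =ᶠ[𝓝 x] g) (α : ℕ × ℕ × ℕ) :
    ZPow α f =ᶠ[𝓝 x] ZPow α g :=
  op_iterate_congr (op_iterate_congr (op_iterate_congr h (.ang 2) _) (.ang 1) _) (.ang 0) _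

theorem ZPow_lincomb {ι : Type*} {s : Finset ι} {f : ι → Pt → ℂ} {x : Pt} (c : ι → ℂ)
    (α : ℕ × ℕ × ℕ) (hf : ∀ i ∈ s, IsCkAt (deg α) (f i) x) :
    ZPow α (fun y => ∑ i ∈ s, c i * f i y) =ᶠ[𝓝 x] fun y => ∑ i ∈ s, c i * ZPow α (f i) y := by
  have h (i) (hi : i ∈ s) : IsCkAt (α.1 + α.2.1 + α.2.2) (f i) x := hf i hi
  refine (op_iterate_congr (op_iterate_congr (op_iterate_lincomb c α.2.2
    (fun i hi => (h i hi).of_le (by omega)) (.ang 2)) (.ang 1) _) (.ang 0) _).trans ?_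
  refine (op_iterate_congr (op_iterate_lincomb c α.2.1
    (fun i hi => ((h i hi).of_le (by omega)).op_iterate _) (.ang 1)) (.ang 0) _).trans ?_
  exact op_iterate_lincomb c α.1
    (fun i hi => (((h i hi).of_le (by omega)).op_iterate _).op_iterate _) (.ang 0)

/-- Applied to functions of class `C^N`, the operator `T` is a fixed linear combination of the
ordered monomials `Z^α` with `|α| ≤ n`. -/
def Reduces (N n : ℕ) (T : (Pt → ℂ) → Pt → ℂ) : Prop :=
  ∃ c : ℕ × ℕ × ℕ → ℂ, ∀ f x, IsCkAt N f x →
    T f =ᶠ[𝓝 x] fun y => ∑ α ∈ angIdx n, c α * ZPow α f y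

theorem Reduces.mono {N N' n n' : ℕ} {T : (Pt → ℂ) → Pt → ℂ} (h : Reduces N n T) (hN : N ≤ N')
    (hn : n ≤ n') : Reduces N' n' T := by
  obtain ⟨c, hc⟩ := h
  refine ⟨fun α => if α ∈ angIdx n then c α else 0, fun f x hf => ?_⟩
  refine (hc f x (hf.of_le hN)).trans (Filter.Eventually.of_forall fun y => ?_)
  have hs : angIdx n ⊆ angIdx n' := fun α hα => mem_angIdx.2 ((mem_angIdx.1 hα).trans hn)
  simp only
  rw [← Finset.sum_subset hs]
  · exact Finset.sum_congr rfl fun α hα => by rw [if_pos hα]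
  · intro α _ hα
    rw [if_neg hα, zero_mul]

theorem Reduces.congr {N n : ℕ} {T T' : (Pt → ℂ) → Pt → ℂ} (h : Reduces N n T)
    (h' : ∀ f x, IsCkAt N f x → T' f =ᶠ[𝓝 x] T f) : Reduces N n T' := by
  obtain ⟨c, hc⟩ := h
  exact ⟨c, fun f x hf => (h' f x hf).trans (hc f x hf)⟩

theorem Reduces.lincomb {N n : ℕ} {ι : Type*} {s : Finset ι} {T : ι → (Pt → ℂ) → Pt → ℂ}
    (a : ι → ℂ) (h : ∀ i ∈ s, Reduces N n (T i)) :
    Reduces N n (fun f y => ∑ i ∈ s, a i * T i f y) := by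
  choose! c hc using h
  refine ⟨fun α => ∑ i ∈ s, a i * c i α, fun f x hf => ?_⟩
  filter_upwards [(Filter.eventually_all_finset s).2 fun i hi => hc i hi f x hf] with y hy
  rw [Finset.sum_congr rfl fun i hi => by rw [hy i hi]]
  simp only [Finset.mul_sum, Finset.sum_mul]
  rw [Finset.sum_comm]
  simp only [mul_assoc]

theorem Reduces.add {N n : ℕ} {T T' : (Pt → ℂ) → Pt → ℂ} (h : Reduces N n T)
    (h' : Reduces N n T') : Reduces N n (fun f y => T f y + T' f y) := by
  obtain ⟨c, hc⟩ := h
  obtain ⟨c', hc'⟩ := h'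
  refine ⟨fun α => c α + c' α, fun f x hf => ?_⟩
  filter_upwards [hc f x hf, hc' f x hf] with y h h'
  simp only [h, h', add_mul, Finset.sum_add_distrib]

theorem reduces_ZPow {N n : ℕ} {α : ℕ × ℕ × ℕ} (h : deg α ≤ n) : Reduces N n (ZPow α) := by
  refine ⟨fun β => if β = α then 1 else 0, fun f x _ => Filter.Eventually.of_forall fun y => ?_⟩
  simp [ite_mul, mem_angIdx.2 h]

/-- Reduces the action of `Z k` on an arbitrary reducible operator to its action on ordered
monomials. -/
theorem Reduces.op {N n n' : ℕ} {T : (Pt → ℂ) → Pt → ℂ} {k : Fin 3} (h : Reduces N n T)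
    (hN : n + 1 ≤ N) (hZ : ∀ α, deg α ≤ n → Reduces N n' (fun f => Z k (ZPow α f))) :
    Reduces N n' (fun f => Z k (T f)) := by
  obtain ⟨c, hc⟩ := h
  refine (Reduces.lincomb (s := angIdx n) c fun α hα => hZ α (mem_angIdx.1 hα)).congr
    fun f x hf => ?_
  refine (op_congr (hc f x hf) (.ang k)).trans ?_
  exact op_lincomb c (fun α hα => IsCkAt.ZPow (hf.of_le (by have := mem_angIdx.1 hα; omega))) _

theorem ZPow_mk (a b c : ℕ) (f : Pt → ℂ) :
    ZPow (a, b, c) f = (Z 0)^[a] ((Z 1)^[b] ((Z 2)^[c] f)) := rfl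

theorem Z_zero_ZPow (a b c : ℕ) (f : Pt → ℂ) :
    Z 0 (ZPow (a, b, c) f) = ZPow (a + 1, b, c) f := by
  rw [ZPow_mk, ZPow_mk, Function.iterate_succ_apply']

theorem Z_one_ZPow (b c : ℕ) (f : Pt → ℂ) : Z 1 (ZPow (0, b, c) f) = ZPow (0, b + 1, c) f := by
  rw [ZPow_mk, ZPow_mk, Function.iterate_zero, id_eq, id_eq, Function.iterate_succ_apply']

theorem Z_two_ZPow (c : ℕ) (f : Pt → ℂ) : Z 2 (ZPow (0, 0, c) f) = ZPow (0, 0, c + 1) f := by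
  rw [ZPow_mk, ZPow_mk, Function.iterate_zero, Function.iterate_zero, id_eq, id_eq, id_eq, id_eq,
    Function.iterate_succ_apply']

/-- Moving `Z_k` past the leading factor `Z_j` of an ordered monomial. -/
theorem reduces_Z_Z_ZPow {n : ℕ} {j k : Fin 3} {α : ℕ × ℕ × ℕ}
    (hα : ∀ l, Reduces (n + 1) (n + 1) (fun f => Z l (ZPow α f))) (hdeg : deg α ≤ n)
    (hj : ∀ β, deg β ≤ n + 1 → Reduces (n + 2) (n + 2) (fun f => Z j (ZPow β f))) :
    Reduces (n + 2) (n + 2) (fun f => Z k (Z j (ZPow α f))) := by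
  have h1 : Reduces (n + 2) (n + 2) (fun f => Z j (Z k (ZPow α f))) :=
    ((hα k).mono (by omega) le_rfl).op le_rfl hj
  have h2 : Reduces (n + 2) (n + 2)
      (fun f y => ∑ l, (structConst k j l : ℂ) * Z l (ZPow α f) y) :=
    Reduces.lincomb _ fun l _ => (hα l).mono (by omega) (by omega)
  refine (h1.add h2).congr fun f x hf => ?_
  exact op_ang_comm (IsCkAt.ZPow (hf.of_le (by omega))) k j

/-- The reordering half of the Poincaré–Birkhoff–Witt theorem for su(2). The outer induction is on
the order. At each order `Z 0` needs no reordering, `Z 1` has to pass only leading factors `Z 0`,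
and `Z 2` only `Z 0` or `Z 1`, so the three indices are treated in that order. Each exchange costs
bracket terms of lower order. -/
theorem reduces_Z_ZPow (n : ℕ) : ∀ (k : Fin 3) (α : ℕ × ℕ × ℕ), deg α ≤ n →
    Reduces (n + 1) (n + 1) (fun f => Z k (ZPow α f)) := by
  induction n with
  | zero =>
    rintro k ⟨a, b, c⟩ h
    have h' : a + b + c ≤ 0 := h
    obtain ⟨rfl, rfl, rfl⟩ : a = 0 ∧ b = 0 ∧ c = 0 := by omega
    obtain rfl | rfl | rfl : k = 0 ∨ k = 1 ∨ k = 2 := by omega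
    · simp only [Z_zero_ZPow]
      exact reduces_ZPow (by simp [deg])
    · simp only [Z_one_ZPow]
      exact reduces_ZPow (by simp [deg])
    · simp only [Z_two_ZPow]
      exact reduces_ZPow (by simp [deg])
  | succ n ih =>
    have h0 : ∀ α, deg α ≤ n + 1 → Reduces (n + 2) (n + 2) (fun f => Z 0 (ZPow α f)) := by
      rintro ⟨a, b, c⟩ h
      simp only [Z_zero_ZPow]
      exact reduces_ZPow (by simp only [deg] at h ⊢; omega)
    have h1 : ∀ α, deg α ≤ n + 1 → Reduces (n + 2) (n + 2) (fun f => Z 1 (ZPow α f)) := by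
      rintro ⟨a, b, c⟩ h
      rcases a with _ | a
      · simp only [Z_one_ZPow]
        exact reduces_ZPow (by simp only [deg] at h ⊢; omega)
      · have hd : deg (a, b, c) ≤ n := by simp only [deg] at h ⊢; omega
        simp only [← Z_zero_ZPow]
        exact reduces_Z_Z_ZPow (fun l => ih l _ hd) hd h0
    have h2 : ∀ α, deg α ≤ n + 1 → Reduces (n + 2) (n + 2) (fun f => Z 2 (ZPow α f)) := by
      rintro ⟨a, b, c⟩ h
      rcases a with _ | a
      · rcases b with _ | b
        · simp only [Z_two_ZPow]
          exact reduces_ZPow (by simp only [deg] at h ⊢; omega)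
        · have hd : deg (0, b, c) ≤ n := by simp only [deg] at h ⊢; omega
          simp only [← Z_one_ZPow]
          exact reduces_Z_Z_ZPow (fun l => ih l _ hd) hd h1
      · have hd : deg (a, b, c) ≤ n := by simp only [deg] at h ⊢; omega
        simp only [← Z_zero_ZPow]
        exact reduces_Z_Z_ZPow (fun l => ih l _ hd) hd h0
    intro k
    obtain rfl | rfl | rfl : k = 0 ∨ k = 1 ∨ k = 2 := by omega
    exacts [h0, h1, h2]

theorem exists_ZPow_eq_Z_ZPow (α : ℕ × ℕ × ℕ) : α = (0, 0, 0) ∨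
    ∃ j β, deg α = deg β + 1 ∧ ∀ f, ZPow α f = Z j (ZPow β f) := by
  obtain ⟨a, b, c⟩ := α
  rcases a with _ | a
  · rcases b with _ | b
    · rcases c with _ | c
      · exact Or.inl rfl
      · exact Or.inr ⟨2, (0, 0, c), by simp only [deg]; omega, fun f => (Z_two_ZPow _ _).symm⟩
    · exact Or.inr ⟨1, (0, b, c), by simp only [deg]; omega, fun f => (Z_one_ZPow _ _ _).symm⟩
  · exact Or.inr ⟨0, (a, b, c), by simp only [deg]; omega, fun f => (Z_zero_ZPow _ _ _ _).symm⟩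

/-- The bracket [Z^α, Z_k] has order at most |α|, one less than the products themselves; this is why
no derivative is lost on commuting. The induction uses [Z_j Z^β, Z_k] = Z_j [Z^β, Z_k] + [Z_j, Z_k]
Z^β. -/
theorem reduces_ZPow_Z_comm (n : ℕ) : ∀ (α : ℕ × ℕ × ℕ) (k : Fin 3), deg α = n →
    Reduces (n + 1) n (fun f y => ZPow α (Z k f) y - Z k (ZPow α f) y) := by
  induction n with
  | zero =>
    rintro ⟨a, b, c⟩ k h
    have h' : a + b + c = 0 := h
    obtain ⟨rfl, rfl, rfl⟩ : a = 0 ∧ b = 0 ∧ c = 0 := by omega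
    exact ⟨fun _ => 0, fun f x _ => Filter.Eventually.of_forall fun y => by simp [ZPow]⟩
  | succ n ih =>
    intro α k h
    rcases exists_ZPow_eq_Z_ZPow α with rfl | ⟨j, β, hd, hβ⟩
    · simp [deg] at h
    have hdβ : deg β = n := by omega
    have h1 := ((ih β k hdβ).mono (show n + 1 ≤ n + 2 by omega) le_rfl).op (k := j) (by omega)
      (fun α hα => (reduces_Z_ZPow n j α hα).mono (by omega) le_rfl)
    have h2 : Reduces (n + 2) (n + 1)
        (fun f y => ∑ l, (structConst j k l : ℂ) * Z l (ZPow β f) y) :=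
      Reduces.lincomb _ fun l _ => (reduces_Z_ZPow n l β hdβ.le).mono (by omega) (by omega)
    refine (h1.add h2).congr fun f x hf => ?_
    have e1 : IsCkAt 1 (ZPow β (Z k f)) x := IsCkAt.ZPow (IsCkAt.op (hf.of_le (by omega)) (.ang k))
    have e2 : IsCkAt 2 (ZPow β f) x := IsCkAt.ZPow (hf.of_le (by omega))
    filter_upwards [op_sub e1 (e2.op (.ang k)) (.ang j), op_ang_comm e2 j k] with y hy1 hy2
    simp only [op_ang] at hy1 hy2
    rw [hy1, hβ, hβ]
    linear_combination hy2

/-! ### Commutation with the transport operators -/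

theorem op_iterate_op_comm {d d' : Dir} (hd : d.IsCoord) (r : ℕ) {f : Pt → ℂ} {x : Pt}
    (hf : IsCkAt (r + 1) f x) : d.op^[r] (d'.op f) =ᶠ[𝓝 x] d'.op (d.op^[r] f) := by
  induction r with
  | zero => exact Filter.EventuallyEq.rfl
  | succ r ih =>
    simp only [Function.iterate_succ_apply']
    refine (op_congr (ih (hf.of_le (by omega))) d).trans ?_
    exact op_comm_coord (IsCkAt.op_iterate (hf.of_le (by omega)) d) hd

theorem op_iterate_iterate_comm {d d' : Dir} (hd : d.IsCoord) (r r' : ℕ) {f : Pt → ℂ} {x : Pt}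
    (hf : IsCkAt (r + r') f x) : d.op^[r] (d'.op^[r'] f) =ᶠ[𝓝 x] d'.op^[r'] (d.op^[r] f) := by
  induction r' with
  | zero => exact Filter.EventuallyEq.rfl
  | succ r' ih =>
    simp only [Function.iterate_succ_apply']
    refine (op_iterate_op_comm hd r (IsCkAt.op_iterate (hf.of_le (by omega)) d')).trans ?_
    exact op_congr (ih (hf.of_le (by omega))) d'

theorem ZPow_op_iterate_comm {d : Dir} (hd : d.IsCoord) (α : ℕ × ℕ × ℕ) (r : ℕ) {f : Pt → ℂ}
    {x : Pt} (hf : IsCkAt (r + deg α) f x) :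
    ZPow α (d.op^[r] f) =ᶠ[𝓝 x] d.op^[r] (ZPow α f) := by
  replace hf : IsCkAt (r + (α.1 + α.2.1 + α.2.2)) f x := hf
  refine (op_iterate_congr (op_iterate_congr (op_iterate_iterate_comm (d' := .ang 2) hd r α.2.2
    (hf.of_le (by omega))).symm (.ang 1) _) (.ang 0) _).trans ?_
  refine (op_iterate_congr (op_iterate_iterate_comm (d' := .ang 1) hd r α.2.1
    (IsCkAt.op_iterate (hf.of_le (by omega)) _)).symm (.ang 0) _).trans ?_
  exact (op_iterate_iterate_comm (d' := .ang 0) hd r α.1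
    (IsCkAt.op_iterate (IsCkAt.op_iterate (hf.of_le (by omega)) _) _)).symm

theorem isCoord_tau : Dir.tau.IsCoord := trivial
theorem isCoord_rho : Dir.rho.IsCoord := trivial

theorem IsCkAt.D {n P N : ℕ} {α : ℕ × ℕ × ℕ} {f : Pt → ℂ} {x : Pt}
    (hf : IsCkAt (n + P + N + deg α) f x) : IsCkAt n (D P N α f) x :=
  IsCkAt.op_iterate (d := .rho) (IsCkAt.op_iterate (d := .tau) (IsCkAt.ZPow hf))

theorem D_congr {f g : Pt → ℂ} {x : Pt} (h : f =ᶠ[𝓝 x] g) (P N : ℕ) (α : ℕ × ℕ × ℕ) :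
    D P N α f =ᶠ[𝓝 x] D P N α g :=
  op_iterate_congr (d := .rho) (op_iterate_congr (d := .tau) (ZPow_congr h α) N) P

theorem D_lincomb {ι : Type*} {s : Finset ι} {f : ι → Pt → ℂ} {x : Pt} (c : ι → ℂ) (P N : ℕ)
    (α : ℕ × ℕ × ℕ) (hf : ∀ i ∈ s, IsCkAt (P + N + deg α) (f i) x) :
    D P N α (fun y => ∑ i ∈ s, c i * f i y) =ᶠ[𝓝 x]
      fun y => ∑ i ∈ s, c i * D P N α (f i) y := by
  refine (op_iterate_congr (op_iterate_congr (ZPow_lincomb c α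
    fun i hi => (hf i hi).of_le (by omega)) .tau N) .rho P).trans ?_
  refine (op_iterate_congr (op_iterate_lincomb c N
    (fun i hi => ((hf i hi).of_le (by omega)).ZPow) .tau) .rho P).trans ?_
  exact op_iterate_lincomb c P
    (fun i hi => (IsCkAt.ZPow ((hf i hi).of_le (by omega))).op_iterate .tau) .rho

/-- The data carry ∂_τ^q ∂_ρ^p and the conclusion ∂_ρ^p ∂_τ^q. This lemma and the next bring both to
one normal form. -/
theorem D_dTau_dRho (p q P N : ℕ) (α : ℕ × ℕ × ℕ) {f : Pt → ℂ} {x : Pt}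
    (hf : IsCkAt (P + p + (N + q) + deg α) f x) :
    D P N α (dTau^[q] (dRho^[p] f)) =ᶠ[𝓝 x] D (P + p) (N + q) α f := by
  have h1 : ZPow α (dTau^[q] (dRho^[p] f)) =ᶠ[𝓝 x] dTau^[q] (dRho^[p] (ZPow α f)) :=
    (ZPow_op_iterate_comm isCoord_tau α q
      (IsCkAt.op_iterate (d := .rho) (hf.of_le (by omega)))).trans
    (op_iterate_congr (ZPow_op_iterate_comm isCoord_rho α p (hf.of_le (by omega))) .tau q)
  refine (op_iterate_congr (op_iterate_congr h1 .tau N) .rho P).trans ?_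
  unfold D
  rw [op_tau, op_rho, ← Function.iterate_add_apply, Function.iterate_add_apply dRho P p]
  exact op_iterate_congr (op_iterate_iterate_comm (d := .tau) (d' := .rho) isCoord_tau _ _
    (IsCkAt.ZPow (hf.of_le (by omega)))) .rho P

theorem D_dRho_dTau (p q P N : ℕ) (α : ℕ × ℕ × ℕ) {f : Pt → ℂ} {x : Pt}
    (hf : IsCkAt (P + p + (N + q) + deg α) f x) :
    D P N α (dRho^[p] (dTau^[q] f)) =ᶠ[𝓝 x] D (P + p) (N + q) α f :=
  (D_congr (op_iterate_iterate_comm (d := .rho) (d' := .tau) isCoord_rho p q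
    (hf.of_le (by omega))) P N α).trans (D_dTau_dRho p q P N α hf)

/-- The null derivatives `(1 + τ) ∂_τ - ρ ∂_ρ` (for `s = 1`) and `(1 - τ) ∂_τ + ρ ∂_ρ`
(for `s = -1`). -/
def nullDer (s : ℂ) (f : Pt → ℂ) : Pt → ℂ :=
  fun y => (1 + s * (y.1 : ℂ)) * dTau f y - s * (y.2.1 : ℂ) * dRho f y

theorem isCkAt_tau (n : ℕ) (x : Pt) : IsCkAt n (fun y => (y.1 : ℂ)) x :=
  IsCkAt.of_coord (φ := fun p => (p.1 : ℂ))
    (Complex.ofRealCLM.contDiff.comp contDiff_fst).contDiffAt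

theorem isCkAt_rho (n : ℕ) (x : Pt) : IsCkAt n (fun y => (y.2.1 : ℂ)) x :=
  IsCkAt.of_coord (φ := fun p => (p.2 : ℂ))
    (Complex.ofRealCLM.contDiff.comp contDiff_snd).contDiffAt

theorem op_tau_coord_tau : Dir.tau.op (fun y => (y.1 : ℂ)) = fun _ => 1 := by
  funext y; exact (hasDerivAt_id y.1).ofReal_comp.deriv
theorem op_rho_coord_rho : Dir.rho.op (fun y => (y.2.1 : ℂ)) = fun _ => 1 := by
  funext y; exact (hasDerivAt_id y.2.1).ofReal_comp.deriv
theorem op_rho_coord_tau : Dir.rho.op (fun y => (y.1 : ℂ)) = fun _ => 0 := by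
  funext y; simp [Dir.op, Dir.curve]
theorem op_tau_coord_rho : Dir.tau.op (fun y => (y.2.1 : ℂ)) = fun _ => 0 := by
  funext y; simp [Dir.op, Dir.curve]
theorem op_ang_coord_tau (k : Fin 3) : (Dir.ang k).op (fun y => (y.1 : ℂ)) = fun _ => 0 := by
  funext y; simp [Dir.op, Dir.curve]
theorem op_ang_coord_rho (k : Fin 3) : (Dir.ang k).op (fun y => (y.2.1 : ℂ)) = fun _ => 0 := by
  funext y; simp [Dir.op, Dir.curve]

/-- The weight of a frame direction under commutation with the null derivatives. -/
def Dir.weight : Dir → ℂ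
  | .tau => 1
  | .rho => -1
  | .ang _ => 0

theorem IsCkAt.nullDer {n : ℕ} {f : Pt → ℂ} {x : Pt} (hf : IsCkAt (n + 1) f x) (s : ℂ) :
    IsCkAt n (nullDer s f) x :=
  (((IsCkAt.const 1 x).add ((isCkAt_tau n x).const_mul s)).mul (hf.op .tau)).sub
    (((isCkAt_rho n x).const_mul s).mul (hf.op .rho))

/-- The coefficients 1 + sτ and -sρ are affine in the variable they multiply, so the bracket with
∂_τ or ∂_ρ is a constant multiple of that same field. -/
theorem op_nullDer (d : Dir) (s : ℂ) {f : Pt → ℂ} {x : Pt} (hf : IsCkAt 2 f x) :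
    d.op (nullDer s f) =ᶠ[𝓝 x] fun y => nullDer s (d.op f) y + d.weight * s * d.op f y := by
  have hA : IsCkAt 1 (fun y : Pt => 1 + s * (y.1 : ℂ)) x :=
    (IsCkAt.const 1 x).add ((isCkAt_tau 1 x).const_mul s)
  have hB : IsCkAt 1 (fun y : Pt => s * (y.2.1 : ℂ)) x := (isCkAt_rho 1 x).const_mul s
  filter_upwards [op_sub (hA.mul (hf.op .tau)) (hB.mul (hf.op .rho)) d,
    op_mul hA (hf.op .tau) d, op_mul hB (hf.op .rho) d,
    op_add (IsCkAt.const 1 x) ((isCkAt_tau 1 x).const_mul s) d,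
    op_const_mul (isCkAt_tau 1 x) s d, op_const_mul (isCkAt_rho 1 x) s d,
    op_comm_coord (d := .tau) (d' := d) hf isCoord_tau,
    op_comm_coord (d := .rho) (d' := d) hf isCoord_rho] with y h1 h2 h3 h4 h5 h6 h7 h8
  have e : d.op (FriedrichCylinder.nullDer s f) y = _ := h1
  rw [e, h2, h3, h4, h5, h6, ← h7, ← h8, op_const]
  simp only [nullDer, ← op_tau, ← op_rho]
  cases d with
  | tau => rw [op_tau_coord_tau, op_tau_coord_rho]; simp only [Dir.weight]; ring
  | rho => rw [op_rho_coord_tau, op_rho_coord_rho]; simp only [Dir.weight]; ring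
  | ang k => rw [op_ang_coord_tau, op_ang_coord_rho]; simp only [Dir.weight]; ring

theorem op_iterate_nullDer (d : Dir) (s : ℂ) (r : ℕ) {f : Pt → ℂ} {x : Pt}
    (hf : IsCkAt (r + 1) f x) : d.op^[r] (nullDer s f) =ᶠ[𝓝 x]
      fun y => nullDer s (d.op^[r] f) y + r * d.weight * s * d.op^[r] f y := by
  induction r with
  | zero => exact Filter.Eventually.of_forall fun y => by simp
  | succ r ih =>
    simp only [Function.iterate_succ_apply']
    have h2 : IsCkAt 2 (d.op^[r] f) x := IsCkAt.op_iterate (hf.of_le (by omega)) d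
    have h1 : IsCkAt 1 (d.op^[r] f) x := h2.of_le (by omega)
    filter_upwards [op_congr (ih (hf.of_le (by omega))) d,
      op_add (h2.nullDer s) (h1.const_mul (r * d.weight * s)) d, op_const_mul h1 (r * d.weight * s) d,
      op_nullDer d s h2] with y e1 e2 e3 e4
    rw [e1, e2, e3, e4]
    push_cast
    ring

theorem ZPow_nullDer (s : ℂ) (α : ℕ × ℕ × ℕ) {f : Pt → ℂ} {x : Pt}
    (hf : IsCkAt (deg α + 1) f x) : ZPow α (nullDer s f) =ᶠ[𝓝 x] nullDer s (ZPow α f) := by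
  have key (k : Fin 3) (r : ℕ) {g : Pt → ℂ} (hg : IsCkAt (r + 1) g x) :
      (Dir.ang k).op^[r] (nullDer s g) =ᶠ[𝓝 x] nullDer s ((Dir.ang k).op^[r] g) := by
    filter_upwards [op_iterate_nullDer (.ang k) s r hg] with y h
    rw [h]; simp [Dir.weight]
  replace hf : IsCkAt (α.1 + α.2.1 + α.2.2 + 1) f x := hf
  refine (op_iterate_congr (op_iterate_congr (key 2 α.2.2 (hf.of_le (by omega))) (.ang 1) _)
    (.ang 0) _).trans ?_
  refine (op_iterate_congr (key 1 α.2.1 (IsCkAt.op_iterate (hf.of_le (by omega)) _)) (.ang 0) _).trans ?_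
  exact key 0 α.1 (IsCkAt.op_iterate (IsCkAt.op_iterate (hf.of_le (by omega)) _) _)

/-- Each ∂_τ contributes s and each ∂_ρ contributes -s, while the angular fields commute. The term
(N - P)s is the source of the damping of u. -/
theorem D_nullDer (s : ℂ) (P N : ℕ) (α : ℕ × ℕ × ℕ) {f : Pt → ℂ} {x : Pt}
    (hf : IsCkAt (P + N + deg α + 1) f x) : D P N α (nullDer s f) =ᶠ[𝓝 x]
      fun y => nullDer s (D P N α f) y + ((N : ℂ) - P) * s * D P N α f y := by
  have h0 : IsCkAt (P + N + 1) (ZPow α f) x := IsCkAt.ZPow (hf.of_le (by omega))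
  have h1 : IsCkAt (P + 1) (Dir.tau.op^[N] (ZPow α f)) x :=
    IsCkAt.op_iterate (h0.of_le (by omega)) _
  have e1 : D P N α (nullDer s f) =ᶠ[𝓝 x] Dir.rho.op^[P] (Dir.tau.op^[N]
      (nullDer s (ZPow α f))) :=
    op_iterate_congr (op_iterate_congr (ZPow_nullDer s α (hf.of_le (by omega))) .tau N) .rho P
  have e2 := op_iterate_congr (op_iterate_nullDer .tau s N (h0.of_le (by omega))) .rho P
  have e3 := op_iterate_lincomb (s := Finset.univ)
    (f := ![nullDer s (Dir.tau.op^[N] (ZPow α f)), Dir.tau.op^[N] (ZPow α f)]) (x := x)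
    ![1, N * Dir.tau.weight * s] P (fun i _ => by
      fin_cases i
      · exact h1.nullDer s
      · exact h1.of_le (by omega)) .rho
  simp only [Fin.sum_univ_two, Matrix.cons_val_zero, Matrix.cons_val_one, one_mul] at e3
  filter_upwards [e1, e2, e3, op_iterate_nullDer .rho s P h1] with y e1 e2 e3 e4
  rw [e1, e2, e3, e4]
  simp only [D, op_tau, op_rho, Dir.weight]
  ring

/-- The coordinate derivatives commute with `Z k`, so the coefficients come from the angular
commutator alone. Their independence of the function and of the point makes the final constant
universal. -/
theorem exists_D_Z (α : ℕ × ℕ × ℕ) (k : Fin 3) : ∃ c : ℕ × ℕ × ℕ → ℂ, ∀ P N f x,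
    IsCkAt (P + N + deg α + 1) f x → D P N α (Z k f) =ᶠ[𝓝 x]
      fun y => Z k (D P N α f) y + ∑ β ∈ angIdx (deg α), c β * D P N β f y := by
  obtain ⟨c, hc⟩ := reduces_ZPow_Z_comm (deg α) α k rfl
  refine ⟨c, fun P N f x hf => ?_⟩
  -- The index `none` carries the principal term, so that principal and lower terms form a single
  -- linear combination to differentiate.
  have e1 : ZPow α (Z k f) =ᶠ[𝓝 x] fun y => ∑ o : Option (angIdx (deg α)),
      (o.elim 1 fun β => c β) * (o.elim (Z k (ZPow α f)) fun β => ZPow β f) y := by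
    filter_upwards [hc f x (hf.of_le (by omega))] with y hy
    simp only [Fintype.sum_option, Option.elim_none, Option.elim_some, one_mul]
    rw [Finset.sum_coe_sort (angIdx (deg α)) fun β => c β * ZPow β f y, ← hy]
    ring
  have hC : ∀ o : Option (angIdx (deg α)),
      IsCkAt (P + N) (o.elim (Z k (ZPow α f)) fun β => ZPow β f) x := by
    rintro (_ | ⟨β, hβ⟩)
    · exact IsCkAt.op (IsCkAt.ZPow (hf.of_le (by omega))) (.ang k)
    · have := mem_angIdx.1 hβ
      exact IsCkAt.ZPow (α := β) (hf.of_le (by omega))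
  have e2 := op_iterate_congr (op_iterate_lincomb (s := Finset.univ)
    (fun o : Option (angIdx (deg α)) => o.elim 1 fun β => c β) N
    (fun o _ => (hC o).of_le (by omega)) .tau) .rho P
  have e3 := op_iterate_lincomb (s := Finset.univ)
    (fun o : Option (angIdx (deg α)) => o.elim 1 fun β => c β) P
    (fun o _ => (hC o).op_iterate .tau) .rho
  have h0 : IsCkAt (P + N + 1) (ZPow α f) x := IsCkAt.ZPow (hf.of_le (by omega))
  have e4 := op_iterate_congr (op_iterate_op_comm (d' := .ang k) isCoord_tau N
    (h0.of_le (by omega))) .rho P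
  have e5 := op_iterate_op_comm (d' := .ang k) isCoord_rho P
    (IsCkAt.op_iterate (r := N) (d := .tau) (h0.of_le (by omega)))
  filter_upwards [op_iterate_congr (op_iterate_congr e1 .tau N) .rho P, e2, e3, e4, e5]
    with y e1 e2 e3 e4 e5
  have e : D P N α (Z k f) y = _ := e1
  rw [e, e2, e3]
  simp only [Fintype.sum_option, Option.elim_none, Option.elim_some, one_mul]
  rw [Finset.sum_coe_sort (angIdx (deg α))
    fun β => c β * Dir.rho.op^[P] (Dir.tau.op^[N] (ZPow β f)) y]
  simp only [op_ang] at e4 e5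
  rw [e4, e5]
  rfl

theorem exists_D_XPlus (α : ℕ × ℕ × ℕ) : ∃ c : ℕ × ℕ × ℕ → ℂ, ∀ P N f x,
    IsCkAt (P + N + deg α + 1) f x → D P N α (XPlus f) =ᶠ[𝓝 x]
      fun y => XPlus (D P N α f) y + ∑ β ∈ angIdx (deg α), c β * D P N β f y := by
  obtain ⟨c0, h0⟩ := exists_D_Z α 0
  obtain ⟨c1, h1⟩ := exists_D_Z α 1
  refine ⟨fun β => -(c1 β + Complex.I * c0 β), fun P N f x hf => ?_⟩
  have e := D_lincomb (s := Finset.univ) (f := ![Z 1 f, Z 0 f]) (x := x) ![-1, -Complex.I] P N α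
    (fun i _ => by fin_cases i <;> exact hf.op (.ang _))
  simp only [Fin.sum_univ_two, Matrix.cons_val_zero, Matrix.cons_val_one] at e
  have e' : XPlus f = fun y => -1 * Z 1 f y + -Complex.I * Z 0 f y := by
    funext y; simp only [XPlus]; ring
  filter_upwards [e, h0 P N f x hf, h1 P N f x hf] with y e h0 h1
  rw [e', e, h0, h1]
  simp only [XPlus, neg_mul, add_mul, Finset.sum_neg_distrib, Finset.sum_add_distrib, mul_assoc,
    ← Finset.mul_sum]
  ring

theorem exists_D_XMinus (α : ℕ × ℕ × ℕ) : ∃ c : ℕ × ℕ × ℕ → ℂ, ∀ P N f x,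
    IsCkAt (P + N + deg α + 1) f x → D P N α (XMinus f) =ᶠ[𝓝 x]
      fun y => XMinus (D P N α f) y + ∑ β ∈ angIdx (deg α), c β * D P N β f y := by
  obtain ⟨c0, h0⟩ := exists_D_Z α 0
  obtain ⟨c1, h1⟩ := exists_D_Z α 1
  refine ⟨fun β => -(c1 β + (-Complex.I) * c0 β), fun P N f x hf => ?_⟩
  have e := D_lincomb (s := Finset.univ) (f := ![Z 1 f, Z 0 f]) (x := x) ![-1, Complex.I] P N α
    (fun i _ => by fin_cases i <;> exact hf.op (.ang _))
  simp only [Fin.sum_univ_two, Matrix.cons_val_zero, Matrix.cons_val_one] at e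
  have e' : XMinus f = fun y => -1 * Z 1 f y + Complex.I * Z 0 f y := by
    funext y; simp only [XMinus]; ring
  filter_upwards [e, h0 P N f x hf, h1 P N f x hf] with y e h0 h1
  rw [e', e, h0, h1]
  simp only [XMinus, neg_mul, add_mul, Finset.sum_neg_distrib, Finset.sum_add_distrib, mul_assoc,
    ← Finset.mul_sum]
  ring

/-! ### Integration by parts on `ℝ × ℝ × SU(2)` -/

instance : Measure.IsHaarMeasure haarSU2 := by
  unfold haarSU2; infer_instance

instance : IsProbabilityMeasure haarSU2 :=
  ⟨by unfold haarSU2; exact Measure.haarMeasure_self⟩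

instance : IsFiniteMeasureOnCompacts dv := by
  unfold dv; infer_instance

instance : SFinite dv := by
  unfold dv; infer_instance

/-- Unimodularity of a compact group: a right translate of Haar measure is again a Haar probability
measure, and that is unique. Left-invariant fields generate right translations, so this is the
invariance that integration by parts requires. -/
theorem map_mul_right_haarSU2 (g : SU2) : haarSU2.map (· * g) = haarSU2 := by
  have : IsProbabilityMeasure (haarSU2.map (· * g)) :=
    Measure.isProbabilityMeasure_map (measurable_mul_const g).aemeasurable
  exact Measure.isHaarMeasure_eq_of_isProbabilityMeasure _ _

theorem rot_add (k : Fin 3) (s t : ℝ) : rot k (s + t) = rot k s * rot k t := by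
  apply Subtype.ext
  have hI : Complex.I ^ 2 = -1 := Complex.I_sq
  change rotMatrix k (s + t) = rotMatrix k s * rotMatrix k t
  unfold rotMatrix
  rw [add_div, Real.cos_add, Real.sin_add]
  generalize Real.cos (s / 2) = c
  generalize Real.sin (s / 2) = d
  generalize Real.cos (t / 2) = c'
  generalize Real.sin (t / 2) = d'
  ext i j
  fin_cases k <;> fin_cases i <;> fin_cases j <;>
    simp [pauli, Matrix.mul_apply, Fin.sum_univ_two] <;> grind

/-- The one-parameter group law transports the derivative at time 0 to time `t`. -/
theorem hasDerivAt_ang {f : Pt → ℂ} {a b : ℝ} (hf : ∀ g, IsCkAt 1 f (a, b, g)) (k : Fin 3)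
    (g : SU2) (t : ℝ) :
    HasDerivAt (fun s => f (a, b, g * rot k s)) (Z k f (a, b, g * rot k t)) t := by
  have h : HasDerivAt (fun s => f (a, b, g * rot k t * rot k s)) (Z k f (a, b, g * rot k t)) 0 :=
    ((hf (g * rot k t)).differentiableAt (.ang k)).hasDerivAt
  have h2 := HasDerivAt.comp_sub_const (f := fun s => f (a, b, g * rot k t * rot k s)) t t
    (by simpa using h)
  refine h2.congr_of_eventuallyEq (Filter.Eventually.of_forall fun s => ?_)
  simp only [mul_assoc, ← rot_add]
  rw [add_sub_cancel]

theorem continuous_fiber {f : Pt → ℂ} {a b : ℝ} (hf : ∀ g, ContinuousAt f (a, b, g)) :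
    Continuous fun g => f (a, b, g) := by
  rw [continuous_iff_continuousAt]
  intro g
  exact ContinuousAt.comp (f := fun g : SU2 => ((a, b, g) : Pt)) (hf g)
    (continuous_const.prodMk (continuous_const.prodMk continuous_id)).continuousAt

/-- Average along the flow for unit time. By the fundamental theorem of calculus the average is the
difference of a right translate and the function, which integrates to 0; by Fubini and right
invariance it also has the integral of `Z k f`. No differentiation under the integral sign is
needed. -/
theorem integral_Z_fiber {f : Pt → ℂ} {a b : ℝ} (hf : ∀ g, IsCkAt 1 f (a, b, g)) (k : Fin 3) :
    ∫ g, Z k f (a, b, g) ∂haarSU2 = 0 := by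
  have hc : Continuous fun g => f (a, b, g) := continuous_fiber fun g => (hf g).continuousAt
  have hc' : Continuous fun g => Z k f (a, b, g) :=
    continuous_fiber fun g => (IsCkAt.op (n := 0) (hf g) (.ang k)).continuousAt
  have hI {φ : SU2 → ℂ} (hφ : Continuous φ) : Integrable φ haarSU2 := by
    rw [← integrableOn_univ]
    exact hφ.continuousOn.integrableOn_compact isCompact_univ
  have hR {φ : SU2 → ℂ} (hφ : Continuous φ) (g0 : SU2) :
      ∫ g, φ (g * g0) ∂haarSU2 = ∫ g, φ g ∂haarSU2 := by
    conv_rhs => rw [← map_mul_right_haarSU2 g0]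
    rw [integral_map (measurable_mul_const g0).aemeasurable hφ.aestronglyMeasurable]
  have hFTC : ∀ g, ∫ s in (0 : ℝ)..1, Z k f (a, b, g * rot k s) =
      f (a, b, g * rot k 1) - f (a, b, g) := by
    intro g
    have := intervalIntegral.integral_eq_sub_of_hasDerivAt (a := 0) (b := 1)
      (fun t _ => hasDerivAt_ang hf k g t)
      ((hc'.comp (continuous_const.mul (continuous_rot k))).intervalIntegrable 0 1)
    rw [this, rot_zero, mul_one]
  have h1 : ∫ g, (∫ s in (0 : ℝ)..1, Z k f (a, b, g * rot k s)) ∂haarSU2 = 0 := by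
    simp_rw [hFTC]
    have hc1 : Continuous fun g => f (a, b, g * rot k 1) := hc.comp (continuous_mul_const _)
    rw [integral_sub (hI hc1) (hI hc), hR hc, sub_self]
  have h2 : ∫ g, (∫ s in (0 : ℝ)..1, Z k f (a, b, g * rot k s)) ∂haarSU2 =
      ∫ s in (0 : ℝ)..1, (∫ g, Z k f (a, b, g * rot k s) ∂haarSU2) := by
    simp_rw [intervalIntegral.integral_of_le zero_le_one]
    refine integral_integral_swap ?_
    have hcc : Continuous (Function.uncurry fun (g : SU2) (s : ℝ) => Z k f (a, b, g * rot k s)) :=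
      hc'.comp (continuous_fst.mul ((continuous_rot k).comp continuous_snd))
    have h3 : IntegrableOn (Function.uncurry fun (g : SU2) (s : ℝ) => Z k f (a, b, g * rot k s))
        (Set.univ ×ˢ Set.Icc 0 1) (haarSU2.prod volume) :=
      hcc.continuousOn.integrableOn_compact (isCompact_univ.prod isCompact_Icc)
    have h4 := h3.mono_set (Set.prod_mono_right (s := Set.univ) (Set.Ioc_subset_Icc_self (a := (0 : ℝ)) (b := 1)))
    rwa [IntegrableOn, ← Measure.prod_restrict, Measure.restrict_univ] at h4
  rw [h2] at h1
  simp_rw [hR hc'] at h1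
  simpa using h1

/-- The product of two intervals and `SU(2)`. -/
def box (a b c d : ℝ) : Set Pt := Set.Icc a b ×ˢ Set.Icc c d ×ˢ Set.univ

theorem isCompact_box (a b c d : ℝ) : IsCompact (box a b c d) :=
  isCompact_Icc.prod (isCompact_Icc.prod isCompact_univ)

theorem integrableOn_box {E : Type*} [NormedAddCommGroup E] {f : Pt → E} {a b c d : ℝ}
    (hf : ∀ x ∈ box a b c d, ContinuousAt f x) : IntegrableOn f (box a b c d) dv :=
  ContinuousOn.integrableOn_compact (isCompact_box a b c d)
    fun x hx => (hf x hx).continuousWithinAt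

theorem integrableOn_slice {E : Type*} [NormedAddCommGroup E] {f : ℝ × SU2 → E} {a b : ℝ}
    (hf : ContinuousOn f (Set.Icc a b ×ˢ Set.univ)) :
    IntegrableOn f (Set.Icc a b ×ˢ Set.univ) ((volume : Measure ℝ).prod haarSU2) :=
  hf.integrableOn_compact (isCompact_Icc.prod isCompact_univ)

theorem integral_Z_box {f : Pt → ℂ} {a b c d : ℝ} (hf : ∀ x ∈ box a b c d, IsCkAt 1 f x)
    (k : Fin 3) : ∫ x in box a b c d, Z k f x ∂dv = 0 := by
  have hi : IntegrableOn (Z k f) (box a b c d) dv :=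
    integrableOn_box fun x hx => (IsCkAt.op (n := 0) (hf x hx) (.ang k)).continuousAt
  unfold box dv at *
  rw [setIntegral_prod _ hi]
  refine setIntegral_eq_zero_of_forall_eq_zero fun τ hτ => ?_
  -- A non-integrable slice would contribute 0 by the convention for the Bochner integral, so slice
  -- integrability need not be proved.
  by_cases hi2 : IntegrableOn (fun y => Z k f (τ, y)) (Set.Icc c d ×ˢ Set.univ)
    ((volume : Measure ℝ).prod haarSU2)
  · rw [setIntegral_prod _ hi2]
    refine setIntegral_eq_zero_of_forall_eq_zero fun ρ hρ => ?_
    rw [Measure.restrict_univ]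
    exact integral_Z_fiber (fun g => hf _ ⟨hτ, hρ, trivial⟩) k
  · exact integral_undef hi2

theorem integral_dRho_box {f : Pt → ℂ} {a b c d : ℝ} (hcd : c ≤ d)
    (hf : ∀ x ∈ box a b c d, IsCkAt 1 f x) :
    ∫ x in box a b c d, dRho f x ∂dv =
      ∫ y in Set.Icc a b ×ˢ (Set.univ : Set SU2), (f (y.1, d, y.2) - f (y.1, c, y.2))
        ∂((volume : Measure ℝ).prod haarSU2) := by
  have hcont : ∀ x ∈ box a b c d, ContinuousAt (dRho f) x := fun x hx =>
    (IsCkAt.op (n := 0) (hf x hx) .rho).continuousAt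
  have hi : IntegrableOn (dRho f) (box a b c d) dv := integrableOn_box hcont
  have hs (e : ℝ) (he : e ∈ Set.Icc c d) : ContinuousOn (fun y : ℝ × SU2 => f (y.1, e, y.2))
      (Set.Icc a b ×ˢ Set.univ) := fun y hy =>
    (ContinuousAt.comp (f := fun y : ℝ × SU2 => ((y.1, e, y.2) : Pt)) (x := y)
      (hf (y.1, e, y.2) ⟨hy.1, he, trivial⟩).continuousAt
      (by fun_prop)).continuousWithinAt
  have hsub : ContinuousOn (fun y : ℝ × SU2 => f (y.1, d, y.2) - f (y.1, c, y.2))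
      (Set.Icc a b ×ˢ Set.univ) := (hs d ⟨hcd, le_rfl⟩).sub (hs c ⟨le_rfl, hcd⟩)
  rw [setIntegral_prod _ (integrableOn_slice hsub)]
  unfold box dv at *
  rw [setIntegral_prod _ hi]
  refine setIntegral_congr_fun measurableSet_Icc fun τ hτ => ?_
  have hi2 : IntegrableOn (fun y => dRho f (τ, y)) (Set.Icc c d ×ˢ Set.univ)
      ((volume : Measure ℝ).prod haarSU2) := integrableOn_slice fun y hy =>
    (ContinuousAt.comp (f := fun y : ℝ × SU2 => ((τ, y) : Pt)) (x := y)
      (hcont (τ, y) ⟨hτ, hy⟩) (by fun_prop)).continuousWithinAt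
  simp only
  rw [← Measure.prod_restrict, integral_prod_symm _ (by rwa [Measure.prod_restrict])]
  refine integral_congr_ae (Filter.Eventually.of_forall fun g => ?_)
  simp only
  rw [integral_Icc_eq_integral_Ioc, ← intervalIntegral.integral_of_le hcd]
  refine intervalIntegral.integral_eq_sub_of_hasDerivAt (f := fun r => f (τ, r, g)) (fun r hr => ?_) ?_
  · rw [Set.uIcc_of_le hcd] at hr
    exact ((hf (τ, r, g) ⟨hτ, hr, trivial⟩).differentiableAt .rho).hasDerivAt
  · refine ContinuousOn.intervalIntegrable fun r hr => ?_
    rw [Set.uIcc_of_le hcd] at hr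
    exact (ContinuousAt.comp (f := fun r : ℝ => ((τ, r, g) : Pt)) (x := r)
      (hcont (τ, r, g) ⟨hτ, hr, trivial⟩) (by fun_prop)).continuousWithinAt

theorem integral_dTau_box {f : Pt → ℂ} {a b c d : ℝ} (hab : a ≤ b)
    (hf : ∀ x ∈ box a b c d, IsCkAt 1 f x) :
    ∫ x in box a b c d, dTau f x ∂dv =
      ∫ y in Set.Icc c d ×ˢ (Set.univ : Set SU2), (f (b, y.1, y.2) - f (a, y.1, y.2))
        ∂((volume : Measure ℝ).prod haarSU2) := by
  have hcont : ∀ x ∈ box a b c d, ContinuousAt (dTau f) x := fun x hx =>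
    (IsCkAt.op (n := 0) (hf x hx) .tau).continuousAt
  have hi : IntegrableOn (dTau f) (box a b c d) dv := integrableOn_box hcont
  unfold box dv at *
  rw [← Measure.prod_restrict, integral_prod_symm _ (by rwa [Measure.prod_restrict])]
  refine setIntegral_congr_fun (measurableSet_Icc.prod MeasurableSet.univ) fun y hy => ?_
  rw [integral_Icc_eq_integral_Ioc, ← intervalIntegral.integral_of_le hab]
  refine intervalIntegral.integral_eq_sub_of_hasDerivAt (f := fun r => f (r, y.1, y.2)) (fun r hr => ?_) ?_
  · rw [Set.uIcc_of_le hab] at hr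
    exact ((hf (r, y) ⟨hr, hy⟩).differentiableAt .tau).hasDerivAt
  · refine ContinuousOn.intervalIntegrable fun r hr => ?_
    rw [Set.uIcc_of_le hab] at hr
    exact (ContinuousAt.comp (f := fun r : ℝ => ((r, y) : Pt)) (x := r)
      (hcont (r, y) ⟨hr, hy⟩) (by fun_prop)).continuousWithinAt

/-! ### The energy estimate on a rectangle -/

theorem integral_XPlus_box {f : Pt → ℂ} {a b c d : ℝ} (hf : ∀ x ∈ box a b c d, IsCkAt 1 f x) :
    ∫ x in box a b c d, XPlus f x ∂dv = 0 := by
  have hi (k : Fin 3) : IntegrableOn (Z k f) (box a b c d) dv :=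
    integrableOn_box fun x hx => (IsCkAt.op (n := 0) (hf x hx) (.ang k)).continuousAt
  unfold XPlus
  rw [integral_neg, integral_add (hi 1) ((hi 0).const_mul _), integral_const_mul,
    integral_Z_box hf, integral_Z_box hf]
  simp

theorem integral_XMinus_box {f : Pt → ℂ} {a b c d : ℝ} (hf : ∀ x ∈ box a b c d, IsCkAt 1 f x) :
    ∫ x in box a b c d, XMinus f x ∂dv = 0 := by
  have hi (k : Fin 3) : IntegrableOn (Z k f) (box a b c d) dv :=
    integrableOn_box fun x hx => (IsCkAt.op (n := 0) (hf x hx) (.ang k)).continuousAt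
  unfold XMinus
  rw [integral_neg, integral_sub (hi 1) ((hi 0).const_mul _), integral_const_mul,
    integral_Z_box hf, integral_Z_box hf]
  simp

theorem IsCkAt.XPlus {n : ℕ} {f : Pt → ℂ} {x : Pt} (hf : IsCkAt (n + 1) f x) :
    IsCkAt n (XPlus f) x :=
  (((hf.op (.ang 1)).add ((hf.op (.ang 0)).const_mul Complex.I)).const_mul (-1)).congr
    (Filter.Eventually.of_forall fun y => by simp only [FriedrichCylinder.XPlus, op_ang]; ring)

theorem IsCkAt.XMinus {n : ℕ} {f : Pt → ℂ} {x : Pt} (hf : IsCkAt (n + 1) f x) :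
    IsCkAt n (XMinus f) x :=
  (((hf.op (.ang 1)).sub ((hf.op (.ang 0)).const_mul Complex.I)).const_mul (-1)).congr
    (Filter.Eventually.of_forall fun y => by simp only [FriedrichCylinder.XMinus, op_ang]; ring)

/-- The divergence theorem on a rectangle times `SU(2)`. -/
theorem integral_div_box {A B H H' : Pt → ℂ} {a b c d : ℝ} (hab : a ≤ b) (hcd : c ≤ d)
    (hA : ∀ x ∈ box a b c d, IsCkAt 1 A x) (hB : ∀ x ∈ box a b c d, IsCkAt 1 B x)
    (hH : ∀ x ∈ box a b c d, IsCkAt 1 H x) (hH' : ∀ x ∈ box a b c d, IsCkAt 1 H' x) :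
    IntegrableOn (fun x => dTau A x + dRho B x - (XPlus H x + XMinus H' x)) (box a b c d) dv ∧
    ∫ x in box a b c d, (dTau A x + dRho B x - (XPlus H x + XMinus H' x)) ∂dv =
      (∫ y in Set.Icc c d ×ˢ (Set.univ : Set SU2), (A (b, y.1, y.2) - A (a, y.1, y.2))
        ∂((volume : Measure ℝ).prod haarSU2)) +
      ∫ y in Set.Icc a b ×ˢ (Set.univ : Set SU2), (B (y.1, d, y.2) - B (y.1, c, y.2))
        ∂((volume : Measure ℝ).prod haarSU2) := by
  have i1 : IntegrableOn (dTau A) (box a b c d) dv :=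
    integrableOn_box fun x hx => (IsCkAt.op (n := 0) (hA x hx) .tau).continuousAt
  have i2 : IntegrableOn (dRho B) (box a b c d) dv :=
    integrableOn_box fun x hx => (IsCkAt.op (n := 0) (hB x hx) .rho).continuousAt
  have i3 : IntegrableOn (XPlus H) (box a b c d) dv :=
    integrableOn_box fun x hx => (IsCkAt.XPlus (n := 0) (hH x hx)).continuousAt
  have i4 : IntegrableOn (XMinus H') (box a b c d) dv :=
    integrableOn_box fun x hx => (IsCkAt.XMinus (n := 0) (hH' x hx)).continuousAt
  refine ⟨(i1.add i2).sub (i3.add i4), ?_⟩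
  have e1 := integral_sub (i1.add i2) (i3.add i4)
  have e2 := integral_add i1 i2
  have e3 := integral_add i3 i4
  simp only [Pi.add_apply] at e1
  rw [e1, e2, e3, integral_XPlus_box hH, integral_XMinus_box hH', integral_dTau_box hab hA,
    integral_dRho_box hcd hB]
  ring

theorem op_tau_comp_tau {φ : ℝ → ℝ} {φ' : ℝ} {x : Pt} (h : HasDerivAt φ φ' x.1) :
    Dir.tau.op (fun y => (φ y.1 : ℂ)) x = φ' :=
  h.ofReal_comp.deriv

theorem op_comp_tau_of_ne {φ : ℝ → ℝ} {x : Pt} {d : Dir} (h : d ≠ .tau) :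
    d.op (fun y => (φ y.1 : ℂ)) x = 0 := by
  cases d with
  | tau => exact absurd rfl h
  | rho => simp [Dir.op, Dir.curve]
  | ang k => simp [Dir.op, Dir.curve]

theorem isCkAt_comp_tau {n : ℕ} {φ : ℝ → ℝ} {x : Pt} (h : ContDiffAt ℝ n φ x.1) :
    IsCkAt n (fun y => (φ y.1 : ℂ)) x :=
  IsCkAt.of_coord (φ := fun p => (φ p.1 : ℂ))
    (Complex.ofRealCLM.contDiff.contDiffAt.comp _ (h.comp (x.1, x.2.1) contDiffAt_fst))

/-! ### The energy current and its divergence -/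

/-- The exponential weight. -/
def wt (lam τ : ℝ) : ℝ := Real.exp (-lam * (τ + 1))

/-- The weight of `|u|²` in the flux through a hypersurface of constant `τ`. -/
def fluxTau (lam τ : ℝ) : ℝ := wt lam τ * (2 * (1 + τ) * (1 - τ)⁻¹)

/-- The weight of `|u|²` in the flux through a hypersurface of constant `ρ (1 - τ)`. -/
def fluxRho (lam τ : ℝ) : ℝ := -(wt lam τ * (4 * (1 - τ)⁻¹ ^ 2))

/-- The weight of the angular flux. -/
def fluxAng (lam τ : ℝ) : ℝ := wt lam τ * (2 * (1 - τ)⁻¹)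

theorem hasDerivAt_wt (lam τ : ℝ) : HasDerivAt (wt lam) (-lam * wt lam τ) τ := by
  have h := (((hasDerivAt_id τ).add_const 1).const_mul (-lam)).exp
  have e : -lam * wt lam τ = Real.exp (-lam * (id τ + 1)) * (-lam * 1) := by
    simp only [wt, id]; ring
  rw [e]; exact h

theorem contDiff_wt (lam : ℝ) {n : ℕ} : ContDiff ℝ n (wt lam) := by
  unfold wt; fun_prop

theorem contDiffAt_inv_one_sub {n : ℕ} {τ : ℝ} (h : τ < 1) :
    ContDiffAt ℝ n (fun t : ℝ => (1 - t)⁻¹) τ :=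
  (contDiffAt_const.sub contDiffAt_id).inv (by simp only [id]; linarith)

theorem contDiffAt_fluxTau (lam : ℝ) {n : ℕ} {τ : ℝ} (h : τ < 1) :
    ContDiffAt ℝ n (fluxTau lam) τ :=
  (contDiff_wt lam).contDiffAt.mul
    ((contDiffAt_const.mul (contDiffAt_const.add contDiffAt_id)).mul (contDiffAt_inv_one_sub h))

theorem contDiffAt_fluxRho (lam : ℝ) {n : ℕ} {τ : ℝ} (h : τ < 1) :
    ContDiffAt ℝ n (fluxRho lam) τ :=
  ((contDiff_wt lam).contDiffAt.mul
    (contDiffAt_const.mul ((contDiffAt_inv_one_sub h).pow 2))).neg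

theorem contDiffAt_fluxAng (lam : ℝ) {n : ℕ} {τ : ℝ} (h : τ < 1) :
    ContDiffAt ℝ n (fluxAng lam) τ :=
  (contDiff_wt lam).contDiffAt.mul (contDiffAt_const.mul (contDiffAt_inv_one_sub h))

/-- The derivative of 2(1+τ)/(1-τ) is 4/(1-τ)², which is exactly the weight in `fluxRho` up to sign.
In the divergence this cancels the term from ∂_ρ falling on the factor ρ of `curRho`, leaving only
the damping and the exponential. -/
theorem hasDerivAt_fluxTau (lam : ℝ) {τ : ℝ} (h : τ < 1) :
    HasDerivAt (fluxTau lam) (-lam * fluxTau lam τ - fluxRho lam τ) τ := by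
  have hne : 1 - τ ≠ 0 := by linarith
  have h1 : HasDerivAt (fun t : ℝ => (1 - t)⁻¹) (-(-1) / (1 - τ) ^ 2) τ :=
    ((hasDerivAt_id τ).const_sub 1).fun_inv hne
  have h2 : HasDerivAt (fun t : ℝ => 2 * (1 + t)) (2 * 1) τ :=
    ((hasDerivAt_id τ).const_add 1).const_mul 2
  have h3 := (hasDerivAt_wt lam τ).mul (h2.mul h1)
  have e : -lam * fluxTau lam τ - fluxRho lam τ = -lam * wt lam τ * (2 * (1 + τ) * (1 - τ)⁻¹) +
      wt lam τ * (2 * 1 * (1 - τ)⁻¹ + 2 * (1 + τ) * (-(-1) / (1 - τ) ^ 2)) := by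
    unfold fluxTau fluxRho
    field_simp
    ring
  rw [e]; exact h3

/-- The energy current in the direction `∂_τ`. -/
def curTau (lam : ℝ) (u w : Pt → ℂ) (y : Pt) : ℂ :=
  (wt lam y.1 : ℂ) * (2 * (w y * (starRingEnd ℂ) (w y))) +
    (fluxTau lam y.1 : ℂ) * (u y * (starRingEnd ℂ) (u y))

/-- The energy current in the direction `∂_ρ`. -/
def curRho (lam : ℝ) (u : Pt → ℂ) (y : Pt) : ℂ :=
  (fluxRho lam y.1 : ℂ) * ((y.2.1 : ℂ) * (u y * (starRingEnd ℂ) (u y)))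

/-- The angular energy current. -/
def curAng (lam : ℝ) (u w : Pt → ℂ) (y : Pt) : ℂ :=
  (fluxAng lam y.1 : ℂ) * (u y * (starRingEnd ℂ) (w y))

theorem isCkAt_curTau (lam : ℝ) {u w : Pt → ℂ} {x : Pt} {n : ℕ} (hx : x.1 < 1)
    (hu : IsCkAt n u x) (hw : IsCkAt n w x) : IsCkAt n (curTau lam u w) x :=
  ((isCkAt_comp_tau (contDiff_wt lam).contDiffAt).mul ((hw.mul hw.conj).const_mul 2)).add
    ((isCkAt_comp_tau (contDiffAt_fluxTau lam hx)).mul (hu.mul hu.conj))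

theorem isCkAt_curRho (lam : ℝ) {u : Pt → ℂ} {x : Pt} {n : ℕ} (hx : x.1 < 1)
    (hu : IsCkAt n u x) : IsCkAt n (curRho lam u) x :=
  (isCkAt_comp_tau (contDiffAt_fluxRho lam hx)).mul ((isCkAt_rho n x).mul (hu.mul hu.conj))

theorem isCkAt_curAng (lam : ℝ) {u w : Pt → ℂ} {x : Pt} {n : ℕ} (hx : x.1 < 1)
    (hu : IsCkAt n u x) (hw : IsCkAt n w x) : IsCkAt n (curAng lam u w) x :=
  (isCkAt_comp_tau (contDiffAt_fluxAng lam hx)).mul (hu.mul hw.conj)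

theorem op_mul_apply {f g : Pt → ℂ} {x : Pt} (hf : IsCkAt 1 f x) (hg : IsCkAt 1 g x) (d : Dir) :
    d.op (fun y => f y * g y) x = d.op f x * g x + f x * d.op g x :=
  (op_mul hf hg d).self_of_nhds

theorem op_mul_conj {f g : Pt → ℂ} {x : Pt} (hf : IsCkAt 1 f x) (hg : IsCkAt 1 g x) (d : Dir) :
    d.op (fun y => f y * (starRingEnd ℂ) (g y)) x =
      d.op f x * (starRingEnd ℂ) (g x) + f x * (starRingEnd ℂ) (d.op g x) := by
  have h : d.op (fun y => (starRingEnd ℂ) (g y)) x = (starRingEnd ℂ) (d.op g x) :=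
    (op_conj hg d).self_of_nhds
  rw [op_mul_apply hf hg.conj d, h]

theorem dTau_curTau (lam : ℝ) {u w : Pt → ℂ} {x : Pt} (hx : x.1 < 1)
    (hu : IsCkAt 1 u x) (hw : IsCkAt 1 w x) : dTau (curTau lam u w) x =
      -lam * curTau lam u w x - fluxRho lam x.1 * (u x * (starRingEnd ℂ) (u x)) +
      wt lam x.1 * (2 * (dTau w x * (starRingEnd ℂ) (w x) + w x * (starRingEnd ℂ) (dTau w x))) +
      fluxTau lam x.1 *
        (dTau u x * (starRingEnd ℂ) (u x) + u x * (starRingEnd ℂ) (dTau u x)) := by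
  have c1 : IsCkAt 1 (fun y : Pt => (wt lam y.1 : ℂ)) x :=
    isCkAt_comp_tau (contDiff_wt lam).contDiffAt
  have c2 : IsCkAt 1 (fun y : Pt => (fluxTau lam y.1 : ℂ)) x :=
    isCkAt_comp_tau (contDiffAt_fluxTau lam hx)
  have hww := hw.mul hw.conj
  have e : dTau (curTau lam u w) x =
      Dir.tau.op (fun y => (wt lam y.1 : ℂ) * (2 * (w y * (starRingEnd ℂ) (w y)))) x +
      Dir.tau.op (fun y => (fluxTau lam y.1 : ℂ) * (u y * (starRingEnd ℂ) (u y))) x :=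
    (op_add (c1.mul (hww.const_mul 2)) (c2.mul (hu.mul hu.conj)) .tau).self_of_nhds
  have e' : Dir.tau.op (fun y => 2 * (w y * (starRingEnd ℂ) (w y))) x =
      2 * Dir.tau.op (fun y => w y * (starRingEnd ℂ) (w y)) x :=
    (op_const_mul hww 2 .tau).self_of_nhds
  rw [e, op_mul_apply c1 (hww.const_mul 2), op_mul_apply c2 (hu.mul hu.conj), e',
    op_mul_conj hw hw, op_mul_conj hu hu, op_tau_comp_tau (hasDerivAt_wt lam x.1),
    op_tau_comp_tau (hasDerivAt_fluxTau lam hx)]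
  simp only [curTau, op_tau]
  push_cast
  ring

theorem dRho_curRho (lam : ℝ) {u : Pt → ℂ} {x : Pt} (hx : x.1 < 1)
    (hu : IsCkAt 1 u x) : dRho (curRho lam u) x = fluxRho lam x.1 * (u x * (starRingEnd ℂ) (u x)) +
      fluxRho lam x.1 * x.2.1 *
        (dRho u x * (starRingEnd ℂ) (u x) + u x * (starRingEnd ℂ) (dRho u x)) := by
  have c : IsCkAt 1 (fun y : Pt => (fluxRho lam y.1 : ℂ)) x :=
    isCkAt_comp_tau (contDiffAt_fluxRho lam hx)
  have e : dRho (curRho lam u) x = _ :=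
    op_mul_apply c ((isCkAt_rho 1 x).mul (hu.mul hu.conj)) .rho
  rw [e, op_mul_apply (isCkAt_rho 1 x) (hu.mul hu.conj), op_mul_conj hu hu,
    op_comp_tau_of_ne (by simp), op_rho_coord_rho]
  simp only [op_rho]
  ring

theorem Z_curAng (lam : ℝ) {u w : Pt → ℂ} {x : Pt} (hx : x.1 < 1) (k : Fin 3)
    (hu : IsCkAt 1 u x) (hw : IsCkAt 1 w x) : Z k (curAng lam u w) x = fluxAng lam x.1 *
      (Z k u x * (starRingEnd ℂ) (w x) + u x * (starRingEnd ℂ) (Z k w x)) := by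
  have c : IsCkAt 1 (fun y : Pt => (fluxAng lam y.1 : ℂ)) x :=
    isCkAt_comp_tau (contDiffAt_fluxAng lam hx)
  have e : Z k (curAng lam u w) x = _ := op_mul_apply c (hu.mul hw.conj) (.ang k)
  rw [e, op_mul_conj hu hw, op_comp_tau_of_ne (by simp)]
  simp only [op_ang]
  ring

/-- The divergence of the energy current of a solution of the transport system. -/
theorem div_current (lam : ℝ) {u w r e : Pt → ℂ} {k l : ℝ} {x : Pt} (hx : x.1 < 1)
    (hu : IsCkAt 1 u x) (hw : IsCkAt 1 w x)
    (h1 : (1 - (x.1 : ℂ)) * dTau w x = l * w x + XPlus u x + r x)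
    (h2 : (1 + (x.1 : ℂ)) * dTau u x - 2 * x.2.1 * (1 - (x.1 : ℂ))⁻¹ * dRho u x =
      -k * u x + XMinus w x + e x) :
    dTau (curTau lam u w) x + dRho (curRho lam u) x -
        (XPlus (curAng lam u w) x + XMinus (curAng lam w u) x) =
      ((fluxAng lam x.1 * (2 * l * ‖w x‖ ^ 2 - 2 * k * ‖u x‖ ^ 2 +
          2 * (r x * (starRingEnd ℂ) (w x)).re + 2 * (e x * (starRingEnd ℂ) (u x)).re) -
        lam * (wt lam x.1 * (2 * ‖w x‖ ^ 2) + fluxTau lam x.1 * ‖u x‖ ^ 2) : ℝ) : ℂ) := by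
  have hne : 1 - (x.1 : ℂ) ≠ 0 := by
    have : (1 - x.1 : ℝ) ≠ 0 := by linarith
    exact_mod_cast this
  have h1c := congrArg (starRingEnd ℂ) h1
  have h2c := congrArg (starRingEnd ℂ) h2
  -- Real parts and squared norms are written through conjugates, which makes the claim a polynomial
  -- identity in the functions, their derivatives and the conjugates of both.
  have re2 (z v : ℂ) : ((2 * (z * (starRingEnd ℂ) v).re : ℝ) : ℂ) =
      z * (starRingEnd ℂ) v + (starRingEnd ℂ) z * v := by
    have := Complex.add_conj (z * (starRingEnd ℂ) v)
    rw [map_mul, Complex.conj_conj] at this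
    rw [this]
  have nsq (z : ℂ) : ((‖z‖ : ℝ) : ℂ) ^ 2 = z * (starRingEnd ℂ) z := by
    rw [Complex.mul_conj, Complex.normSq_eq_norm_sq]; norm_cast
  rw [dTau_curTau lam hx hu hw, dRho_curRho lam hx hu]
  rw [Complex.ofReal_sub, Complex.ofReal_mul (fluxAng lam x.1), Complex.ofReal_add,
    Complex.ofReal_add, re2, re2]
  simp only [XPlus, XMinus, Z_curAng lam hx _ hu hw, Z_curAng lam hx _ hw hu] at *
  simp only [curTau, fluxTau, fluxRho, fluxAng]
  push_cast
  simp only [nsq]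
  simp only [map_mul, map_add, map_sub, map_neg, map_one, map_inv₀, Complex.conj_ofReal,
    Complex.conj_I, map_ofNat] at h1c h2c
  generalize hj : (1 - (x.1 : ℂ))⁻¹ = j at *
  have hj1 : j * (1 - (x.1 : ℂ)) = 1 := by rw [← hj]; exact inv_mul_cancel₀ hne
  generalize (starRingEnd ℂ) (u x) = uc at *
  generalize (starRingEnd ℂ) (w x) = wc at *
  -- The two equations are multiplied by the conjugates of w and u with the common weight `fluxAng`,
  -- and their conjugates by w and u. Since conjugation exchanges X₊ and X₋, the angular terms form
  -- exact derivatives of the angular current.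
  linear_combination (2 * (wt lam x.1 : ℂ) * j * wc) * h1 + (2 * (wt lam x.1 : ℂ) * j * w x) * h1c +
    (2 * (wt lam x.1 : ℂ) * j * uc) * h2 + (2 * (wt lam x.1 : ℂ) * j * u x) * h2c -
    2 * (wt lam x.1 : ℂ) * (dTau w x * wc + w x * (starRingEnd ℂ) (dTau w x)) * hj1

/-! ### Absorption of the coupling and the energy inequality -/

/-- The growth rate of the energy for a system with `n` unknowns of each kind and coefficients
bounded by `M`. -/
def growthRate (M : ℝ) (n : ℕ) : ℝ := 2 * M + 4 * M ^ 2 * n ^ 2 + 1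

/-- The coupling terms are absorbed by the damping of `u` and the exponential weight. -/
theorem sum_coupling_le {ι : Type*} (I : Finset ι) {M : ℝ} (u w r e : ι → ℂ)
    (k l : ι → ℝ) (hk : ∀ i ∈ I, 1 ≤ k i) (hl : ∀ i ∈ I, l i ≤ M)
    (hr : ∀ i ∈ I, ‖r i‖ ≤ M * ∑ j ∈ I, ‖u j‖) (he : ∀ i ∈ I, ‖e i‖ ≤ M * ∑ j ∈ I, ‖w j‖) :
    ∑ i ∈ I, (2 * l i * ‖w i‖ ^ 2 - 2 * k i * ‖u i‖ ^ 2 +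
        2 * (r i * (starRingEnd ℂ) (w i)).re + 2 * (e i * (starRingEnd ℂ) (u i)).re) ≤
      (growthRate M I.card - 1) * ∑ i ∈ I, ‖w i‖ ^ 2 - ∑ i ∈ I, ‖u i‖ ^ 2 := by
  set U := ∑ j ∈ I, ‖u j‖ with hU
  set W := ∑ j ∈ I, ‖w j‖ with hW
  have hU0 : 0 ≤ U := Finset.sum_nonneg fun _ _ => norm_nonneg _
  have hW0 : 0 ≤ W := Finset.sum_nonneg fun _ _ => norm_nonneg _
  have hUs : U ^ 2 ≤ I.card * ∑ i ∈ I, ‖u i‖ ^ 2 := sq_sum_le_card_mul_sum_sq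
  have hWs : W ^ 2 ≤ I.card * ∑ i ∈ I, ‖w i‖ ^ 2 := sq_sum_le_card_mul_sum_sq
  have hre (z v : ℂ) {b : ℝ} (h : ‖z‖ ≤ b) : (z * (starRingEnd ℂ) v).re ≤ b * ‖v‖ := by
    refine (Complex.re_le_norm _).trans ?_
    rw [norm_mul, Complex.norm_conj]
    exact mul_le_mul_of_nonneg_right h (norm_nonneg _)
  have h1 : ∑ i ∈ I, (2 * l i * ‖w i‖ ^ 2 - 2 * k i * ‖u i‖ ^ 2 +
        2 * (r i * (starRingEnd ℂ) (w i)).re + 2 * (e i * (starRingEnd ℂ) (u i)).re) ≤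
      ∑ i ∈ I, (2 * M * ‖w i‖ ^ 2 - 2 * ‖u i‖ ^ 2 + 2 * (M * U) * ‖w i‖ + 2 * (M * W) * ‖u i‖) := by
    refine Finset.sum_le_sum fun i hi => ?_
    have a1 := hre (r i) (w i) (hr i hi)
    have a2 := hre (e i) (u i) (he i hi)
    have a3 := mul_le_mul_of_nonneg_right (hl i hi) (sq_nonneg ‖w i‖)
    have a4 := mul_le_mul_of_nonneg_right (hk i hi) (sq_nonneg ‖u i‖)
    linarith
  have h2 : ∑ i ∈ I, (2 * M * ‖w i‖ ^ 2 - 2 * ‖u i‖ ^ 2 + 2 * (M * U) * ‖w i‖ +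
      2 * (M * W) * ‖u i‖) =
      2 * M * ∑ i ∈ I, ‖w i‖ ^ 2 - 2 * ∑ i ∈ I, ‖u i‖ ^ 2 + 4 * M * U * W := by
    simp only [Finset.sum_add_distrib, Finset.sum_sub_distrib, ← Finset.mul_sum]
    rw [← hU, ← hW]; ring
  -- Young's inequality weighted to spend only one of the two available units of damping of u. The
  -- other unit is what bounds u in the end; the large constant falls on w, where the exponential
  -- weight pays for it.
  have h3 : 4 * M * U * W ≤ ∑ i ∈ I, ‖u i‖ ^ 2 + 4 * M ^ 2 * I.card ^ 2 * ∑ i ∈ I, ‖w i‖ ^ 2 := by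
    rcases Nat.eq_zero_or_pos I.card with h0 | h0
    · have : I = ∅ := Finset.card_eq_zero.1 h0
      simp [hU, this]
    · have hn : (0 : ℝ) < I.card := by exact_mod_cast h0
      have a1 := sq_nonneg (U - 2 * M * I.card * W)
      have a2 := mul_le_mul_of_nonneg_left hWs (show 0 ≤ 4 * M ^ 2 * (I.card : ℝ) ^ 2 by positivity)
      refine le_of_mul_le_mul_left ?_ hn
      nlinarith
  unfold growthRate
  linarith

theorem wt_pos (lam τ : ℝ) : 0 < wt lam τ := Real.exp_pos _

theorem wt_le_one {lam τ : ℝ} (hlam : 0 ≤ lam) (h : -1 ≤ τ) : wt lam τ ≤ 1 := by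
  unfold wt
  rw [Real.exp_le_one_iff]
  nlinarith

theorem exp_neg_le_wt {lam τ : ℝ} (hlam : 0 ≤ lam) (h : τ ≤ 0) : Real.exp (-lam) ≤ wt lam τ := by
  unfold wt
  rw [Real.exp_le_exp]
  nlinarith

theorem mem_box {a b c d : ℝ} {x : Pt} :
    x ∈ box a b c d ↔ x.1 ∈ Set.Icc a b ∧ x.2.1 ∈ Set.Icc c d := by
  simp [box, Set.mem_prod]

/-- The differentiated equations hold only at interior points, where the original equations hold on
a neighbourhood. Under the integral the faces do not matter. -/
theorem ae_mem_interior_box (a b c d : ℝ) :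
    ∀ᵐ x ∂(dv.restrict (box a b c d)), x.1 ∈ Set.Ioo a b ∧ x.2.1 ∈ Set.Ioo c d := by
  have h : (Set.Ioo a b ×ˢ Set.Ioo c d ×ˢ (Set.univ : Set SU2) : Set Pt) =ᵐ[dv] box a b c d :=
    Measure.set_prod_ae_eq Ioo_ae_eq_Icc
      (Measure.set_prod_ae_eq Ioo_ae_eq_Icc Filter.EventuallyEq.rfl)
  rw [← Measure.restrict_congr_set h]
  filter_upwards [ae_restrict_mem
    (measurableSet_Ioo.prod (measurableSet_Ioo.prod MeasurableSet.univ))] with x hx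
  exact ⟨hx.1, hx.2.1⟩

theorem curTau_eq (lam : ℝ) (u w : Pt → ℂ) (y : Pt) : curTau lam u w y =
    ((wt lam y.1 * (2 * ‖w y‖ ^ 2) + fluxTau lam y.1 * ‖u y‖ ^ 2 : ℝ) : ℂ) := by
  simp only [curTau, Complex.mul_conj, Complex.normSq_eq_norm_sq]
  push_cast; ring

theorem curRho_eq (lam : ℝ) (u : Pt → ℂ) (y : Pt) : curRho lam u y =
    ((fluxRho lam y.1 * (y.2.1 * ‖u y‖ ^ 2) : ℝ) : ℂ) := by
  simp only [curRho, Complex.mul_conj, Complex.normSq_eq_norm_sq]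
  push_cast; ring

theorem continuousOn_slice_tau {E : Type*} [TopologicalSpace E] {f : Pt → E} {a c d : ℝ}
    (hf : ∀ y ∈ Set.Icc c d ×ˢ (Set.univ : Set SU2), ContinuousAt f (a, y.1, y.2)) :
    ContinuousOn (fun y : ℝ × SU2 => f (a, y.1, y.2)) (Set.Icc c d ×ˢ Set.univ) := fun y hy =>
  (ContinuousAt.comp (f := fun y : ℝ × SU2 => ((a, y.1, y.2) : Pt)) (x := y) (hf y hy)
    (by fun_prop)).continuousWithinAt

theorem continuousOn_slice_rho {E : Type*} [TopologicalSpace E] {f : Pt → E} {a b c : ℝ}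
    (hf : ∀ y ∈ Set.Icc a b ×ˢ (Set.univ : Set SU2), ContinuousAt f (y.1, c, y.2)) :
    ContinuousOn (fun y : ℝ × SU2 => f (y.1, c, y.2)) (Set.Icc a b ×ˢ Set.univ) := fun y hy =>
  (ContinuousAt.comp (f := fun y : ℝ × SU2 => ((y.1, c, y.2) : Pt)) (x := y) (hf y hy)
    (by fun_prop)).continuousWithinAt

/-- The flux balance for a single pair `(u, w)`. -/
theorem flux_balance {lam T c d : ℝ} (hlam : 0 ≤ lam) (hT : -1 ≤ T) (hT0 : T ≤ 0) (hc : 0 ≤ c)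
    (hcd : c ≤ d) {u w r e : Pt → ℂ} {k l : ℝ}
    (hu : ∀ x ∈ box (-1) T c d, IsCkAt 1 u x) (hw : ∀ x ∈ box (-1) T c d, IsCkAt 1 w x)
    (h1 : ∀ x : Pt, x.1 ∈ Set.Ioo (-1) T → x.2.1 ∈ Set.Ioo c d →
      (1 - (x.1 : ℂ)) * dTau w x = l * w x + XPlus u x + r x)
    (h2 : ∀ x : Pt, x.1 ∈ Set.Ioo (-1) T → x.2.1 ∈ Set.Ioo c d →
      (1 + (x.1 : ℂ)) * dTau u x - 2 * x.2.1 * (1 - (x.1 : ℂ))⁻¹ * dRho u x =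
        -k * u x + XMinus w x + e x) :
    IntegrableOn (fun x => fluxAng lam x.1 * (2 * l * ‖w x‖ ^ 2 - 2 * k * ‖u x‖ ^ 2 +
          2 * (r x * (starRingEnd ℂ) (w x)).re + 2 * (e x * (starRingEnd ℂ) (u x)).re) -
        lam * (wt lam x.1 * (2 * ‖w x‖ ^ 2) + fluxTau lam x.1 * ‖u x‖ ^ 2))
      (box (-1) T c d) dv ∧
    -((∫ y in Set.Icc c d ×ˢ (Set.univ : Set SU2), 2 * ‖w (-1, y.1, y.2)‖ ^ 2
        ∂((volume : Measure ℝ).prod haarSU2)) +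
      ∫ y in Set.Icc (-1) T ×ˢ (Set.univ : Set SU2), 4 * d * (1 - y.1)⁻¹ ^ 2 *
        ‖u (y.1, d, y.2)‖ ^ 2 ∂((volume : Measure ℝ).prod haarSU2)) ≤
    ∫ x in box (-1) T c d, (fluxAng lam x.1 * (2 * l * ‖w x‖ ^ 2 - 2 * k * ‖u x‖ ^ 2 +
          2 * (r x * (starRingEnd ℂ) (w x)).re + 2 * (e x * (starRingEnd ℂ) (u x)).re) -
        lam * (wt lam x.1 * (2 * ‖w x‖ ^ 2) + fluxTau lam x.1 * ‖u x‖ ^ 2)) ∂dv := by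
  have hlt : ∀ x ∈ box (-1) T c d, x.1 < 1 := fun x hx => by
    have := (mem_box.1 hx).1.2; linarith
  have hA : ∀ x ∈ box (-1) T c d, IsCkAt 1 (curTau lam u w) x := fun x hx =>
    isCkAt_curTau lam (hlt x hx) (hu x hx) (hw x hx)
  have hB : ∀ x ∈ box (-1) T c d, IsCkAt 1 (curRho lam u) x := fun x hx =>
    isCkAt_curRho lam (hlt x hx) (hu x hx)
  obtain ⟨hint, hdiv⟩ := integral_div_box hT hcd hA hB
    (fun x hx => isCkAt_curAng lam (hlt x hx) (hu x hx) (hw x hx))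
    (fun x hx => isCkAt_curAng lam (hlt x hx) (hw x hx) (hu x hx))
  have hae : (fun x => dTau (curTau lam u w) x + dRho (curRho lam u) x -
        (XPlus (curAng lam u w) x + XMinus (curAng lam w u) x)) =ᵐ[dv.restrict (box (-1) T c d)]
      fun x => ((fluxAng lam x.1 * (2 * l * ‖w x‖ ^ 2 - 2 * k * ‖u x‖ ^ 2 +
          2 * (r x * (starRingEnd ℂ) (w x)).re + 2 * (e x * (starRingEnd ℂ) (u x)).re) -
        lam * (wt lam x.1 * (2 * ‖w x‖ ^ 2) + fluxTau lam x.1 * ‖u x‖ ^ 2) : ℝ) : ℂ) := by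
    filter_upwards [ae_mem_interior_box (-1) T c d] with x hx
    have hb : x ∈ box (-1) T c d :=
      mem_box.2 ⟨Set.Ioo_subset_Icc_self hx.1, Set.Ioo_subset_Icc_self hx.2⟩
    exact div_current lam (hlt x hb) (hu x hb) (hw x hb) (h1 x hx.1 hx.2) (h2 x hx.1 hx.2)
  refine ⟨(hint.congr_fun_ae hae).re, ?_⟩
  rw [integral_congr_ae hae, integral_complex_ofReal] at hdiv
  have hbT (y : ℝ × SU2) (hy : y ∈ Set.Icc c d ×ˢ (Set.univ : Set SU2)) (t : ℝ)
      (ht : t ∈ Set.Icc (-1) T) : ((t, y.1, y.2) : Pt) ∈ box (-1) T c d := mem_box.2 ⟨ht, hy.1⟩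
  have hbR (y : ℝ × SU2) (hy : y ∈ Set.Icc (-1) T ×ˢ (Set.univ : Set SU2)) (s : ℝ)
      (hs : s ∈ Set.Icc c d) : ((y.1, s, y.2) : Pt) ∈ box (-1) T c d := mem_box.2 ⟨hy.1, hs⟩
  have hm1 : (-1 : ℝ) ∈ Set.Icc (-1) T := ⟨le_rfl, hT⟩
  have hTT : T ∈ Set.Icc (-1) T := ⟨hT, le_rfl⟩
  have hcc : c ∈ Set.Icc c d := ⟨le_rfl, hcd⟩
  have hdd : d ∈ Set.Icc c d := ⟨hcd, le_rfl⟩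
  set a : Pt → ℝ := fun y => wt lam y.1 * (2 * ‖w y‖ ^ 2) + fluxTau lam y.1 * ‖u y‖ ^ 2 with ha
  set b : Pt → ℝ := fun y => fluxRho lam y.1 * (y.2.1 * ‖u y‖ ^ 2) with hb
  have hca : ∀ x ∈ box (-1) T c d, ContinuousAt a x := fun x hx => by
    have := Complex.continuous_re.continuousAt.comp (hA x hx).continuousAt
    refine this.congr (Filter.Eventually.of_forall fun y => ?_)
    simp only [Function.comp, curTau_eq, Complex.ofReal_re, ha]
  have hcb : ∀ x ∈ box (-1) T c d, ContinuousAt b x := fun x hx => by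
    have := Complex.continuous_re.continuousAt.comp (hB x hx).continuousAt
    refine this.congr (Filter.Eventually.of_forall fun y => ?_)
    simp only [Function.comp, curRho_eq, Complex.ofReal_re, hb]
  have hcu : ∀ x ∈ box (-1) T c d, ContinuousAt (fun y => 4 * d * (1 - y.1)⁻¹ ^ 2 * ‖u y‖ ^ 2) x :=
    fun x hx => by
      have h1 : ContinuousAt (fun y : Pt => (1 - y.1)⁻¹) x :=
        (continuousAt_const.sub continuousAt_fst).inv₀ 
          (by change 1 - x.1 ≠ 0; have := hlt x hx; linarith)
      exact (continuousAt_const.mul (h1.pow 2)).mul ((hu x hx).continuousAt.norm.pow 2)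
  have hcw : ∀ x ∈ box (-1) T c d, ContinuousAt (fun y => 2 * ‖w y‖ ^ 2) x := fun x hx =>
    continuousAt_const.mul ((hw x hx).continuousAt.norm.pow 2)
  have e1 : ∀ y : ℝ × SU2, curTau lam u w (T, y.1, y.2) - curTau lam u w (-1, y.1, y.2) =
      ((a (T, y.1, y.2) - a (-1, y.1, y.2) : ℝ) : ℂ) := fun y => by
    rw [curTau_eq, curTau_eq, Complex.ofReal_sub]
  have e2 : ∀ y : ℝ × SU2, curRho lam u (y.1, d, y.2) - curRho lam u (y.1, c, y.2) =
      ((b (y.1, d, y.2) - b (y.1, c, y.2) : ℝ) : ℂ) := fun y => by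
    rw [curRho_eq, curRho_eq, Complex.ofReal_sub]
  simp_rw [e1, e2] at hdiv
  rw [integral_complex_ofReal, integral_complex_ofReal] at hdiv
  rw [show ∀ z z' v : ℝ, ((z : ℂ) = z' + v ↔ z = z' + v) from
    fun z z' v => by exact_mod_cast Iff.rfl] at hdiv
  rw [hdiv, neg_add, ← integral_neg, ← integral_neg]
  refine add_le_add ?_ ?_
  · refine setIntegral_mono_on
      (integrableOn_slice (continuousOn_slice_tau fun y hy => hcw _ (hbT y hy _ hm1))).neg
      ((integrableOn_slice (continuousOn_slice_tau fun y hy => hca _ (hbT y hy _ hTT))).sub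
        (integrableOn_slice (continuousOn_slice_tau fun y hy => hca _ (hbT y hy _ hm1))))
      (measurableSet_Icc.prod MeasurableSet.univ) fun y hy => ?_
    -- The flux through the top is nonnegative and is discarded.
    have p1 : 0 ≤ a (T, y.1, y.2) := by
      have := (wt_pos lam T).le
      have h1 : 0 ≤ 1 + T := by linarith
      have h2 : 0 ≤ (1 - T)⁻¹ := inv_nonneg.2 (by linarith)
      simp only [ha, fluxTau]
      positivity
    -- At τ = -1 the factor 1+τ removes u and the exponential weight equals 1.
    have p2 : a (-1, y.1, y.2) = 2 * ‖w (-1, y.1, y.2)‖ ^ 2 := by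
      simp [ha, fluxTau, wt]
    linarith
  · refine setIntegral_mono_on
      (integrableOn_slice (continuousOn_slice_rho fun y hy => hcu _ (hbR y hy _ hdd))).neg
      ((integrableOn_slice (continuousOn_slice_rho fun y hy => hcb _ (hbR y hy _ hdd))).sub
        (integrableOn_slice (continuousOn_slice_rho fun y hy => hcb _ (hbR y hy _ hcc))))
      (measurableSet_Icc.prod MeasurableSet.univ) fun y hy => ?_
    have p0 : 0 ≤ 4 * (1 - y.1)⁻¹ ^ 2 := by positivity
    -- The flux through the inner side also has the favourable sign, so no data are needed towards
    -- the cylinder ρ = 0.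
    have p1 : b (y.1, c, y.2) ≤ 0 := by
      simp only [hb, fluxRho, neg_mul]
      have := (wt_pos lam y.1).le
      rw [neg_nonpos]
      positivity
    have p2 : -(4 * d * (1 - y.1)⁻¹ ^ 2 * ‖u (y.1, d, y.2)‖ ^ 2) ≤ b (y.1, d, y.2) := by
      have h1 := wt_le_one hlam hy.1.1
      have h2 : 0 ≤ 4 * (1 - y.1)⁻¹ ^ 2 * (d * ‖u (y.1, d, y.2)‖ ^ 2) := by
        have : 0 ≤ d := hc.trans hcd
        positivity
      simp only [hb, fluxRho]
      nlinarith
    linarith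

/-- The energy estimate on a rectangle. -/
theorem energy_box {ι : Type*} (I : Finset ι) {M : ℝ} (hM : 0 ≤ M) {T c d : ℝ} (hT : -1 ≤ T)
    (hT0 : T ≤ 0) (hc : 0 ≤ c) (hcd : c ≤ d) {u w r e : ι → Pt → ℂ} {k l : ι → ℝ}
    (hk : ∀ i ∈ I, 1 ≤ k i) (hl : ∀ i ∈ I, l i ≤ M)
    (hu : ∀ i ∈ I, ∀ x ∈ box (-1) T c d, IsCkAt 1 (u i) x)
    (hw : ∀ i ∈ I, ∀ x ∈ box (-1) T c d, IsCkAt 1 (w i) x)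
    (h1 : ∀ i ∈ I, ∀ x : Pt, x.1 ∈ Set.Ioo (-1) T → x.2.1 ∈ Set.Ioo c d →
      (1 - (x.1 : ℂ)) * dTau (w i) x = l i * w i x + XPlus (u i) x + r i x)
    (h2 : ∀ i ∈ I, ∀ x : Pt, x.1 ∈ Set.Ioo (-1) T → x.2.1 ∈ Set.Ioo c d →
      (1 + (x.1 : ℂ)) * dTau (u i) x - 2 * x.2.1 * (1 - (x.1 : ℂ))⁻¹ * dRho (u i) x =
        -k i * u i x + XMinus (w i) x + e i x)
    (hr : ∀ i ∈ I, ∀ x : Pt, x.1 ∈ Set.Ioo (-1) T → x.2.1 ∈ Set.Ioo c d →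
      ‖r i x‖ ≤ M * ∑ j ∈ I, ‖u j x‖)
    (he : ∀ i ∈ I, ∀ x : Pt, x.1 ∈ Set.Ioo (-1) T → x.2.1 ∈ Set.Ioo c d →
      ‖e i x‖ ≤ M * ∑ j ∈ I, ‖w j x‖) :
    ∫ x in box (-1) T c d, 2 * (1 - x.1)⁻¹ * ∑ i ∈ I, (‖u i x‖ ^ 2 + ‖w i x‖ ^ 2) ∂dv ≤
      Real.exp (growthRate M I.card) * ∑ i ∈ I,
      ((∫ y in Set.Icc c d ×ˢ (Set.univ : Set SU2), 2 * ‖w i (-1, y.1, y.2)‖ ^ 2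
        ∂((volume : Measure ℝ).prod haarSU2)) +
      ∫ y in Set.Icc (-1) T ×ˢ (Set.univ : Set SU2), 4 * d * (1 - y.1)⁻¹ ^ 2 *
        ‖u i (y.1, d, y.2)‖ ^ 2 ∂((volume : Measure ℝ).prod haarSU2)) := by
  set lam := growthRate M I.card with hlamdef
  have hlam : 1 ≤ lam := by
    have : 0 ≤ 2 * M + 4 * M ^ 2 * (I.card : ℝ) ^ 2 := by positivity
    simp only [hlamdef, growthRate]; linarith
  have hfb := fun i hi => flux_balance (zero_le_one.trans hlam) hT hT0 hc hcd (hu i hi) (hw i hi)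
    (h1 i hi) (h2 i hi)
  have hsum := Finset.sum_le_sum fun i hi => (hfb i hi).2
  rw [← integral_finsetSum _ fun i hi => (hfb i hi).1, Finset.sum_neg_distrib] at hsum
  have hcS : ∀ x ∈ box (-1) T c d, ContinuousAt
      (fun x : Pt => 2 * (1 - x.1)⁻¹ * ∑ i ∈ I, (‖u i x‖ ^ 2 + ‖w i x‖ ^ 2)) x := by
    intro x hx
    have hx1 : 1 - x.1 ≠ 0 := by have := (mem_box.1 hx).1.2; linarith
    have h1 : ContinuousAt (fun y : Pt => (1 - y.1)⁻¹) x :=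
      (continuousAt_const.sub continuousAt_fst).inv₀ hx1
    refine (continuousAt_const.mul h1).mul (tendsto_finsetSum _ fun i hi => ?_)
    exact ((hu i hi x hx).continuousAt.norm.pow 2).add ((hw i hi x hx).continuousAt.norm.pow 2)
  have hint := integrableOn_box hcS
  -- Pointwise, the coupling contributes at most `fluxAng` times (λ-1)|w|² - |u|². The term
  -- -2λ·`wt`·|w|² coming from the exponential cancels the λ|w|², because (1-τ)⁻¹ ≤ 1 for τ ≤ 0.
  -- What remains is at most -`fluxAng`·(|u|²+|w|²), and `wt` ≥ exp(-λ).
  have hmono := integral_mono_ae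
    (integrable_finsetSum I fun i hi => (hfb i hi).1) (hint.const_mul (-Real.exp (-lam))) (by
      filter_upwards [ae_mem_interior_box (-1) T c d] with x hx
      have hc1 := sum_coupling_le I (fun i => u i x) (fun i => w i x) (fun i => r i x)
        (fun i => e i x) k l hk hl (fun i hi => hr i hi x hx.1 hx.2)
        (fun i hi => he i hi x hx.1 hx.2)
      rw [← hlamdef] at hc1
      simp only [Finset.sum_sub_distrib, ← Finset.mul_sum, Finset.sum_add_distrib] at hc1 ⊢
      set S := ∑ i ∈ I, ‖u i x‖ ^ 2
      set S' := ∑ i ∈ I, ‖w i x‖ ^ 2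
      have hS : 0 ≤ S := Finset.sum_nonneg fun _ _ => by positivity
      have hS' : 0 ≤ S' := Finset.sum_nonneg fun _ _ => by positivity
      have hj0 : 0 ≤ (1 - x.1)⁻¹ := inv_nonneg.2 (by linarith [hx.1.2])
      have hj1 : (1 - x.1)⁻¹ ≤ 1 := inv_le_one_of_one_le₀ (by linarith [hx.1.2])
      have hE0 := (wt_pos lam x.1).le
      have hE1 := exp_neg_le_wt (zero_le_one.trans hlam) (hx.1.2.le.trans hT0)
      have hfA : 0 ≤ fluxAng lam x.1 := by unfold fluxAng; positivity
      have hfT : 0 ≤ fluxTau lam x.1 := by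
        have : 0 ≤ 1 + x.1 := by linarith [hx.1.1]
        unfold fluxTau; positivity
      have b1 := mul_le_mul_of_nonneg_left hc1 hfA
      have b2 : fluxAng lam x.1 * (lam * S') ≤ lam * (wt lam x.1 * (2 * S')) := by
        have : wt lam x.1 * (2 * (1 - x.1)⁻¹) * (lam * S') =
          lam * (wt lam x.1 * (2 * S')) * (1 - x.1)⁻¹ := by ring
        unfold fluxAng
        rw [this]
        exact mul_le_of_le_one_right (by positivity) hj1
      have b3 : 0 ≤ lam * (fluxTau lam x.1 * S) := by positivity
      have b4 : Real.exp (-lam) * (2 * (1 - x.1)⁻¹ * (S + S')) ≤ fluxAng lam x.1 * (S + S') := by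
        unfold fluxAng
        rw [mul_assoc (wt lam x.1)]
        exact mul_le_mul_of_nonneg_right hE1 (by positivity)
      nlinarith)
  rw [integral_const_mul] at hmono
  have hfin := hsum.trans hmono
  rw [neg_mul, neg_le_neg_iff] at hfin
  have := mul_le_mul_of_nonneg_left hfin (Real.exp_pos lam).le
  rwa [← mul_assoc, ← Real.exp_add, add_neg_cancel, Real.exp_zero, one_mul] at this

/-! ### Straightening the characteristics `ρ (1 - τ) = const` -/

/-- The map `(τ, s, g) ↦ (τ, 2s/(1-τ), g)`. -/
def straight (x : Pt) : Pt := (x.1, 2 * x.2.1 * (1 - x.1)⁻¹, x.2.2)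

theorem continuousAt_straight {x : Pt} (hx : x.1 < 1) : ContinuousAt straight x := by
  have h1 : ContinuousAt (fun y : Pt => (1 - y.1)⁻¹) x :=
    (continuousAt_const.sub continuousAt_fst).inv₀ (by change 1 - x.1 ≠ 0; linarith)
  have h2 : ContinuousAt (fun y : Pt => 2 * y.2.1) x := by fun_prop
  have h3 : ContinuousAt (fun y : Pt => y.2.2) x := by fun_prop
  exact continuousAt_fst.prodMk ((h2.mul h1).prodMk h3)

theorem IsCkAt.comp_straight {n : ℕ} {f : Pt → ℂ} {x : Pt} (hx : x.1 < 1)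
    (hf : IsCkAt n f (straight x)) : IsCkAt n (fun y => f (straight y)) x := by
  obtain ⟨F, hF, hfF⟩ := hf
  refine ⟨fun e => F (e.1, 2 * e.2.1 * (1 - e.1)⁻¹, e.2.2), ?_,
    (continuousAt_straight hx).eventually hfF⟩
  refine ContDiffAt.comp (ambient x) (g := F)
    (f := fun e : Amb => (e.1, 2 * e.2.1 * (1 - e.1)⁻¹, e.2.2)) hF ?_
  have h1 : ContDiffAt ℝ n (fun e : Amb => (1 - e.1)⁻¹) (ambient x) :=
    ContDiffAt.comp (ambient x) (g := fun t : ℝ => (1 - t)⁻¹) (f := fun e : Amb => e.1)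
      (contDiffAt_inv_one_sub hx) contDiffAt_fst
  have h2 : ContDiffAt ℝ n (fun e : Amb => 2 * e.2.1) (ambient x) :=
    (contDiff_const.mul (contDiff_fst.comp contDiff_snd)).contDiffAt
  exact contDiffAt_fst.prodMk ((h2.mul h1).prodMk (contDiff_snd.comp contDiff_snd).contDiffAt)

/-- Chain rule along an arbitrary curve whose straightened velocity is spanned by ∂_τ and ∂_ρ, so
that both partial derivatives of a composition with `straight` are instances. -/
theorem hasDerivAt_straight {F : Amb → ℂ} {f : Pt → ℂ} {x : Pt} {γ : ℝ → Pt} {t a b : ℝ}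
    (hx : x.1 < 1) (hF : DifferentiableAt ℝ F (ambient (straight x)))
    (h : ∀ᶠ y in 𝓝 (straight x), f y = F (ambient y)) (hγ : ContinuousAt γ t) (hγx : γ t = x)
    (hd : HasDerivAt (fun s => ambient (straight (γ s))) (a • Dir.tau.cst + b • Dir.rho.cst) t) :
    HasDerivAt (fun s => f (straight (γ s)))
      (a * dTau f (straight x) + b * dRho f (straight x)) t := by
  have e (d : Dir) := (hasDerivAt_comp_curve hF h d).deriv
  have e1 : dTau f (straight x) = fderiv ℝ F (ambient (straight x)) Dir.tau.cst := by
    exact (e .tau).trans (by simp [Dir.lin])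
  have e2 : dRho f (straight x) = fderiv ℝ F (ambient (straight x)) Dir.rho.cst := by
    exact (e .rho).trans (by simp [Dir.lin])
  have h1 := HasFDerivAt.comp_hasDerivAt_of_eq t hF.hasFDerivAt hd (by rw [hγx])
  rw [map_add, map_smul, map_smul, ← e1, ← e2, Complex.real_smul, Complex.real_smul] at h1
  refine h1.congr_of_eventuallyEq ?_
  have hc : ContinuousAt (fun s => straight (γ s)) t :=
    ContinuousAt.comp (g := straight) (by rw [hγx]; exact continuousAt_straight hx) hγ
  rw [ContinuousAt, hγx] at hc
  exact hc.eventually h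

theorem dTau_comp_straight {f : Pt → ℂ} {x : Pt} (hx : x.1 < 1) (hf : IsCkAt 1 f (straight x)) :
    dTau (fun y => f (straight y)) x =
      dTau f (straight x) + 2 * x.2.1 * (1 - (x.1 : ℂ))⁻¹ ^ 2 * dRho f (straight x) := by
  obtain ⟨F, hF, hfF⟩ := hf
  have hne : 1 - x.1 ≠ 0 := by linarith
  have hinv : HasDerivAt (fun t : ℝ => (1 - t)⁻¹) (-(-1) / (1 - x.1) ^ 2) x.1 :=
    ((hasDerivAt_id x.1).const_sub 1).fun_inv hne
  have hd : HasDerivAt (fun t : ℝ => ambient (straight (t, x.2.1, x.2.2)))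
      ((1 : ℝ) • Dir.tau.cst + (2 * x.2.1 * (1 - x.1)⁻¹ ^ 2) • Dir.rho.cst) x.1 := by
    have := (hasDerivAt_id x.1).prodMk ((hinv.const_mul (2 * x.2.1)).prodMk
      (hasDerivAt_const x.1 ((fun i j => x.2.2.1 i j) : (Fin 2 → Fin 2 → ℂ))))
    have e : (1 : ℝ) • Dir.tau.cst + (2 * x.2.1 * (1 - x.1)⁻¹ ^ 2) • Dir.rho.cst =
        (1, 2 * x.2.1 * (-(-1) / (1 - x.1) ^ 2), 0) := by
      simp [Dir.cst, div_eq_mul_inv]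
    rw [e]; exact this
  have := (hasDerivAt_straight (γ := fun t => (t, x.2.1, x.2.2)) hx (hF.differentiableAt (by simp))
    hfF (Dir.tau.continuous_curve x).continuousAt rfl hd).deriv
  refine Eq.trans this ?_
  push_cast; ring

theorem dRho_comp_straight {f : Pt → ℂ} {x : Pt} (hx : x.1 < 1) (hf : IsCkAt 1 f (straight x)) :
    dRho (fun y => f (straight y)) x = 2 * (1 - (x.1 : ℂ))⁻¹ * dRho f (straight x) := by
  obtain ⟨F, hF, hfF⟩ := hf
  have hd : HasDerivAt (fun t : ℝ => ambient (straight (x.1, t, x.2.2)))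
      ((0 : ℝ) • Dir.tau.cst + (2 * (1 - x.1)⁻¹) • Dir.rho.cst) x.2.1 := by
    have := (hasDerivAt_const x.2.1 x.1).prodMk
      ((((hasDerivAt_id x.2.1).const_mul 2).mul_const (1 - x.1)⁻¹).prodMk
      (hasDerivAt_const x.2.1 ((fun i j => x.2.2.1 i j) : (Fin 2 → Fin 2 → ℂ))))
    have e : (0 : ℝ) • Dir.tau.cst + (2 * (1 - x.1)⁻¹) • Dir.rho.cst =
        (0, 2 * 1 * (1 - x.1)⁻¹, 0) := by
      simp [Dir.cst]
    rw [e]; exact this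
  have := (hasDerivAt_straight (γ := fun t => (x.1, t, x.2.2)) hx (hF.differentiableAt (by simp))
    hfF (Dir.rho.continuous_curve x).continuousAt rfl hd).deriv
  refine Eq.trans this ?_
  push_cast; ring

/-- The quantity ρ(1-τ) is constant along (1-τ)∂_τ + ρ∂_ρ, so in the straightened coordinates this
field has no radial component. -/
theorem nullDer_neg_comp_straight {f : Pt → ℂ} {x : Pt} (hx : x.1 < 1)
    (hf : IsCkAt 1 f (straight x)) : (1 - (x.1 : ℂ)) * dTau (fun y => f (straight y)) x =
      nullDer (-1) f (straight x) := by
  have hne : 1 - (x.1 : ℂ) ≠ 0 := by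
    have : (1 - x.1 : ℝ) ≠ 0 := by linarith
    exact_mod_cast this
  rw [dTau_comp_straight hx hf]
  simp only [nullDer]
  simp only [straight]
  push_cast
  field_simp
  ring

theorem nullDer_one_comp_straight {f : Pt → ℂ} {x : Pt} (hx : x.1 < 1)
    (hf : IsCkAt 1 f (straight x)) : (1 + (x.1 : ℂ)) * dTau (fun y => f (straight y)) x -
      2 * x.2.1 * (1 - (x.1 : ℂ))⁻¹ * dRho (fun y => f (straight y)) x =
      nullDer 1 f (straight x) := by
  have hne : 1 - (x.1 : ℂ) ≠ 0 := by
    have : (1 - x.1 : ℝ) ≠ 0 := by linarith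
    exact_mod_cast this
  rw [dTau_comp_straight hx hf, dRho_comp_straight hx hf]
  simp only [nullDer]
  simp only [straight]
  push_cast
  field_simp
  ring

/-- The part `2c ≤ ρ (1 - τ) ≤ 2d`, `-1 ≤ τ ≤ T` of the cylinder. -/
def wedge (T c d : ℝ) : Set Pt :=
  {x | -1 ≤ x.1 ∧ x.1 ≤ T ∧ 2 * c * (1 - x.1)⁻¹ ≤ x.2.1 ∧ x.2.1 ≤ 2 * d * (1 - x.1)⁻¹}

theorem measurableSet_wedge (T c d : ℝ) : MeasurableSet (wedge T c d) := by
  have h : Measurable fun x : Pt => (1 - x.1)⁻¹ := by fun_prop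
  have h1 : Measurable fun x : Pt => x.1 := by fun_prop
  have h2 : Measurable fun x : Pt => x.2.1 := by fun_prop
  exact (measurableSet_le measurable_const h1).inter ((measurableSet_le h1 measurable_const).inter
    ((measurableSet_le (h.const_mul _) h2).inter (measurableSet_le h2 (h.const_mul _))))

theorem straight_mem_wedge {T c d : ℝ} (hT : T ≤ 0) {x : Pt} (h1 : x.1 ∈ Set.Icc (-1) T) :
    straight x ∈ wedge T c d ↔ x ∈ box (-1) T c d := by
  have hj : 0 < (1 - x.1)⁻¹ := inv_pos.2 (by linarith [h1.2])
  rw [mem_box]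
  simp only [straight, wedge, Set.mem_ofPred_eq, mul_le_mul_iff_left₀ hj]
  constructor
  · rintro ⟨-, -, h3, h4⟩
    exact ⟨h1, by linarith, by linarith⟩
  · rintro ⟨-, h3, h4⟩
    exact ⟨h1.1, h1.2, by linarith, by linarith⟩

/-- Rescaling the radial variable in an integral over `ℝ × SU(2)`. -/
theorem lintegral_scale {a : ℝ} (ha : 0 < a) (φ : ℝ × SU2 → ℝ≥0∞) :
    ∫⁻ y, φ y ∂((volume : Measure ℝ).prod haarSU2) =
      ∫⁻ y, ENNReal.ofReal a * φ (a * y.1, y.2) ∂((volume : Measure ℝ).prod haarSU2) := by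
  let S : ℝ × SU2 ≃ᵐ ℝ × SU2 :=
    (Homeomorph.mulLeft₀ a ha.ne').toMeasurableEquiv.prodCongr (MeasurableEquiv.refl SU2)
  have hmap : ((volume : Measure ℝ).prod haarSU2).map S =
      ENNReal.ofReal |a⁻¹| • (volume : Measure ℝ).prod haarSU2 := by
    have h := Measure.map_prod_map (volume : Measure ℝ) haarSU2
      (f := fun t => a * t) (g := id) (measurable_const_mul a) measurable_id
    rw [Real.map_volume_mul_left ha.ne', Measure.map_id, Measure.prod_smul_left] at h
    exact h.symm
  have h := lintegral_map_equiv (μ := (volume : Measure ℝ).prod haarSU2) φ S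
  rw [hmap, lintegral_smul_measure] at h
  rw [lintegral_const_mul' _ _ ENNReal.ofReal_ne_top]
  have hS : ∀ y : ℝ × SU2, S y = (a * y.1, y.2) := fun y => rfl
  simp only [hS] at h
  rw [← h, smul_eq_mul, ← mul_assoc, ← ENNReal.ofReal_mul ha.le, abs_of_pos (inv_pos.2 ha),
    mul_inv_cancel₀ ha.ne', ENNReal.ofReal_one, one_mul]

/-- On each slice of constant τ the map `straight` is a dilation of the radial variable by 2(1-τ)⁻¹.
This Jacobian is precisely the weight left over in `energy_box`, so the unweighted norm over the
wedge comes out. -/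
theorem lintegral_wedge {T c d : ℝ} (hT : T ≤ 0) {h : Pt → ℝ≥0∞}
    (hc : ∀ x ∈ wedge T c d, ContinuousAt h x) :
    ∫⁻ x in wedge T c d, h x ∂dv =
      ∫⁻ x in box (-1) T c d, ENNReal.ofReal (2 * (1 - x.1)⁻¹) * h (straight x) ∂dv := by
  have hbox : MeasurableSet (box (-1) T c d) := (isCompact_box _ _ _ _).measurableSet
  have hm1 : AEMeasurable h (dv.restrict (wedge T c d)) :=
    ContinuousOn.aemeasurable (fun x hx => (hc x hx).continuousWithinAt) (measurableSet_wedge _ _ _)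
  have hm2 : AEMeasurable (fun x => ENNReal.ofReal (2 * (1 - x.1)⁻¹) * h (straight x))
      (dv.restrict (box (-1) T c d)) := by
    refine AEMeasurable.mul ?_ ?_
    · have : Measurable fun x : Pt => ENNReal.ofReal (2 * (1 - x.1)⁻¹) := by fun_prop
      exact this.aemeasurable
    · refine ContinuousOn.aemeasurable (fun x hx => ?_) hbox
      have hx1 := (mem_box.1 hx).1
      exact (ContinuousAt.comp (g := h) (hc _ ((straight_mem_wedge hT hx1).2 hx))
        (continuousAt_straight (by linarith [hx1.2]))).continuousWithinAt
  rw [← lintegral_indicator (measurableSet_wedge _ _ _), ← lintegral_indicator hbox]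
  unfold dv at *
  rw [lintegral_prod _ ((aemeasurable_indicator_iff (measurableSet_wedge _ _ _)).2 hm1),
    lintegral_prod _ ((aemeasurable_indicator_iff hbox).2 hm2)]
  refine lintegral_congr fun τ => ?_
  by_cases hτ : τ ∈ Set.Icc (-1) T
  · have hj : 0 < 2 * (1 - τ)⁻¹ := by
      have : 0 < (1 - τ)⁻¹ := inv_pos.2 (by linarith [hτ.2])
      positivity
    rw [lintegral_scale hj]
    refine lintegral_congr fun y => ?_
    have hs : straight (τ, y) = (τ, 2 * (1 - τ)⁻¹ * y.1, y.2) := by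
      simp only [straight, Prod.mk.injEq, true_and, and_true]; ring
    rw [← hs]
    by_cases hy : (τ, y) ∈ box (-1) T c d
    · rw [Set.indicator_of_mem hy, Set.indicator_of_mem ((straight_mem_wedge hT hτ).2 hy)]
    · rw [Set.indicator_of_notMem hy,
        Set.indicator_of_notMem (fun h' => hy ((straight_mem_wedge hT hτ).1 h')), mul_zero]
  · refine lintegral_congr fun y => ?_
    rw [Set.indicator_of_notMem, Set.indicator_of_notMem]
    · exact fun h' => hτ (mem_box.1 h').1
    · exact fun h' => hτ ⟨h'.1, h'.2.1⟩

/-! ### The energy estimate on wedges and its limit on the whole domain -/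

theorem ofReal_norm_sq (z : ℂ) : ENNReal.ofReal (‖z‖ ^ 2) = ‖z‖ₑ ^ 2 := by
  rw [ENNReal.ofReal_pow (norm_nonneg _), ofReal_norm]

/-- The interior of the lower domain. -/
def lowerInterior (ρs ε : ℝ) : Set Pt :=
  {x | -1 < x.1 ∧ x.1 < -1 + ε ∧ 0 < x.2.1 ∧ x.2.1 < 2 * ρs / (1 - x.1)}

/-- Identifies the boundary weight 4ρ⋆/(1-τ)² of the energy flux with the induced measure on the
null hypersurface. -/
theorem nullDensity_eq (ρs : ℝ) {τ : ℝ} (hτ : τ < 1) :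
    4 * ρs * (1 - τ)⁻¹ ^ 2 = Real.sqrt 2 * nullDensity ρs τ := by
  have hne : 1 - τ ≠ 0 := by linarith
  have h2 : Real.sqrt 2 ≠ 0 := by positivity
  unfold nullDensity
  field_simp
  ring

/-- The energy estimate on a wedge. -/
theorem energy_wedge {ι : Type*} (I : Finset ι) {M : ℝ} (hM : 0 ≤ M) {ρs ε δ : ℝ}
    (hε : 0 < ε) (hε1 : ε < 1) (hδ : 0 < δ) (hδρ : δ ≤ ρs) {u w r e : ι → Pt → ℂ} {k l : ι → ℝ}
    (hk : ∀ i ∈ I, 1 ≤ k i) (hl : ∀ i ∈ I, l i ≤ M)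
    (hu : ∀ i ∈ I, ∀ x ∈ lowerDomain ρs ε, 0 < x.2.1 → IsCkAt 1 (u i) x)
    (hw : ∀ i ∈ I, ∀ x ∈ lowerDomain ρs ε, 0 < x.2.1 → IsCkAt 1 (w i) x)
    (h1 : ∀ i ∈ I, ∀ x ∈ lowerInterior ρs ε,
      nullDer (-1) (w i) x = l i * w i x + XPlus (u i) x + r i x)
    (h2 : ∀ i ∈ I, ∀ x ∈ lowerInterior ρs ε,
      nullDer 1 (u i) x = -k i * u i x + XMinus (w i) x + e i x)
    (hr : ∀ i ∈ I, ∀ x ∈ lowerInterior ρs ε, ‖r i x‖ ≤ M * ∑ j ∈ I, ‖u j x‖)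
    (he : ∀ i ∈ I, ∀ x ∈ lowerInterior ρs ε, ‖e i x‖ ≤ M * ∑ j ∈ I, ‖w j x‖) :
    ∫⁻ x in wedge (-1 + ε) δ ρs, ∑ i ∈ I, (‖u i x‖ₑ ^ 2 + ‖w i x‖ₑ ^ 2) ∂dv ≤
      ENNReal.ofReal (2 * Real.exp (growthRate M I.card)) * ∑ i ∈ I,
      ((∫⁻ y in Set.Icc 0 ρs ×ˢ (Set.univ : Set SU2), ‖w i (-1, y.1, y.2)‖ₑ ^ 2
        ∂((volume : Measure ℝ).prod haarSU2)) +
      ∫⁻ y in Set.Icc (-1) (-1 + ε) ×ˢ (Set.univ : Set SU2),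
        ‖u i (y.1, 2 * ρs / (1 - y.1), y.2)‖ₑ ^ 2 * ENNReal.ofReal (nullDensity ρs y.1)
        ∂((volume : Measure ℝ).prod haarSU2)) := by
  have hT : (-1 : ℝ) ≤ -1 + ε := by linarith
  have hT0 : -1 + ε ≤ 0 := by linarith
  have hρ : 0 < ρs := hδ.trans_le hδρ
  have hwd : ∀ x ∈ wedge (-1 + ε) δ ρs, x ∈ lowerDomain ρs ε ∧ 0 < x.2.1 := by
    rintro x ⟨a1, a2, a3, a4⟩
    have hj : 0 < (1 - x.1)⁻¹ := inv_pos.2 (by linarith)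
    have h0 : 0 < x.2.1 := lt_of_lt_of_le (by positivity) a3
    exact ⟨⟨a1, a2, h0.le, by rwa [div_eq_mul_inv]⟩, h0⟩
  have hbd : ∀ x ∈ box (-1) (-1 + ε) δ ρs, x.1 < 1 ∧ straight x ∈ wedge (-1 + ε) δ ρs :=
    fun x hx => ⟨by linarith [(mem_box.1 hx).1.2],
      (straight_mem_wedge hT0 (mem_box.1 hx).1).2 hx⟩
  have hint : ∀ x : Pt, x.1 ∈ Set.Ioo (-1) (-1 + ε) → x.2.1 ∈ Set.Ioo δ ρs →
      x.1 < 1 ∧ straight x ∈ lowerInterior ρs ε ∧ straight x ∈ lowerDomain ρs ε := by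
    intro x hx1 hx2
    have hlt : x.1 < 1 := by linarith [hx1.2]
    have hj : 0 < (1 - x.1)⁻¹ := inv_pos.2 (by linarith)
    have h0 : 0 < x.2.1 := hδ.trans hx2.1
    have hup : (straight x).2.1 < 2 * ρs / (1 - x.1) := by
      rw [div_eq_mul_inv]
      exact mul_lt_mul_of_pos_right (by linarith [hx2.2]) hj
    have hpos : 0 < (straight x).2.1 := by simp only [straight]; positivity
    exact ⟨hlt, ⟨hx1.1, hx1.2, hpos, hup⟩, ⟨hx1.1.le, hx1.2.le, hpos.le, hup.le⟩⟩
  have hu' : ∀ i ∈ I, ∀ x ∈ box (-1) (-1 + ε) δ ρs, IsCkAt 1 (fun y => u i (straight y)) x :=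
    fun i hi x hx => IsCkAt.comp_straight (hbd x hx).1
      (hu i hi _ (hwd _ (hbd x hx).2).1 (hwd _ (hbd x hx).2).2)
  have hw' : ∀ i ∈ I, ∀ x ∈ box (-1) (-1 + ε) δ ρs, IsCkAt 1 (fun y => w i (straight y)) x :=
    fun i hi x hx => IsCkAt.comp_straight (hbd x hx).1
      (hw i hi _ (hwd _ (hbd x hx).2).1 (hwd _ (hbd x hx).2).2)
  have key := energy_box I hM hT hT0 hδ.le hδρ (u := fun i y => u i (straight y))
    (w := fun i y => w i (straight y)) (r := fun i y => r i (straight y))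
    (e := fun i y => e i (straight y)) hk hl hu' hw'
    (fun i hi x hx1 hx2 => by
      obtain ⟨a1, a2, a3⟩ := hint x hx1 hx2
      rw [nullDer_neg_comp_straight a1 (hw i hi _ a3 a2.2.2.1)]
      exact h1 i hi _ a2)
    (fun i hi x hx1 hx2 => by
      obtain ⟨a1, a2, a3⟩ := hint x hx1 hx2
      rw [nullDer_one_comp_straight a1 (hu i hi _ a3 a2.2.2.1)]
      exact h2 i hi _ a2)
    (fun i hi x hx1 hx2 => hr i hi _ (hint x hx1 hx2).2.1)
    (fun i hi x hx1 hx2 => he i hi _ (hint x hx1 hx2).2.1)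
  have hcw : ∀ i ∈ I, ∀ x ∈ box (-1) (-1 + ε) δ ρs,
      ContinuousAt (fun y => ‖w i (straight y)‖ ^ 2) x := fun i hi x hx =>
    (hw' i hi x hx).continuousAt.norm.pow 2
  have hcu : ∀ i ∈ I, ∀ x ∈ box (-1) (-1 + ε) δ ρs,
      ContinuousAt (fun y => ‖u i (straight y)‖ ^ 2) x := fun i hi x hx =>
    (hu' i hi x hx).continuousAt.norm.pow 2
  have hcj : ∀ x ∈ box (-1) (-1 + ε) δ ρs, ContinuousAt (fun y : Pt => (1 - y.1)⁻¹) x :=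
    fun x hx => (continuousAt_const.sub continuousAt_fst).inv₀
      (by change 1 - x.1 ≠ 0; linarith [(hbd x hx).1])
  have hlhs : ∫⁻ x in wedge (-1 + ε) δ ρs, ∑ i ∈ I, (‖u i x‖ₑ ^ 2 + ‖w i x‖ₑ ^ 2) ∂dv =
      ENNReal.ofReal (∫ x in box (-1) (-1 + ε) δ ρs, 2 * (1 - x.1)⁻¹ *
        ∑ i ∈ I, (‖u i (straight x)‖ ^ 2 + ‖w i (straight x)‖ ^ 2) ∂dv) := by
    rw [lintegral_wedge hT0 fun x hx => ?_, ofReal_integral_eq_lintegral_ofReal]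
    · refine setLIntegral_congr_fun (isCompact_box _ _ _ _).measurableSet fun x hx => ?_
      have hj : 0 ≤ 2 * (1 - x.1)⁻¹ := by
        have : 0 < (1 - x.1)⁻¹ := inv_pos.2 (by linarith [(hbd x hx).1])
        positivity
      rw [ENNReal.ofReal_mul hj, ENNReal.ofReal_sum_of_nonneg fun i _ => by positivity]
      congr 1
      refine Finset.sum_congr rfl fun i _ => ?_
      rw [ENNReal.ofReal_add (by positivity) (by positivity), ofReal_norm_sq, ofReal_norm_sq]
    · exact integrableOn_box fun x hx => (continuousAt_const.mul (hcj x hx)).mul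
        (tendsto_finsetSum _ fun i hi => (hcu i hi x hx).add (hcw i hi x hx))
    · filter_upwards [ae_restrict_mem (isCompact_box _ _ _ _).measurableSet] with x hx
      have : 0 < (1 - x.1)⁻¹ := inv_pos.2 (by linarith [(hbd x hx).1])
      exact mul_nonneg (by positivity) (Finset.sum_nonneg fun i _ => by positivity)
    · obtain ⟨a1, a2⟩ := hwd x hx
      refine tendsto_finsetSum _ fun i hi => ?_
      exact (((ENNReal.continuous_pow 2).continuousAt.comp (hu i hi x a1 a2).continuousAt.enorm)).add
        (((ENNReal.continuous_pow 2).continuousAt.comp (hw i hi x a1 a2).continuousAt.enorm))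
  rw [hlhs]
  refine (ENNReal.ofReal_le_ofReal key).trans ?_
  -- The extra factor 2 serves both data terms: the weight is 2 on past null infinity and √2 ≤ 2
  -- relative to the induced measure on the null hypersurface.
  rw [ENNReal.ofReal_mul (Real.exp_pos _).le, mul_comm 2, ENNReal.ofReal_mul (Real.exp_pos _).le,
    mul_assoc]
  refine mul_le_mul_right ?_ _
  rw [Finset.mul_sum]
  rw [ENNReal.ofReal_sum_of_nonneg fun i _ => add_nonneg
    (integral_nonneg fun y => by positivity)
    (integral_nonneg fun y => by positivity)]
  refine Finset.sum_le_sum fun i hi => ?_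
  rw [ENNReal.ofReal_add (integral_nonneg fun y => by positivity)
    (integral_nonneg fun y => by positivity), mul_add]
  refine add_le_add ?_ ?_
  · rw [ofReal_integral_eq_lintegral_ofReal
      (integrableOn_slice (continuousOn_slice_tau (f := fun y => 2 * ‖w i (straight y)‖ ^ 2)
        fun y hy => continuousAt_const.mul (hcw i hi _ (mem_box.2 ⟨⟨le_rfl, hT⟩, hy.1⟩))))
      (Filter.Eventually.of_forall fun y => by positivity)]
    rw [← lintegral_const_mul' _ _ ENNReal.ofReal_ne_top]
    refine (lintegral_mono_set (Set.prod_mono_left (Set.Icc_subset_Icc_left hδ.le))).trans ?_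
    refine lintegral_mono fun y => ?_
    rw [ENNReal.ofReal_mul zero_le_two, ofReal_norm_sq]
    -- At τ = -1 the dilation factor 2/(1-τ) is 1.
    have hs : straight (-1, y.1, y.2) = (-1, y.1, y.2) := by
      simp only [straight, Prod.mk.injEq, true_and, and_true]; ring
    rw [hs]
  · rw [ofReal_integral_eq_lintegral_ofReal
      (integrableOn_slice (continuousOn_slice_rho
        (f := fun y => 4 * ρs * (1 - y.1)⁻¹ ^ 2 * ‖u i (straight y)‖ ^ 2) fun y hy => by
          have hb : ((y.1, ρs, y.2) : Pt) ∈ box (-1) (-1 + ε) δ ρs :=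
            mem_box.2 ⟨hy.1, hδρ, le_rfl⟩
          exact (continuousAt_const.mul ((hcj _ hb).pow 2)).mul (hcu i hi _ hb)))
      (Filter.Eventually.of_forall fun y => by positivity)]
    rw [← lintegral_const_mul' _ _ ENNReal.ofReal_ne_top]
    refine setLIntegral_mono' (measurableSet_Icc.prod MeasurableSet.univ) fun y hy => ?_
    have hy1 : y.1 < 1 := by linarith [hy.1.2]
    have hs : straight (y.1, ρs, y.2) = (y.1, 2 * ρs / (1 - y.1), y.2) := by
      simp only [straight, div_eq_mul_inv]
    rw [hs, ENNReal.ofReal_mul (by positivity), ofReal_norm_sq, mul_comm (‖_‖ₑ ^ 2), ← mul_assoc,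
      ← ENNReal.ofReal_mul zero_le_two]
    refine mul_le_mul_left (ENNReal.ofReal_le_ofReal ?_) _
    have hd : 0 ≤ nullDensity ρs y.1 := by
      have a1 : 0 ≤ 1 + y.1 := by linarith [hy.1.1]
      have a2 : 0 < 1 - y.1 := by linarith
      unfold nullDensity
      positivity
    rw [nullDensity_eq ρs hy1]
    refine mul_le_mul_of_nonneg_right ?_ hd
    rw [Real.sqrt_le_left zero_le_two]
    norm_num

theorem ae_rho_ne_zero : ∀ᵐ x ∂dv, x.2.1 ≠ 0 := by
  have h : {x : Pt | ¬ x.2.1 ≠ 0} = Set.univ ×ˢ ({0} : Set ℝ) ×ˢ Set.univ := by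
    ext x; simp
  rw [ae_iff, h, dv, Measure.prod_prod, Measure.prod_prod]
  simp

/-- The energy estimate on the lower domain, up to the cylinder `ρ = 0`. -/
theorem energy_lowerDomain {ι : Type*} (I : Finset ι) {M : ℝ} (hM : 0 ≤ M) {ρs ε : ℝ}
    (hρ : 0 < ρs) (hε : 0 < ε) (hε1 : ε < 1) {u w r e : ι → Pt → ℂ} {k l : ι → ℝ}
    (hk : ∀ i ∈ I, 1 ≤ k i) (hl : ∀ i ∈ I, l i ≤ M)
    (hu : ∀ i ∈ I, ∀ x ∈ lowerDomain ρs ε, 0 < x.2.1 → IsCkAt 1 (u i) x)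
    (hw : ∀ i ∈ I, ∀ x ∈ lowerDomain ρs ε, 0 < x.2.1 → IsCkAt 1 (w i) x)
    (h1 : ∀ i ∈ I, ∀ x ∈ lowerInterior ρs ε,
      nullDer (-1) (w i) x = l i * w i x + XPlus (u i) x + r i x)
    (h2 : ∀ i ∈ I, ∀ x ∈ lowerInterior ρs ε,
      nullDer 1 (u i) x = -k i * u i x + XMinus (w i) x + e i x)
    (hr : ∀ i ∈ I, ∀ x ∈ lowerInterior ρs ε, ‖r i x‖ ≤ M * ∑ j ∈ I, ‖u j x‖)
    (he : ∀ i ∈ I, ∀ x ∈ lowerInterior ρs ε, ‖e i x‖ ≤ M * ∑ j ∈ I, ‖w j x‖) :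
    ∫⁻ x in lowerDomain ρs ε, ∑ i ∈ I, (‖u i x‖ₑ ^ 2 + ‖w i x‖ₑ ^ 2) ∂dv ≤
      ENNReal.ofReal (2 * Real.exp (growthRate M I.card)) * ∑ i ∈ I,
      ((∫⁻ y in Set.Icc 0 ρs ×ˢ (Set.univ : Set SU2), ‖w i (-1, y.1, y.2)‖ₑ ^ 2
        ∂((volume : Measure ℝ).prod haarSU2)) +
      ∫⁻ y in Set.Icc (-1) (-1 + ε) ×ˢ (Set.univ : Set SU2),
        ‖u i (y.1, 2 * ρs / (1 - y.1), y.2)‖ₑ ^ 2 * ENNReal.ofReal (nullDensity ρs y.1)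
        ∂((volume : Measure ℝ).prod haarSU2)) := by
  set δ : ℕ → ℝ := fun n => ρs / (n + 1) with hδ
  have hδ0 : ∀ n, 0 < δ n := fun n => by simp only [hδ]; positivity
  have hδ1 : ∀ n, δ n ≤ ρs := fun n => div_le_self hρ.le (by simp)
  have hδanti : Antitone δ := fun n m hnm => by
    simp only [hδ]
    have : (n : ℝ) ≤ m := by exact_mod_cast hnm
    gcongr
  have hmono : Monotone fun n => wedge (-1 + ε) (δ n) ρs := by
    rintro n m hnm x ⟨a1, a2, a3, a4⟩
    have hj : 0 < (1 - x.1)⁻¹ := inv_pos.2 (by linarith)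
    refine ⟨a1, a2, le_trans ?_ a3, a4⟩
    have := hδanti hnm
    gcongr
  -- Every point of the domain with ρ > 0 lies in a wedge with small enough inner side, and the
  -- cylinder ρ = 0 is a null set.
  have hsub : (lowerDomain ρs ε : Set Pt) ≤ᵐ[dv] ⋃ n, wedge (-1 + ε) (δ n) ρs := by
    filter_upwards [ae_rho_ne_zero] with x hx0 hx
    obtain ⟨a1, a2, a3, a4⟩ := hx
    have hx2 : 0 < x.2.1 := lt_of_le_of_ne a3 (Ne.symm hx0)
    have hj : 0 < (1 - x.1)⁻¹ := inv_pos.2 (by linarith)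
    have hlim : Filter.Tendsto (fun n => 2 * δ n * (1 - x.1)⁻¹) Filter.atTop (𝓝 0) := by
      have h0 : Filter.Tendsto δ Filter.atTop (𝓝 0) := by
        have := (tendsto_one_div_add_atTop_nhds_zero_nat (𝕜 := ℝ)).const_mul ρs
        simpa [hδ, div_eq_mul_inv] using this
      simpa using (h0.const_mul 2).mul_const (1 - x.1)⁻¹
    obtain ⟨n, hn⟩ := (hlim.eventually_lt_const hx2).exists
    exact Set.mem_iUnion.2 ⟨n, a1, a2, hn.le, by rwa [← div_eq_mul_inv]⟩
  refine (lintegral_mono' (Measure.restrict_mono_ae hsub) le_rfl).trans ?_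
  rw [setLIntegral_iUnion_of_directed _ hmono.directed_le]
  -- The bound on a wedge is uniform in δ, so it passes to the supremum by monotone convergence;
  -- finiteness of the norm is thereby proved, not assumed.
  exact iSup_le fun n => energy_wedge I hM hε hε1 (hδ0 n) (hδ1 n) hk hl hu hw h1 h2 hr he

/-! ### The estimate for the transport system -/

theorem mem_multiIndices {m : ℕ} {i : ℕ × ℕ × (ℕ × ℕ × ℕ)} :
    i ∈ multiIndices m ↔ i.1 + i.2.1 + deg i.2.2 ≤ m := by
  obtain ⟨a, b, c, d, e⟩ := i
  unfold multiIndices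
  rw [Finset.mem_filter]
  simp only [Finset.mem_product, Finset.mem_range, deg]
  omega

/-- The derivative `∂_ρ^{p'+p} ∂_τ^{q'+q} Z^α` for `i = (p', q', α)`. -/
def DD (p q : ℕ) (i : ℕ × ℕ × (ℕ × ℕ × ℕ)) (f : Pt → ℂ) : Pt → ℂ :=
  D (i.1 + p) (i.2.1 + q) i.2.2 f

theorem IsCkAt.DD {m p q : ℕ} {i : ℕ × ℕ × (ℕ × ℕ × ℕ)} (hi : i ∈ multiIndices m) {f : Pt → ℂ}
    {x : Pt} (hf : IsCkAt (m + p + q + 1) f x) : IsCkAt 1 (DD p q i f) x :=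
  IsCkAt.D (hf.of_le (by have := mem_multiIndices.1 hi; omega))

theorem D_add_mul {P N : ℕ} {α : ℕ × ℕ × ℕ} {f g : Pt → ℂ} {x : Pt} (s t : ℂ)
    (hf : IsCkAt (P + N + deg α) f x) (hg : IsCkAt (P + N + deg α) g x) :
    D P N α (fun y => s * f y + t * g y) =ᶠ[𝓝 x] fun y => s * D P N α f y + t * D P N α g y := by
  have e := D_lincomb (s := Finset.univ) (f := ![f, g]) (x := x) ![s, t] P N α
    (fun i _ => by fin_cases i; exacts [hf, hg])
  simpa only [Fin.sum_univ_two, Matrix.cons_val_zero, Matrix.cons_val_one] using e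

theorem DD_add_mul {m p q : ℕ} {i : ℕ × ℕ × (ℕ × ℕ × ℕ)} (hi : i ∈ multiIndices m)
    {f g : Pt → ℂ} {x : Pt} (s t : ℂ) (hf : IsCkAt (m + p + q + 1) f x)
    (hg : IsCkAt (m + p + q + 1) g x) :
    DD p q i (fun y => s * f y + t * g y) x = s * DD p q i f x + t * DD p q i g x := by
  have := mem_multiIndices.1 hi
  exact (D_add_mul s t (hf.of_le (by omega)) (hg.of_le (by omega))).self_of_nhds

theorem isOpen_lowerInterior (ρs ε : ℝ) (hε : ε < 1) : IsOpen (lowerInterior ρs ε) := by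
  have h : lowerInterior ρs ε = {x | -1 < x.1} ∩ ({x | x.1 < -1 + ε} ∩ ({x | 0 < x.2.1} ∩
      {x | x.2.1 * (1 - x.1) < 2 * ρs})) := by
    ext x
    simp only [lowerInterior, Set.mem_inter_iff, Set.mem_ofPred_eq]
    refine and_congr_right fun _ => and_congr_right fun h => and_congr_right fun _ => ?_
    rw [lt_div_iff₀ (by linarith)]
  rw [h]
  refine (isOpen_lt (by fun_prop) (by fun_prop)).inter ((isOpen_lt (by fun_prop) (by fun_prop)).inter
    ((isOpen_lt (by fun_prop) (by fun_prop)).inter (isOpen_lt (by fun_prop) (by fun_prop))))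

theorem lowerInterior_subset {ρs ε : ℝ} {x : Pt} (hx : x ∈ lowerInterior ρs ε) :
    x ∈ lowerDomain ρs ε ∧ 0 < x.2.1 :=
  ⟨⟨hx.1.le, hx.2.1.le, hx.2.2.1.le, hx.2.2.2.le⟩, hx.2.2.1⟩

/-- Superadditivity of the lower integral, which requires no measurability of the summands. -/
theorem finsetSum_lintegral_le {X ι : Type*} [MeasurableSpace X] {μ : Measure X} (I : Finset ι)
    (f : ι → X → ℝ≥0∞) : ∑ i ∈ I, ∫⁻ x, f i x ∂μ ≤ ∫⁻ x, ∑ i ∈ I, f i x ∂μ := by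
  classical
  induction I using Finset.induction_on with
  | empty => simp
  | insert a s ha ih =>
    simp only [Finset.sum_insert ha]
    exact (add_le_add le_rfl ih).trans (le_lintegral_add _ _)

/-- The squared `L²` norm of the derivative with index `i` over the lower domain. -/
def lowerSq (p q : ℕ) (ρs ε : ℝ) (i : ℕ × ℕ × (ℕ × ℕ × ℕ)) (f : Pt → ℂ) : ℝ≥0∞ :=
  ∫⁻ x in lowerDomain ρs ε, ‖DD p q i f x‖ₑ ^ 2 ∂dv

/-- The squared `L²` norm of the derivative with index `i` over past null infinity. -/
def scriSq (p q : ℕ) (ρs : ℝ) (i : ℕ × ℕ × (ℕ × ℕ × ℕ)) (f : Pt → ℂ) : ℝ≥0∞ :=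
  ∫⁻ y in Set.Icc 0 ρs ×ˢ (Set.univ : Set SU2), ‖DD p q i f (-1, y.1, y.2)‖ₑ ^ 2
    ∂((volume : Measure ℝ).prod haarSU2)

/-- The squared `L²` norm of the derivative with index `i` over the incoming null hypersurface. -/
def nullSq (p q : ℕ) (ρs ε : ℝ) (i : ℕ × ℕ × (ℕ × ℕ × ℕ)) (f : Pt → ℂ) : ℝ≥0∞ :=
  ∫⁻ y in Set.Icc (-1) (-1 + ε) ×ˢ (Set.univ : Set SU2),
    ‖DD p q i f (y.1, 2 * ρs / (1 - y.1), y.2)‖ₑ ^ 2 * ENNReal.ofReal (nullDensity ρs y.1)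
    ∂((volume : Measure ℝ).prod haarSU2)

/-- Commuting `∂_ρ^P ∂_τ^N Z^α` through a transport equation with an angular source term. -/
theorem commuted_equation {P N : ℕ} {α : ℕ × ℕ × ℕ} {c : ℕ × ℕ × ℕ → ℂ}
    {X : (Pt → ℂ) → Pt → ℂ} {f g : Pt → ℂ} {x : Pt} {s κ : ℂ}
    (hX : D P N α (X f) =ᶠ[𝓝 x]
      fun y => X (D P N α f) y + ∑ β ∈ angIdx (deg α), c β * D P N β f y)
    (hXf : IsCkAt (P + N + deg α) (X f) x) (hg : IsCkAt (P + N + deg α + 1) g x)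
    (heq : ∀ᶠ y in 𝓝 x, nullDer s g y = X f y + κ * g y) :
    nullDer s (D P N α g) x = (κ - ((N : ℂ) - P) * s) * D P N α g x + X (D P N α f) x +
      ∑ β ∈ angIdx (deg α), c β * D P N β f x := by
  have e0 : nullDer s g =ᶠ[𝓝 x] fun y => 1 * X f y + κ * g y := by
    filter_upwards [heq] with y hy
    rw [hy, one_mul]
  have e1 : D P N α (nullDer s g) x = D P N α (fun y => 1 * X f y + κ * g y) x :=
    (D_congr e0 P N α).self_of_nhds
  have e2 : D P N α (nullDer s g) x =
      nullDer s (D P N α g) x + ((N : ℂ) - P) * s * D P N α g x :=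
    (D_nullDer s P N α hg).self_of_nhds
  have e3 : D P N α (fun y => 1 * X f y + κ * g y) x =
      1 * D P N α (X f) x + κ * D P N α g x :=
    (D_add_mul 1 κ hXf (hg.of_le (by omega))).self_of_nhds
  have e4 : D P N α (X f) x = X (D P N α f) x + ∑ β ∈ angIdx (deg α), c β * D P N β f x :=
    hX.self_of_nhds
  linear_combination e1 - e2 + e3 + e4

/-- A coupling term of order at most `|α|` is bounded by the derivatives occurring in the norm. -/
theorem norm_coupling_le {m p q : ℕ} {i : ℕ × ℕ × (ℕ × ℕ × ℕ)} (hi : i ∈ multiIndices m)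
    (b : ℕ × ℕ × ℕ → ℂ) {B : ℝ} (hb : ∑ β ∈ angIdx (deg i.2.2), ‖b β‖ ≤ B) (h : Pt → ℂ) (x : Pt) :
    ‖∑ β ∈ angIdx (deg i.2.2), b β * D (i.1 + p) (i.2.1 + q) β h x‖ ≤
      B * ∑ j ∈ multiIndices m, ‖DD p q j h x‖ := by
  have hi' := mem_multiIndices.1 hi
  refine (norm_sum_le _ _).trans ?_
  have h1 : ∀ β ∈ angIdx (deg i.2.2), ‖b β * D (i.1 + p) (i.2.1 + q) β h x‖ ≤
      ‖b β‖ * ∑ j ∈ multiIndices m, ‖DD p q j h x‖ := by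
    intro β hβ
    rw [norm_mul]
    refine mul_le_mul_of_nonneg_left ?_ (norm_nonneg _)
    have hβ' := mem_angIdx.1 hβ
    have hmem : ((i.1, i.2.1, β) : ℕ × ℕ × (ℕ × ℕ × ℕ)) ∈ multiIndices m :=
      mem_multiIndices.2 (show i.1 + i.2.1 + deg β ≤ m by omega)
    exact Finset.single_le_sum (f := fun j => ‖DD p q j h x‖) (fun _ _ => norm_nonneg _) hmem
  refine (Finset.sum_le_sum h1).trans ?_
  rw [← Finset.sum_mul]
  exact mul_le_mul_of_nonneg_right hb (Finset.sum_nonneg fun _ _ => norm_nonneg _)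

/-- The energy estimate for a pair `(f, g)` coupled by `X_±`. -/
theorem pair_estimate {m p q : ℕ} (hq : m + p < q) {κ κ' : ℝ} (hκ : 0 ≤ κ) (hκ' : κ' ≤ 1) :
    ∃ C : ℝ, 0 < C ∧ ∀ (ρs ε : ℝ), 0 < ρs → 0 < ε → ε < 1 → ∀ f g : Pt → ℂ,
      (∀ x ∈ lowerDomain ρs ε, 0 < x.2.1 → IsCkAt (m + p + q + 1) f x) →
      (∀ x ∈ lowerDomain ρs ε, 0 < x.2.1 → IsCkAt (m + p + q + 1) g x) →
      (∀ x ∈ lowerInterior ρs ε, nullDer 1 f x = XMinus g x - κ * f x) →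
      (∀ x ∈ lowerInterior ρs ε, nullDer (-1) g x = XPlus f x + κ' * g x) →
      ∑ i ∈ multiIndices m, (lowerSq p q ρs ε i f + lowerSq p q ρs ε i g) ≤
        ENNReal.ofReal C * ∑ i ∈ multiIndices m, (scriSq p q ρs i g + nullSq p q ρs ε i f) := by
  choose cp hcp using exists_D_XPlus
  choose cm hcm using exists_D_XMinus
  -- The sum dominates every commutator coefficient that can occur, and m + q + 1 dominates the
  -- growth rates N - P + κ'. Thus M is fixed before the domain and the functions.
  set M : ℝ := (∑ i ∈ multiIndices m, ∑ β ∈ angIdx (deg i.2.2),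
    (‖cp i.2.2 β‖ + ‖cm i.2.2 β‖)) + (m + q + 1) with hMdef
  have hS0 : 0 ≤ ∑ i ∈ multiIndices m, ∑ β ∈ angIdx (deg i.2.2),
    (‖cp i.2.2 β‖ + ‖cm i.2.2 β‖) :=
    Finset.sum_nonneg fun _ _ => Finset.sum_nonneg fun _ _ => by positivity
  have hM : 0 ≤ M := add_nonneg hS0 (by positivity)
  refine ⟨2 * Real.exp (growthRate M (multiIndices m).card), mul_pos two_pos (Real.exp_pos _), ?_⟩
  intro ρs ε hρ hε hε1 f g hf hg hfeq hgeq
  have hB : ∀ i ∈ multiIndices m, ∑ β ∈ angIdx (deg i.2.2), (‖cp i.2.2 β‖ + ‖cm i.2.2 β‖) ≤ M := by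
    intro i hi
    have h2 := Finset.single_le_sum (f := fun i : ℕ × ℕ × (ℕ × ℕ × ℕ) =>
      ∑ β ∈ angIdx (deg i.2.2), (‖cp i.2.2 β‖ + ‖cm i.2.2 β‖))
      (fun _ _ => Finset.sum_nonneg fun _ _ => by positivity) hi
    have h3 : (0 : ℝ) ≤ m + q + 1 := by positivity
    rw [hMdef]
    exact h2.trans (le_add_of_nonneg_right h3)
  have main := energy_lowerDomain (multiIndices m) hM hρ hε hε1
    (u := fun i => DD p q i f) (w := fun i => DD p q i g)
    (r := fun i x => ∑ β ∈ angIdx (deg i.2.2), cp i.2.2 β * D (i.1 + p) (i.2.1 + q) β f x)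
    (e := fun i x => ∑ β ∈ angIdx (deg i.2.2), cm i.2.2 β * D (i.1 + p) (i.2.1 + q) β g x)
    (k := fun i => ((i.2.1 + q : ℕ) : ℝ) - ((i.1 + p : ℕ) : ℝ) + κ)
    (l := fun i => ((i.2.1 + q : ℕ) : ℝ) - ((i.1 + p : ℕ) : ℝ) + κ')
    (fun i hi => by
      have h1 := mem_multiIndices.1 hi
      -- Here m + p < q enters: it makes the damping rate of every differentiated u at least 1.
      have h2 : ((i.1 + p : ℕ) : ℝ) + 1 ≤ ((i.2.1 + q : ℕ) : ℝ) := by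
        exact_mod_cast (by omega : i.1 + p + 1 ≤ i.2.1 + q)
      linarith)
    (fun i hi => by
      have h1 := mem_multiIndices.1 hi
      have h2 : ((i.2.1 + q : ℕ) : ℝ) ≤ m + q := by
        exact_mod_cast (by omega : i.2.1 + q ≤ m + q)
      have h3 : (0 : ℝ) ≤ ((i.1 + p : ℕ) : ℝ) := Nat.cast_nonneg _
      linarith)
    (fun i hi x hx hx0 => IsCkAt.DD hi (hf x hx hx0))
    (fun i hi x hx hx0 => IsCkAt.DD hi (hg x hx hx0))
    (fun i hi x hx => by
      have hi' := mem_multiIndices.1 hi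
      obtain ⟨hx1, hx2⟩ := lowerInterior_subset hx
      have hle : i.1 + p + (i.2.1 + q) + deg i.2.2 + 1 ≤ m + p + q + 1 := by omega
      have hfx := (hf x hx1 hx2).of_le hle
      refine (commuted_equation (hcp i.2.2 (i.1 + p) (i.2.1 + q) f x hfx) (IsCkAt.XPlus hfx)
        ((hg x hx1 hx2).of_le hle) (κ := (κ' : ℂ)) (s := -1) ?_).trans ?_
      -- Differentiating the equation requires it as an identity of germs, which is why the open
      -- interior is used.
      · filter_upwards [(isOpen_lowerInterior ρs ε hε1).mem_nhds hx] with y hy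
        exact hgeq y hy
      · simp only [DD]
        push_cast
        ring)
    (fun i hi x hx => by
      have hi' := mem_multiIndices.1 hi
      obtain ⟨hx1, hx2⟩ := lowerInterior_subset hx
      have hle : i.1 + p + (i.2.1 + q) + deg i.2.2 + 1 ≤ m + p + q + 1 := by omega
      have hgx := (hg x hx1 hx2).of_le hle
      refine (commuted_equation (hcm i.2.2 (i.1 + p) (i.2.1 + q) g x hgx) (IsCkAt.XMinus hgx)
        ((hf x hx1 hx2).of_le hle) (κ := -(κ : ℂ)) (s := 1) ?_).trans ?_
      · filter_upwards [(isOpen_lowerInterior ρs ε hε1).mem_nhds hx] with y hy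
        rw [hfeq y hy]; ring
      · simp only [DD]
        push_cast
        ring)
    (fun i hi x _ => norm_coupling_le hi (cp i.2.2) ((Finset.sum_le_sum fun β _ =>
      le_add_of_nonneg_right (norm_nonneg _)).trans (hB i hi)) f x)
    (fun i hi x _ => norm_coupling_le hi (cm i.2.2) ((Finset.sum_le_sum fun β _ =>
      le_add_of_nonneg_left (norm_nonneg _)).trans (hB i hi)) g x)
  refine le_trans ?_ main
  refine le_trans ?_ (finsetSum_lintegral_le _ _)
  exact Finset.sum_le_sum fun i _ => le_lintegral_add _ _

/-! ### Points of the domain and its boundary where the functions are regular -/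

theorem measurableSet_lowerDomain (ρs ε : ℝ) : MeasurableSet (lowerDomain ρs ε) := by
  have h : Measurable fun x : Pt => 2 * ρs / (1 - x.1) := by fun_prop
  have h1 : Measurable fun x : Pt => x.1 := by fun_prop
  have h2 : Measurable fun x : Pt => x.2.1 := by fun_prop
  exact (measurableSet_le measurable_const h1).inter ((measurableSet_le h1 measurable_const).inter
    ((measurableSet_le measurable_const h2).inter (measurableSet_le h2 h)))

theorem ae_lowerDomain (ρs ε : ℝ) :
    ∀ᵐ x ∂(dv.restrict (lowerDomain ρs ε)), x ∈ lowerDomain ρs ε ∧ 0 < x.2.1 := by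
  filter_upwards [ae_restrict_mem (measurableSet_lowerDomain ρs ε),
    ae_restrict_of_ae ae_rho_ne_zero] with x hx hx0
  exact ⟨hx, lt_of_le_of_ne hx.2.2.1 (Ne.symm hx0)⟩

theorem Icc_prod_ae_eq_Ioc (a b : ℝ) : (Set.Ioc a b ×ˢ (Set.univ : Set SU2) : Set (ℝ × SU2))
    =ᵐ[(volume : Measure ℝ).prod haarSU2] Set.Icc a b ×ˢ Set.univ :=
  Measure.set_prod_ae_eq Ioc_ae_eq_Icc Filter.EventuallyEq.rfl

theorem ae_scri {ρs ε : ℝ} (hε : 0 ≤ ε) :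
    ∀ᵐ y ∂(((volume : Measure ℝ).prod haarSU2).restrict (Set.Icc 0 ρs ×ˢ Set.univ)),
      ((-1, y.1, y.2) : Pt) ∈ lowerDomain ρs ε ∧ 0 < y.1 := by
  rw [← Measure.restrict_congr_set (Icc_prod_ae_eq_Ioc 0 ρs)]
  filter_upwards [ae_restrict_mem (measurableSet_Ioc.prod MeasurableSet.univ)] with y hy
  refine ⟨⟨le_rfl, by simpa using hε, hy.1.1.le, ?_⟩, hy.1.1⟩
  have := hy.1.2
  simp only
  linarith

theorem mem_lowerDomain_null {ρs ε : ℝ} (hρ : 0 < ρs) (hε : ε < 1) {y : ℝ × SU2}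
    (hy : y ∈ Set.Icc (-1) (-1 + ε) ×ˢ (Set.univ : Set SU2)) :
    ((y.1, 2 * ρs / (1 - y.1), y.2) : Pt) ∈ lowerDomain ρs ε ∧ 0 < 2 * ρs / (1 - y.1) := by
  have h : 0 < 1 - y.1 := by linarith [hy.1.2]
  have h0 : 0 < 2 * ρs / (1 - y.1) := by positivity
  exact ⟨⟨hy.1.1, hy.1.2, h0.le, le_rfl⟩, h0⟩

theorem enorm_comb_sq_le {s t : ℂ} (hs : ‖s‖ ≤ 1) (ht : ‖t‖ ≤ 1) (z v : ℂ) :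
    ‖s * z + t * v‖ₑ ^ 2 ≤ 2 * ‖z‖ₑ ^ 2 + 2 * ‖v‖ₑ ^ 2 := by
  have h1 : ‖s * z + t * v‖ ≤ ‖z‖ + ‖v‖ := by
    refine (norm_add_le _ _).trans ?_
    rw [norm_mul, norm_mul]
    exact add_le_add (mul_le_of_le_one_left (norm_nonneg _) hs)
      (mul_le_of_le_one_left (norm_nonneg _) ht)
  have h2 : ‖s * z + t * v‖ ^ 2 ≤ 2 * ‖z‖ ^ 2 + 2 * ‖v‖ ^ 2 := by
    have := pow_le_pow_left₀ (norm_nonneg _) h1 2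
    nlinarith [sq_nonneg (‖z‖ - ‖v‖)]
  have h3 := ENNReal.ofReal_le_ofReal h2
  rwa [ENNReal.ofReal_add (by positivity) (by positivity), ENNReal.ofReal_mul zero_le_two,
    ENNReal.ofReal_mul zero_le_two, ofReal_norm_sq, ofReal_norm_sq, ofReal_norm_sq,
    ENNReal.ofReal_ofNat] at h3

/-- Additivity of the lower integral needs only one measurable summand. -/
theorem lintegral_le_two_add {X : Type*} [MeasurableSpace X] {μ : Measure X} {F G H : X → ℝ≥0∞}
    (hF : AEMeasurable F μ) (h : ∀ᵐ x ∂μ, H x ≤ 2 * F x + 2 * G x) :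
    ∫⁻ x, H x ∂μ ≤ 2 * ∫⁻ x, F x ∂μ + 2 * ∫⁻ x, G x ∂μ := by
  refine (lintegral_mono_ae h).trans ?_
  rw [lintegral_add_left' (hF.const_mul 2), lintegral_const_mul' _ _ (by simp),
    lintegral_const_mul' _ _ (by simp)]

/-! ### Norms and data of linear combinations, and passage to the normal form of the derivatives -/

section Comb

variable {m p q : ℕ} {i : ℕ × ℕ × (ℕ × ℕ × ℕ)} {ρs ε : ℝ} {f g : Pt → ℂ} {s t : ℂ}

theorem continuousAt_enorm_DD_sq (hi : i ∈ multiIndices m) {x : Pt}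
    (hf : IsCkAt (m + p + q + 1) f x) : ContinuousAt (fun x => ‖DD p q i f x‖ₑ ^ 2) x :=
  (ENNReal.continuous_pow 2).continuousAt.comp (IsCkAt.DD hi hf).continuousAt.enorm

theorem lowerSq_comb_le (hi : i ∈ multiIndices m) (hs : ‖s‖ ≤ 1) (ht : ‖t‖ ≤ 1)
    (hf : ∀ x ∈ lowerDomain ρs ε, 0 < x.2.1 → IsCkAt (m + p + q + 1) f x)
    (hg : ∀ x ∈ lowerDomain ρs ε, 0 < x.2.1 → IsCkAt (m + p + q + 1) g x) :
    lowerSq p q ρs ε i (fun y => s * f y + t * g y) ≤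
      2 * lowerSq p q ρs ε i f + 2 * lowerSq p q ρs ε i g := by
  refine lintegral_le_two_add ?_ ?_
  -- Regularity is known only for ρ > 0; measurability is obtained from continuity there, after
  -- discarding the null set ρ = 0.
  · have hset : (lowerDomain ρs ε ∩ {x | 0 < x.2.1} : Set Pt) =ᵐ[dv] lowerDomain ρs ε := by
      filter_upwards [ae_rho_ne_zero] with x hx
      refine propext ⟨fun h => h.1, fun h => ⟨h, lt_of_le_of_ne h.2.2.1 (Ne.symm hx)⟩⟩
    rw [← Measure.restrict_congr_set hset]
    refine ContinuousOn.aemeasurable (fun x hx => ?_)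
      ((measurableSet_lowerDomain ρs ε).inter
        (measurableSet_lt measurable_const (measurable_fst.comp measurable_snd)))
    exact (continuousAt_enorm_DD_sq hi (hf x hx.1 hx.2)).continuousWithinAt
  · filter_upwards [ae_lowerDomain ρs ε] with x hx
    rw [DD_add_mul hi s t (hf x hx.1 hx.2) (hg x hx.1 hx.2)]
    exact enorm_comb_sq_le hs ht _ _

theorem scriSq_comb_le (hi : i ∈ multiIndices m) (hs : ‖s‖ ≤ 1) (ht : ‖t‖ ≤ 1) (hε : 0 ≤ ε)
    (hf : ∀ x ∈ lowerDomain ρs ε, 0 < x.2.1 → IsCkAt (m + p + q + 1) f x)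
    (hg : ∀ x ∈ lowerDomain ρs ε, 0 < x.2.1 → IsCkAt (m + p + q + 1) g x) :
    scriSq p q ρs i (fun y => s * f y + t * g y) ≤
      2 * scriSq p q ρs i f + 2 * scriSq p q ρs i g := by
  refine lintegral_le_two_add ?_ ?_
  · rw [← Measure.restrict_congr_set (Icc_prod_ae_eq_Ioc 0 ρs)]
    refine ContinuousOn.aemeasurable (fun y hy => ?_) (measurableSet_Ioc.prod MeasurableSet.univ)
    have hm : ((-1, y.1, y.2) : Pt) ∈ lowerDomain ρs ε := by
      refine ⟨le_rfl, by simpa using hε, hy.1.1.le, ?_⟩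
      have := hy.1.2
      simp only
      linarith
    exact (ContinuousAt.comp (f := fun y : ℝ × SU2 => ((-1, y.1, y.2) : Pt)) (x := y)
      (continuousAt_enorm_DD_sq hi (hf _ hm hy.1.1)) (by fun_prop)).continuousWithinAt
  · filter_upwards [ae_scri (ρs := ρs) hε] with y hy
    rw [DD_add_mul hi s t (hf _ hy.1 hy.2) (hg _ hy.1 hy.2)]
    exact enorm_comb_sq_le hs ht _ _

theorem nullSq_comb_le (hi : i ∈ multiIndices m) (hs : ‖s‖ ≤ 1) (ht : ‖t‖ ≤ 1) (hρ : 0 < ρs)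
    (hε : ε < 1) (hf : ∀ x ∈ lowerDomain ρs ε, 0 < x.2.1 → IsCkAt (m + p + q + 1) f x)
    (hg : ∀ x ∈ lowerDomain ρs ε, 0 < x.2.1 → IsCkAt (m + p + q + 1) g x) :
    nullSq p q ρs ε i (fun y => s * f y + t * g y) ≤
      2 * nullSq p q ρs ε i f + 2 * nullSq p q ρs ε i g := by
  have hS : MeasurableSet (Set.Icc (-1) (-1 + ε) ×ˢ (Set.univ : Set SU2)) :=
    measurableSet_Icc.prod MeasurableSet.univ
  have hA : AEMeasurable (fun y : ℝ × SU2 => ‖DD p q i f (y.1, 2 * ρs / (1 - y.1), y.2)‖ₑ ^ 2)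
      (((volume : Measure ℝ).prod haarSU2).restrict (Set.Icc (-1) (-1 + ε) ×ˢ Set.univ)) := by
    refine ContinuousOn.aemeasurable (fun y hy => ?_) hS
    obtain ⟨h1, h2⟩ := mem_lowerDomain_null hρ hε hy
    refine (ContinuousAt.comp (f := fun y : ℝ × SU2 => ((y.1, 2 * ρs / (1 - y.1), y.2) : Pt))
      (x := y) (continuousAt_enorm_DD_sq hi (hf _ h1 h2)) ?_).continuousWithinAt
    have h3 : 1 - y.1 ≠ 0 := by linarith [hy.1.2]
    fun_prop (disch := exact h3)
  have hB : Measurable fun y : ℝ × SU2 => ENNReal.ofReal (nullDensity ρs y.1) := by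
    unfold nullDensity; fun_prop
  refine lintegral_le_two_add (hA.mul hB.aemeasurable) ?_
  filter_upwards [ae_restrict_mem hS] with y hy
  obtain ⟨h1, h2⟩ := mem_lowerDomain_null hρ hε hy
  rw [DD_add_mul hi s t (hf _ h1 h2) (hg _ h1 h2)]
  rw [← mul_assoc, ← mul_assoc, ← add_mul]
  exact mul_le_mul_left (enorm_comb_sq_le hs ht _ _) _

theorem sobolevSq_eq (hf : ∀ x ∈ lowerDomain ρs ε, 0 < x.2.1 → IsCkAt (m + p + q + 1) f x) :
    sobolevSq m (lowerDomain ρs ε) (dRho^[p] (dTau^[q] f)) =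
      ∑ i ∈ multiIndices m, lowerSq p q ρs ε i f := by
  refine Finset.sum_congr rfl fun i hi => lintegral_congr_ae ?_
  have hi' := mem_multiIndices.1 hi
  filter_upwards [ae_lowerDomain ρs ε] with x hx
  rw [(D_dRho_dTau p q i.1 i.2.1 i.2.2 ((hf x hx.1 hx.2).of_le (by omega))).self_of_nhds]
  rfl

theorem scriDataSq_eq (hε : 0 ≤ ε)
    (hf : ∀ x ∈ lowerDomain ρs ε, 0 < x.2.1 → IsCkAt (m + p + q + 1) f x) :
    scriDataSq m ρs (dTau^[q] (dRho^[p] f)) = ∑ i ∈ multiIndices m, scriSq p q ρs i f := by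
  refine Finset.sum_congr rfl fun i hi => lintegral_congr_ae ?_
  have hi' := mem_multiIndices.1 hi
  filter_upwards [ae_scri (ρs := ρs) hε] with y hy
  rw [(D_dTau_dRho p q i.1 i.2.1 i.2.2 ((hf _ hy.1 hy.2).of_le (by omega))).self_of_nhds]
  rfl

theorem nullDataSq_eq (hρ : 0 < ρs) (hε : ε < 1)
    (hf : ∀ x ∈ lowerDomain ρs ε, 0 < x.2.1 → IsCkAt (m + p + q + 1) f x) :
    nullDataSq m ρs ε (dTau^[q] (dRho^[p] f)) = ∑ i ∈ multiIndices m, nullSq p q ρs ε i f := by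
  refine Finset.sum_congr rfl fun i hi =>
    setLIntegral_congr_fun (measurableSet_Icc.prod MeasurableSet.univ) fun y hy => ?_
  have hi' := mem_multiIndices.1 hi
  obtain ⟨h1, h2⟩ := mem_lowerDomain_null hρ hε hy
  rw [(D_dTau_dRho p q i.1 i.2.1 i.2.2 ((hf _ h1 h2).of_le (by omega))).self_of_nhds]
  rfl

end Comb

theorem sum_le_two_add {ι : Type*} {I : Finset ι} {a b c : ι → ℝ≥0∞}
    (h : ∀ i ∈ I, a i ≤ 2 * b i + 2 * c i) :
    ∑ i ∈ I, a i ≤ 2 * ∑ i ∈ I, b i + 2 * ∑ i ∈ I, c i := by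
  refine (Finset.sum_le_sum h).trans ?_
  rw [Finset.sum_add_distrib, Finset.mul_sum, Finset.mul_sum]

theorem XPlus_comb {f g : Pt → ℂ} {x : Pt} (s t : ℂ) (hf : IsCkAt 1 f x) (hg : IsCkAt 1 g x) :
    XPlus (fun y => s * f y + t * g y) x = s * XPlus f x + t * XPlus g x := by
  have h (k : Fin 3) : Z k (fun y => s * f y + t * g y) x = s * Z k f x + t * Z k g x := by
    have h1 := (op_add (hf.const_mul s) (hg.const_mul t) (.ang k)).self_of_nhds
    have h2 := (op_const_mul hf s (.ang k)).self_of_nhds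
    have h3 := (op_const_mul hg t (.ang k)).self_of_nhds
    simp only [op_ang] at h1 h2 h3
    rw [h1, h2, h3]
  simp only [XPlus, h]; ring

theorem XMinus_comb {f g : Pt → ℂ} {x : Pt} (s t : ℂ) (hf : IsCkAt 1 f x) (hg : IsCkAt 1 g x) :
    XMinus (fun y => s * f y + t * g y) x = s * XMinus f x + t * XMinus g x := by
  have h (k : Fin 3) : Z k (fun y => s * f y + t * g y) x = s * Z k f x + t * Z k g x := by
    have h1 := (op_add (hf.const_mul s) (hg.const_mul t) (.ang k)).self_of_nhds
    have h2 := (op_const_mul hf s (.ang k)).self_of_nhds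
    have h3 := (op_const_mul hg t (.ang k)).self_of_nhds
    simp only [op_ang] at h1 h2 h3
    rw [h1, h2, h3]
  simp only [XMinus, h]; ring

theorem nullDer_comb {f g : Pt → ℂ} {x : Pt} (a s t : ℂ) (hf : IsCkAt 1 f x)
    (hg : IsCkAt 1 g x) :
    nullDer a (fun y => s * f y + t * g y) x = s * nullDer a f x + t * nullDer a g x := by
  have h (d : Dir) : d.op (fun y => s * f y + t * g y) x = s * d.op f x + t * d.op g x := by
    have h1 := (op_add (hf.const_mul s) (hg.const_mul t) d).self_of_nhds
    have h2 := (op_const_mul hf s d).self_of_nhds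
    have h3 := (op_const_mul hg t d).self_of_nhds
    simp only at h1 h2 h3
    rw [h1, h2, h3]
  simp only [nullDer, ← op_tau, ← op_rho, h]; ring

end FriedrichCylinder

end

/-! ### Decoupling of the system and assembly of the estimate -/

open FriedrichCylinder
theorem proposition3 (m p q : ℕ) (hq : m + p < q) :
    ∃ C : ℝ, 0 < C ∧
      ∀ (ρs ε : ℝ), 0 < ρs → 0 < ε → ε < 1 →
      ∀ (ψ ψ₀ ψ₁ ψ₂ : Pt → ℂ),
        (∀ f ∈ ({ψ, ψ₀, ψ₁, ψ₂} : Set (Pt → ℂ)), ∀ x ∈ lowerDomain ρs ε, 0 < x.2.1 →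
          IsCkAt (m + p + q + 1) f x) →
        (∀ x ∈ lowerDomain ρs ε, 0 < x.2.1 → TransportEqAt ψ ψ₀ ψ₁ ψ₂ x) →
      ∀ Ω : ℝ, 0 < Ω →
        (∀ f ∈ ({ψ, ψ₀, ψ₁, ψ₂} : Set (Pt → ℂ)),
          scriDataSq m ρs (dTau^[q] (dRho^[p] f))
            + nullDataSq m ρs ε (dTau^[q] (dRho^[p] f)) ≤ ENNReal.ofReal Ω) →
        sobolevSq m (lowerDomain ρs ε) (dRho^[p] (dTau^[q] ψ₀))
          + sobolevSq m (lowerDomain ρs ε) (dRho^[p] (dTau^[q] ψ₁))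
          + sobolevSq m (lowerDomain ρs ε) (dRho^[p] (dTau^[q] ψ)) ≤ ENNReal.ofReal (C * Ω) := by
  -- The first constant is for the pair (ψ₂, ψ₁ + ψ/2), the second for (ψ₁ - ψ/2, ψ₀).
  obtain ⟨C₁, hC₁, h₁⟩ := pair_estimate (m := m) hq (κ := 0) (κ' := 1) le_rfl le_rfl
  obtain ⟨C₂, hC₂, h₂⟩ := pair_estimate (m := m) hq (κ := 1) (κ' := 0) zero_le_one zero_le_one
  refine ⟨25 * (C₁ + C₂), by positivity, ?_⟩
  intro ρs ε hρ hε hε1 ψ ψ₀ ψ₁ ψ₂ hreg heq Ω hΩ hdata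
  simp only [Set.mem_insert_iff, Set.mem_singleton_iff, forall_eq_or_imp, forall_eq] at hreg hdata
  obtain ⟨rψ, r₀, r₁, r₂⟩ := hreg
  obtain ⟨dψ, d₀, d₁, d₂⟩ := hdata
  rw [scriDataSq_eq hε.le rψ, nullDataSq_eq hρ hε1 rψ] at dψ
  rw [scriDataSq_eq hε.le r₀, nullDataSq_eq hρ hε1 r₀] at d₀
  rw [scriDataSq_eq hε.le r₁, nullDataSq_eq hρ hε1 r₁] at d₁
  rw [scriDataSq_eq hε.le r₂, nullDataSq_eq hρ hε1 r₂] at d₂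
  rw [sobolevSq_eq r₀, sobolevSq_eq r₁, sobolevSq_eq rψ]
  -- The combinations ψ₁ ± ψ/2 turn the second and third equations into transport equations for one
  -- unknown each, with sources X₊ψ₂ and X₋ψ₀; they are also the combinations appearing in the first
  -- and fourth.
  set a : Pt → ℂ := fun y => 1 * ψ₁ y + (1 / 2 : ℂ) * ψ y with ha
  set b : Pt → ℂ := fun y => 1 * ψ₁ y + (-(1 / 2) : ℂ) * ψ y with hb
  have n1 : ‖(1 : ℂ)‖ ≤ 1 := by simp
  have n2 : ‖(1 / 2 : ℂ)‖ ≤ 1 := by norm_num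
  have n3 : ‖(-(1 / 2) : ℂ)‖ ≤ 1 := by norm_num
  have n4 : ‖(-1 : ℂ)‖ ≤ 1 := by simp
  have ra : ∀ x ∈ lowerDomain ρs ε, 0 < x.2.1 → IsCkAt (m + p + q + 1) a x := fun x hx hx0 =>
    ((r₁ x hx hx0).const_mul 1).add ((rψ x hx hx0).const_mul (1 / 2))
  have rb : ∀ x ∈ lowerDomain ρs ε, 0 < x.2.1 → IsCkAt (m + p + q + 1) b x := fun x hx hx0 =>
    ((r₁ x hx hx0).const_mul 1).add ((rψ x hx hx0).const_mul (-(1 / 2)))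
  have hψ₁ : ψ₁ = fun y => (1 / 2 : ℂ) * a y + (1 / 2 : ℂ) * b y := by
    funext y; simp only [ha, hb]; ring
  have hψ : ψ = fun y => 1 * a y + (-1 : ℂ) * b y := by
    funext y; simp only [ha, hb]; ring
  have sys : ∀ x ∈ lowerInterior ρs ε, IsCkAt 1 ψ x ∧ IsCkAt 1 ψ₁ x ∧
      TransportEqAt ψ ψ₀ ψ₁ ψ₂ x := fun x hx => by
    obtain ⟨h, h0⟩ := lowerInterior_subset hx
    exact ⟨(rψ x h h0).of_le (by omega), (r₁ x h h0).of_le (by omega), heq x h h0⟩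
  have E₁ := h₁ ρs ε hρ hε hε1 ψ₂ a r₂ ra
    (fun x hx => by
      obtain ⟨c1, c2, e1, -, -, -⟩ := sys x hx
      rw [XMinus_comb _ _ c2 c1]
      simp only [nullDer]
      push_cast
      linear_combination e1)
    (fun x hx => by
      obtain ⟨c1, c2, -, e2, -, -⟩ := sys x hx
      rw [nullDer_comb _ _ _ c2 c1]
      simp only [nullDer, ha]
      push_cast
      linear_combination e2)
  have E₂ := h₂ ρs ε hρ hε hε1 b ψ₀ rb r₀
    (fun x hx => by
      obtain ⟨c1, c2, -, -, e3, -⟩ := sys x hx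
      rw [nullDer_comb _ _ _ c2 c1]
      simp only [nullDer, hb]
      push_cast
      linear_combination e3)
    (fun x hx => by
      obtain ⟨c1, c2, -, -, -, e4⟩ := sys x hx
      rw [XPlus_comb _ _ c2 c1]
      simp only [nullDer]
      push_cast
      linear_combination e4)
  have S₁ := sum_le_two_add fun i hi =>
    scriSq_comb_le (q := q) (p := p) (i := i) hi n1 n2 hε.le r₁ rψ
  have S₂ := sum_le_two_add fun i hi =>
    nullSq_comb_le (q := q) (p := p) (i := i) hi n1 n3 hρ hε1 r₁ rψ
  have L₁ := sum_le_two_add fun i hi =>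
    lowerSq_comb_le (q := q) (p := p) (i := i) hi n2 n2 ra rb
  have L₂ := sum_le_two_add fun i hi =>
    lowerSq_comb_le (q := q) (p := p) (i := i) hi n1 n4 ra rb
  rw [← hψ₁] at L₁
  rw [← hψ] at L₂
  rw [Finset.sum_add_distrib, Finset.sum_add_distrib] at E₁ E₂
  set W := ENNReal.ofReal Ω
  -- A combination of two functions costs 2Ω + 2Ω, and the single function costs Ω.
  have B₁ : ∑ i ∈ multiIndices m, scriSq p q ρs i a + ∑ i ∈ multiIndices m, nullSq p q ρs ε i ψ₂ ≤
      5 * W := by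
    calc _ ≤ (2 * W + 2 * W) + W := by
          refine add_le_add (S₁.trans ?_) (le_add_self.trans d₂)
          gcongr
          · exact le_self_add.trans d₁
          · exact le_self_add.trans dψ
      _ = 5 * W := by ring
  have B₂ : ∑ i ∈ multiIndices m, scriSq p q ρs i ψ₀ + ∑ i ∈ multiIndices m, nullSq p q ρs ε i b ≤
      5 * W := by
    calc _ ≤ W + (2 * W + 2 * W) := by
          refine add_le_add (le_self_add.trans d₀) (S₂.trans ?_)
          gcongr
          · exact le_add_self.trans d₁
          · exact le_add_self.trans dψ
      _ = 5 * W := by ring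
  set K₁ := ENNReal.ofReal C₁
  set K₂ := ENNReal.ofReal C₂
  have F₁ := E₁.trans (mul_le_mul_right B₁ K₁)
  have F₂ := E₂.trans (mul_le_mul_right B₂ K₂)
  have Fa := le_add_self.trans F₁
  have Fb := le_self_add.trans F₂
  have F₀ := le_add_self.trans F₂
  calc _ ≤ K₂ * (5 * W) + (2 * (K₁ * (5 * W)) + 2 * (K₂ * (5 * W))) +
        (2 * (K₁ * (5 * W)) + 2 * (K₂ * (5 * W))) := by
        refine add_le_add (add_le_add F₀ (L₁.trans ?_)) (L₂.trans ?_) <;> gcongr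
    -- ψ₁ and ψ each contribute 10(C₁ + C₂) and ψ₀ contributes 5C₂; rounding up gives the constant
    -- 25(C₁ + C₂).
    _ = (20 * K₁ + 25 * K₂) * W := by ring
    _ ≤ (25 * K₁ + 25 * K₂) * W := by gcongr; norm_num
    _ = ENNReal.ofReal (25 * (C₁ + C₂) * Ω) := by
        rw [ENNReal.ofReal_mul (by positivity), ENNReal.ofReal_mul (by norm_num),
          ENNReal.ofReal_add hC₁.le hC₂.le, mul_add]
        norm_num [K₁, K₂, W]
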